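/- Let $q$ be an odd prime power. For $A\in GL_n(\mathbb F_q)$ let $$F(A)=\bigl|\{B\in GL_n(\mathbb F_q): B^T=B,\ ABA^T=B\}\bigr|,$$ the number of nondegenerate symmetric bilinear forms on $\mathbb F_q^n$ preserved by $A$. Let $\Phi$ be the set of monic irreducible polynomials $f\neq t$ in $\mathbb F_q[t]$, write $d_f=\deg f$, and let $f^*\in\Phi$ be the polynomial whose roots are the inverses of the roots of $f$. For a partition $\lambda=(\lambda_1\ge\dots\ge\lambda_\ell)$ put $|\lambda|=\sum_i\lambda_i$, $n_\lambda=\sum_i(i-1)\lambda_i$, and let $\ell_{odd}(\lambda)$ be the number of odd parts. For a finitely supported map $\boldsymbol\mu$ from $\Phi$ to partitions with $\sum_f d_f|\boldsymbol\mu(f)|=n$, let $c_{\boldsymbol\mu}$ be the conjugacy class of those $A\in GL_n(\mathbb F_q)$ for which $\mathbb F_q^n$, with $t$ acting as $A$, is isomorphic to $\bigoplus_{f\in\Phi}\bigoplus_i\mathbb F_q[t]/(f^{\boldsymbol\mu(f)_i})$ as an $\mathbb F_q[t]$-module. Call $\boldsymbol\mu$ symmetric if $\boldsymbol\mu(f)=\boldsymbol\mu(f^*)$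 for all $f\in\Phi$. The symmetric type of a symmetric $\boldsymbol\mu$ is the tuple $\eta=(\eta_+,\eta_-,\eta_s,\eta_p)$ with $\eta_\pm=\boldsymbol\mu(t\mp1)$ and, for every nonempty partition $\lambda$, $\eta_s(\lambda)$ (respectively $\eta_p(\lambda)$) the partition in which each $d\ge1$ occurs as often as there are $f\in\Phi$ with $f=f^*$, $d_f=2d$, $\boldsymbol\mu(f)=\lambda$ (respectively unordered pairs $\{f,f^*\}$ with $f\ne f^*$, $d_f=d$, $\boldsymbol\mu(f)=\lambda$). **Proposition.** If $\boldsymbol\mu$ is not symmetric, then $F$ vanishes on $c_{\boldsymbol\mu}$. For each symmetric type $\eta$ there is a polynomial $P_\eta\in\mathbb Z[x]$, depending only on $\eta$ (not on $q$ or $\boldsymbol\mu$), such that $F(A)=P_\eta(q)$ for every odd prime power $q$, every symmetric $\boldsymbol\mu$ over $\mathbb F_q$ of symmetric type $\eta$ and every $A\in c_{\boldsymbol\mu}$. If every even part of $\boldsymbol\mu(t-1)$ and of $\boldsymbol\mu(t+1)$ occurs with even multiplicity, then $P_\eta$ is monic of degree $$\tfrac12\sum_{f=t\pm1}\ell_{odd}(\boldsymbol\mu(f))+\sum_{f\in\operatorname{supp}\boldsymbol\mu}d_f\Bigl(n_{\boldsymbol\mu(f)}+\tfrac12|\boldsymbol\mu(f)|\Bigr);$$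 otherwise $P_\eta=0$. -/

import Mathlib

open Polynomial
open scoped DirectSum

/-- Integer partitions, as finite multisets of positive parts. The empty partition is `0`, and the
multiplicity of `d` in `lam` is `lam.count d`. -/
abbrev IntPartition : Type := Multiset ℕ+

namespace IntPartition

/-- The weight: the sum of the parts. -/
def weight (lam : IntPartition) : ℕ := (lam.map (fun d : ℕ+ => (d : ℕ))).sum

/-- The number of odd parts. -/
def lengthOdd (lam : IntPartition) : ℕ := lam.countP (fun d : ℕ+ => Odd (d : ℕ))

/-- The parts in weakly decreasing order. -/
def sortedParts (lam : IntPartition) : List ℕ+ := lam.sort (fun a b => b ≤ a)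

/-- `n_lam = ∑ (i - 1) lam_i` over the parts `lam_1 ≥ lam_2 ≥ ⋯`
(the index of the list starts at `0`). -/
def nStat (lam : IntPartition) : ℕ :=
  ∑ i : Fin lam.sortedParts.length, (i : ℕ) * (lam.sortedParts.get i : ℕ)

end IntPartition

/-- The set `Φ` of monic irreducible polynomials over `K` other than `t`, that is, with nonzero
roots. -/
def Phi (K : Type*) [Field K] : Type _ :=
  {f : K[X] // f.Monic ∧ Irreducible f ∧ f.coeff 0 ≠ 0}

namespace Phi

variable {K : Type*} [Field K]

/-- The degree `d_f`. -/
noncomputable def deg (f : Phi K) : ℕ := f.1.natDegree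

theorem reverse_reverse_of_coeff_zero {f : K[X]} (h : f.coeff 0 ≠ 0) :
    f.reverse.reverse = f := by
  have h0 : f.natTrailingDegree = 0 := natTrailingDegree_eq_zero.2 (Or.inr h)
  have h1 : f.reverse.natDegree = f.natDegree := by rw [reverse_natDegree, h0, Nat.sub_zero]
  ext k
  rw [coeff_reverse, coeff_reverse, h1, revAt_invol]

theorem irreducible_reverse {f : K[X]} (hf : Irreducible f) (h : f.coeff 0 ≠ 0) :
    Irreducible f.reverse := by
  have key : ∀ a : K[X], a.coeff 0 ≠ 0 → IsUnit a.reverse → IsUnit a := by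
    intro a ha hu
    have h0 : a.natTrailingDegree = 0 := natTrailingDegree_eq_zero.2 (Or.inr ha)
    have h1 : a.natDegree = 0 := by
      have := natDegree_eq_zero_of_isUnit hu
      rwa [reverse_natDegree, h0, Nat.sub_zero] at this
    rw [eq_C_of_natDegree_eq_zero h1]
    exact isUnit_C.2 (isUnit_iff_ne_zero.2 ha)
  refine ⟨fun hu => hf.not_isUnit (key f h hu), fun a b hab => ?_⟩
  have h2 : a.coeff 0 * b.coeff 0 ≠ 0 := by
    rw [← mul_coeff_zero, ← hab, coeff_zero_reverse]
    exact leadingCoeff_ne_zero.2 hf.ne_zero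
  have h3 : f = a.reverse * b.reverse := by
    rw [← reverse_mul_of_domain, ← hab, reverse_reverse_of_coeff_zero h]
  exact (hf.isUnit_or_isUnit h3).imp (key a (left_ne_zero_of_mul h2))
    (key b (right_ne_zero_of_mul h2))

/-- The dual `f* = f(0)⁻¹ t ^ {d_f} f(t⁻¹)`: the monic irreducible polynomial whose roots are the
inverses of the roots of `f`. -/
noncomputable def star (f : Phi K) : Phi K :=
  ⟨C (f.1.coeff 0)⁻¹ * f.1.reverse, by
    obtain ⟨f, hm, hi, h0⟩ := f
    have ht : f.natTrailingDegree = 0 := natTrailingDegree_eq_zero.2 (Or.inr h0)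
    refine ⟨?_, ?_, ?_⟩
    · rw [Monic, leadingCoeff_mul, leadingCoeff_C, reverse_leadingCoeff, trailingCoeff, ht]
      exact inv_mul_cancel₀ h0
    · exact (irreducible_isUnit_mul (isUnit_C.2 (isUnit_iff_ne_zero.2 (inv_ne_zero h0)))).2
        (irreducible_reverse hi h0)
    · rw [coeff_C_mul, coeff_zero_reverse]
      exact mul_ne_zero (inv_ne_zero h0) (leadingCoeff_ne_zero.2 hi.ne_zero)⟩

/-- The element `t - a` of `Φ`, for `a ≠ 0`. -/
noncomputable def linear (a : Kˣ) : Phi K :=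
  ⟨X - C (a : K), monic_X_sub_C _, irreducible_X_sub_C _, by simp⟩

end Phi

section ConjugacyClasses

variable {K : Type*} [Field K]

/-- The conjugacy class `c_μ` in `GL_n(K)` of a finitely supported map `μ : Φ → {partitions}`: the
matrices `A` such that `K ^ n`, with `t` acting as `A`, is isomorphic as a `K[t]`-module to the
direct sum of the `K[t] / (f ^ {lam_i})` over `f ∈ Φ` and the parts `lam_i` of `μ(f)`. -/
def conjClass (n : ℕ) (μ : Phi K →₀ IntPartition) : Set (GL (Fin n) K) :=
  {A | Nonempty (Module.AEval' (Matrix.toLin' (A : Matrix (Fin n) (Fin n) K)) ≃ₗ[K[X]]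
    ⨁ f : Phi K, ⨁ i : (μ f).ToType, (K[X] ⧸ Ideal.span {f.1 ^ (i.1 : ℕ)}))}

/-- `μ` is symmetric: `μ(f) = μ(f*)` for all `f ∈ Φ`. -/
def IsSymmetricMap (μ : Phi K →₀ IntPartition) : Prop := ∀ f, μ f = μ f.star

/-- Every even part of `μ(t - 1)` and of `μ(t + 1)` has even multiplicity. -/
def EvenPartsPaired (μ : Phi K →₀ IntPartition) : Prop :=
  ∀ d : ℕ+, Even (d : ℕ) →
    Even ((μ (Phi.linear 1)).count d) ∧ Even ((μ (Phi.linear (-1))).count d)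

/-- Symmetric types `(η_+, η_-, η_s, η_p)`. The partitions `η_s(lam) = (1 ^ {m_1} 2 ^ {m_2} ⋯)` and
`η_p(lam)`, for `lam` a nonempty partition, are recorded by their multiplicities `d ↦ m_d`. -/
@[ext]
structure SymType where
  plus : IntPartition
  minus : IntPartition
  selfDual : {lam : IntPartition // lam ≠ 0} → ℕ+ → ℕ
  pairs : {lam : IntPartition // lam ≠ 0} → ℕ+ → ℕ

/-- The symmetric type of `μ`: `η_± = μ(t ∓ 1)`, `m_d` of `η_s(lam)` is the number of self-dual `f`
of degree `2 d` with `μ(f) = lam`, and `m_d` of `η_p(lam)` is the number of unordered pairs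
`{f, f*}` with `f ≠ f*` of degree `d` and `μ(f) = lam`. -/
noncomputable def symType (μ : Phi K →₀ IntPartition) : SymType where
  plus := μ (Phi.linear 1)
  minus := μ (Phi.linear (-1))
  selfDual lam d := {f : Phi K | f.star = f ∧ f.deg = 2 * (d : ℕ) ∧ μ f = lam.1}.ncard
  pairs lam d := {P : Sym2 (Phi K) | ∃ f : Phi K,
    P = s(f, f.star) ∧ f.star ≠ f ∧ f.deg = (d : ℕ) ∧ μ f = lam.1}.ncard

/-- The number
`½ ∑_{f = t ± 1} ℓ_odd(μ(f)) + ∑_{f ∈ supp μ} d_f (n_{μ(f)} + ½ |μ(f)|)`. -/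
noncomputable def degFormula (μ : Phi K →₀ IntPartition) : ℚ :=
  1 / 2 * (((μ (Phi.linear 1)).lengthOdd : ℚ) + ((μ (Phi.linear (-1))).lengthOdd : ℚ)) +
    ∑ f ∈ μ.support, (f.deg : ℚ) * (((μ f).nStat : ℚ) + 1 / 2 * ((μ f).weight : ℚ))

/-- `F(A)`: the number of invertible symmetric matrices `B` with `A B Aᵀ = B`. -/
noncomputable def formCount {n : ℕ} (A : GL (Fin n) K) : ℕ :=
  Nat.card {B : GL (Fin n) K // (B : Matrix (Fin n) (Fin n) K).transpose = B ∧
    (A : Matrix (Fin n) (Fin n) K) * B * (A : Matrix (Fin n) (Fin n) K).transpose = B}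

end ConjugacyClasses

/-! Inverting B turns F(A) into the number of nondegenerate symmetric forms β on V = K^n with β(Ax,
Ay) = β(x, y) (`formCount_eq_invFormCount`). For such a form the adjoint of p(A) is, up to a power
of A, the reversed polynomial at A (`pairing_aeval_apply`). Hence ker f(A)^m and ker f*(A)^m have
the same dimension for all m; as these dimensions determine μ(f) and μ(f*), no form exists unless μ
is symmetric. Moreover the f- and g-primary components are orthogonal unless g = f*, so F(A) is a
product over the orbits {f, f*} (`invFormCount_supportEnd`).

Each orbit is reduced to linear algebra over a residue field. Let R = K[t]/(f^N) with uniformizer π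
and residue field F, and write the f-component as the sum of the R/(π^{k_i}). Once t acts by its
inverse on the second factor, an invariant pairing is an R-balanced one, so it is Σ ℓ_ij(x_i y_j)
for functionals ℓ_ij on R that kill π^{min(k_i,k_j)}. Their leading coefficients, read through the
trace form of F/K, form a block triangular matrix, and the pairing is separating exactly when its
diagonal blocks, one for each part size a, are invertible (`separating_iff`,
`det_coefMatrix_ne_zero`). All other coefficients are free and contribute powers of q.

For f ≠ f* the blocks are arbitrary invertible matrices. For f = f* the involution σ : t ↦ t⁻¹ acts
on R, and since 2 is invertible π can be chosen with σπ = δπ, δ = ±1 (`exists_involution`). Symmetry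
of the form reads ℓ_ji = ℓ_ij ∘ σ and makes the block of part size a a δ^{a-1}-hermitian matrix for
the residual involution τ. For f = t ∓ 1 one has τ = id and δ = -1, so odd parts give symmetric and
even parts alternating blocks; an even part of odd multiplicity leaves no form. Every other
self-dual f has even degree 2d and τ ≠ id, and both signs have q^d hermitian scalars.

Symmetric, alternating and hermitian matrices are counted by one recursion, `nondegSeq`, obtained
from Schur complements. It is polynomial in q, and monic except that it vanishes for alternating
matrices of odd size. The exponents depend only on the symmetric type, which gives `formPoly`; the
degrees add up because the sum of min(k_i, k_j) over j < i is n_λ for decreasing parts. -/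

/-! ### Invertible `ε`-hermitian matrices over a finite field -/

/-- The sequence counting nondegenerate `ε`-hermitian forms, in terms of the number `s` of
`ε`-hermitian scalars and the number `Q` of all scalars. -/
def nondegSeq {A : Type*} [CommRing A] (s Q : A) : ℕ → A
  | 0 => 1
  | 1 => s - 1
  | m + 2 => (s - 1) * Q ^ (m + 1) * nondegSeq s Q (m + 1) +
      (Q ^ (m + 1) - 1) * (s * Q ^ m * nondegSeq s Q m)

/-- Allows the recursion to be run in ℤ[X] and evaluated at a power of q afterwards. -/
theorem map_nondegSeq {A B : Type*} [CommRing A] [CommRing B] (φ : A →+* B) (s Q : A) (m : ℕ) :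
    φ (nondegSeq s Q m) = nondegSeq (φ s) (φ Q) m := by
  induction m using nondegSeq.induct with
  | case1 => simp [nondegSeq]
  | case2 => simp [nondegSeq]
  | case3 m h1 h2 => simp [nondegSeq, h1, h2]

section EpsHermitian

variable {F : Type*} [Field F] (σ : F →+* F) (ε : F)

/-- `B` is `ε`-hermitian with respect to `σ`. -/
def IsEpsHermitian {ι : Type*} (B : Matrix ι ι F) : Prop := ∀ i j, B j i = ε * σ (B i j)

/-- The number of invertible `ε`-hermitian matrices with rows and columns indexed by `ι`. -/
noncomputable def nondegCount (ι : Type*) [Fintype ι] [DecidableEq ι] : ℕ :=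
  Nat.card {B : Matrix ι ι F // IsEpsHermitian σ ε B ∧ B.det ≠ 0}

variable {σ ε}

theorem isEpsHermitian_reindex {ι κ : Type*} (e : ι ≃ κ) (B : Matrix ι ι F) :
    IsEpsHermitian σ ε (Matrix.reindex e e B) ↔ IsEpsHermitian σ ε B := by
  refine ⟨fun h i j => ?_, fun h i j => h _ _⟩
  simpa using h (e i) (e j)

theorem nondegCount_congr {ι κ : Type*} [Fintype ι] [DecidableEq ι] [Fintype κ] [DecidableEq κ]
    (e : ι ≃ κ) : nondegCount σ ε ι = nondegCount σ ε κ :=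
  Nat.card_congr ((Matrix.reindex e e).subtypeEquiv fun B => by
    rw [isEpsHermitian_reindex, Matrix.det_reindex_self])

theorem isEpsHermitian_iff {ι : Type*} (B : Matrix ι ι F) :
    IsEpsHermitian σ ε B ↔ B = ε • (B.map σ).transpose := by
  constructor
  · intro h; ext i j; exact h j i
  · intro h i j; exact congrFun (congrFun h j) i

/-- The lower left block of an `ε`-hermitian matrix with upper right block `b`. -/
def epsAdjoint (σ : F →+* F) (ε : F) {ι κ : Type*} (b : Matrix ι κ F) : Matrix κ ι F :=
  ε • (b.map σ).transpose

theorem isEpsHermitian_fromBlocks (hσ : ∀ a, σ (σ a) = a) (hε : ε * σ ε = 1)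
    {ι κ : Type*} (A : Matrix ι ι F) (b : Matrix ι κ F) (c : Matrix κ ι F) (D : Matrix κ κ F) :
    IsEpsHermitian σ ε (Matrix.fromBlocks A b c D) ↔
      IsEpsHermitian σ ε A ∧ c = epsAdjoint σ ε b ∧ IsEpsHermitian σ ε D := by
  constructor
  · intro h
    refine ⟨fun i j => h (.inl i) (.inl j), ?_, fun i j => h (.inr i) (.inr j)⟩
    ext i j
    exact h (.inl j) (.inr i)
  · rintro ⟨hA, rfl, hD⟩ (i | i) (j | j)
    · exact hA i j
    · rfl
    · simp only [Matrix.fromBlocks_apply₁₂, Matrix.fromBlocks_apply₂₁, epsAdjoint,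
        Matrix.smul_apply, Matrix.transpose_apply, Matrix.map_apply, smul_eq_mul, map_mul, hσ]
      rw [← mul_assoc, hε, one_mul]
    · exact hD i j

theorem IsEpsHermitian.sub {ι : Type*} {B C : Matrix ι ι F} (hB : IsEpsHermitian σ ε B)
    (hC : IsEpsHermitian σ ε C) : IsEpsHermitian σ ε (B - C) := fun i j => by
  simp only [Matrix.sub_apply, map_sub, mul_sub, ← hB i j, ← hC i j]

theorem IsEpsHermitian.add {ι : Type*} {B C : Matrix ι ι F} (hB : IsEpsHermitian σ ε B)
    (hC : IsEpsHermitian σ ε C) : IsEpsHermitian σ ε (B + C) := fun i j => by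
  simp only [Matrix.add_apply, map_add, mul_add, ← hB i j, ← hC i j]

/-- Under conjugate transposition A acquires ε⁻¹ and A⁻¹ acquires ε, so the triple product acquires
ε⁻¹ · ε · ε⁻¹, which the outer ε cancels. Invertibility of A is not needed: a singular matrix has
inverse 0. -/
theorem isEpsHermitian_schur (hσ : ∀ a, σ (σ a) = a) (hε : ε * σ ε = 1)
    {ι κ : Type*} [Fintype ι] [DecidableEq ι] {A : Matrix ι ι F} (hA : IsEpsHermitian σ ε A)
    (b : Matrix ι κ F) :
    IsEpsHermitian σ ε (epsAdjoint σ ε b * A⁻¹ * b) := by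
  have hε0 : ε ≠ 0 := left_ne_zero_of_mul (hε ▸ one_ne_zero)
  have hσε : σ ε = ε⁻¹ := eq_inv_of_mul_eq_one_right hε
  rw [isEpsHermitian_iff] at hA ⊢
  have h1 : (A.map σ).transpose = ε⁻¹ • A := by
    conv_rhs => rw [hA]
    rw [smul_smul, inv_mul_cancel₀ hε0, one_smul]
  have h2 : ((A⁻¹).map σ).transpose = ε • A⁻¹ := by
    have : (A⁻¹).map σ = (A.map σ)⁻¹ := by
      by_cases hd : IsUnit A.det
      · refine (Matrix.inv_eq_left_inv ?_).symm
        rw [← Matrix.map_mul, Matrix.nonsing_inv_mul _ hd]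
        simp
      · have h3 : ¬ IsUnit (A.map σ).det := by
          rw [isUnit_iff_ne_zero, not_not] at hd ⊢
          rw [show A.map σ = σ.mapMatrix A from rfl, ← RingHom.map_det, hd, map_zero]
        rw [Matrix.nonsing_inv_apply_not_isUnit _ hd, Matrix.nonsing_inv_apply_not_isUnit _ h3]
        ext; simp
    rw [this, Matrix.transpose_nonsing_inv, h1]
    by_cases hd : IsUnit A.det
    · refine Matrix.inv_eq_left_inv ?_
      rw [smul_mul_smul_comm, Matrix.nonsing_inv_mul _ hd, mul_inv_cancel₀ hε0, one_smul]
    · have h3 : ¬ IsUnit (ε⁻¹ • A).det := by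
        rw [isUnit_iff_ne_zero, not_not] at hd ⊢
        rw [Matrix.det_smul, hd, mul_zero]
      rw [Matrix.nonsing_inv_apply_not_isUnit _ hd, Matrix.nonsing_inv_apply_not_isUnit _ h3,
        smul_zero]
  have h3 : ((epsAdjoint σ ε b).map σ).transpose = ε⁻¹ • b := by
    ext i j
    simp [epsAdjoint, hσ, hσε]
  have h4 : (b.map σ).transpose = ε⁻¹ • epsAdjoint σ ε b := by
    rw [epsAdjoint, smul_smul, inv_mul_cancel₀ hε0, one_smul]
  rw [Matrix.map_mul, Matrix.map_mul, Matrix.transpose_mul, Matrix.transpose_mul, h2, h3, h4]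
  simp only [Matrix.smul_mul, Matrix.mul_smul, smul_smul, Matrix.mul_assoc]
  rw [show ε * (ε⁻¹ * ε * ε⁻¹) = 1 by field_simp, one_smul]

/-- The determinant is det A times that of the Schur complement D - b*A⁻¹b, and translation by the
ε-hermitian matrix b*A⁻¹b is a bijection. The count therefore does not depend on b. -/
theorem card_schur (hσ : ∀ a, σ (σ a) = a) (hε : ε * σ ε = 1)
    {ι κ : Type*} [Fintype ι] [DecidableEq ι] [Fintype κ] [DecidableEq κ]
    {A : Matrix ι ι F} (hA : IsEpsHermitian σ ε A) (hdet : A.det ≠ 0) (b : Matrix ι κ F) :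
    Nat.card {D : Matrix κ κ F // IsEpsHermitian σ ε D ∧
      (Matrix.fromBlocks A b (epsAdjoint σ ε b) D).det ≠ 0} = nondegCount σ ε κ := by
  have hX := isEpsHermitian_schur hσ hε hA b
  refine Nat.card_congr ((Equiv.subRight (epsAdjoint σ ε b * A⁻¹ * b)).subtypeEquiv fun D => ?_)
  let _ : Invertible A := Matrix.invertibleOfIsUnitDet A (isUnit_iff_ne_zero.2 hdet)
  rw [Matrix.det_fromBlocks₁₁, Matrix.invOf_eq_nonsing_inv, Equiv.subRight_apply]
  refine and_congr ⟨fun h => h.sub hX, fun h => ?_⟩ (by simp [hdet])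
  simpa using h.add hX

/-- Block decomposition of `ε`-hermitian matrices. -/
def epsHermitianBlocks (hσ : ∀ a, σ (σ a) = a) (hε : ε * σ ε = 1) (ι κ : Type*)
    (P : Matrix (ι ⊕ κ) (ι ⊕ κ) F → Prop) :
    {B : Matrix (ι ⊕ κ) (ι ⊕ κ) F // IsEpsHermitian σ ε B ∧ P B} ≃
      Σ (x : {A : Matrix ι ι F // IsEpsHermitian σ ε A} × Matrix ι κ F),
        {D : Matrix κ κ F // IsEpsHermitian σ ε D ∧
          P (Matrix.fromBlocks x.1.1 x.2 (epsAdjoint σ ε x.2) D)} where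
  toFun B :=
    have h := (isEpsHermitian_fromBlocks hσ hε B.1.toBlocks₁₁ B.1.toBlocks₁₂ B.1.toBlocks₂₁
      B.1.toBlocks₂₂).1 (by rw [Matrix.fromBlocks_toBlocks]; exact B.2.1)
    ⟨(⟨B.1.toBlocks₁₁, h.1⟩, B.1.toBlocks₁₂), B.1.toBlocks₂₂, h.2.2, by
      have h2 := B.2.2
      rwa [← Matrix.fromBlocks_toBlocks B.1, h.2.1] at h2⟩
  invFun x := ⟨Matrix.fromBlocks x.1.1.1 x.1.2 (epsAdjoint σ ε x.1.2) x.2.1,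
    (isEpsHermitian_fromBlocks hσ hε _ _ _ _).2 ⟨x.1.1.2, rfl, x.2.2.1⟩, x.2.2.2⟩
  left_inv B := by
    have h := (isEpsHermitian_fromBlocks hσ hε B.1.toBlocks₁₁ B.1.toBlocks₁₂ B.1.toBlocks₂₁
      B.1.toBlocks₂₂).1 (by rw [Matrix.fromBlocks_toBlocks]; exact B.2.1)
    ext1
    simp only
    rw [← h.2.1, Matrix.fromBlocks_toBlocks]
  right_inv x := rfl

theorem card_isEpsHermitian_unit :
    Nat.card {A : Matrix Unit Unit F // IsEpsHermitian σ ε A} =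
      Nat.card {a : F // a = ε * σ a} := by
  refine Nat.card_congr
    { toFun := fun A => ⟨A.1 () (), A.2 () ()⟩
      invFun := fun a => ⟨fun _ _ => a.1, fun _ _ => a.2⟩
      left_inv := fun A => rfl
      right_inv := fun a => rfl }

variable [Finite F]

/-- Choose i₀ with b(i₀) ≠ 0. The zero corner together with the index i₀ spans a 2 × 2 block with
determinant -ε b(i₀) σ(b(i₀)) ≠ 0, whatever its last diagonal entry. That entry and the other m
entries of row i₀ are thus free, and the Schur complement of the block has size m. -/
theorem card_corner_zero (hσ : ∀ a, σ (σ a) = a) (hε : ε * σ ε = 1)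
    {κ : Type*} [Fintype κ] [DecidableEq κ] (b : Matrix Unit κ F) (hb : b ≠ 0) (m : ℕ)
    (hm : Fintype.card κ = m + 1) :
    Nat.card {D : Matrix κ κ F // IsEpsHermitian σ ε D ∧
      (Matrix.fromBlocks (0 : Matrix Unit Unit F) b (epsAdjoint σ ε b) D).det ≠ 0} =
      Nat.card {a : F // a = ε * σ a} * Nat.card F ^ m * nondegCount σ ε (Fin m) := by
  classical
  obtain ⟨i₀, hi₀⟩ : ∃ i, b () i ≠ 0 := by
    by_contra! h
    exact hb (by ext i j; exact h j)
  have hcard : Fintype.card {j // j ≠ i₀} = m := by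
    rw [Fintype.card_subtype_compl, Fintype.card_subtype_eq, hm]; rfl
  let e : κ ≃ Unit ⊕ {j // j ≠ i₀} :=
    (Equiv.sumCompl (fun j => j = i₀)).symm.trans
      (Equiv.sumCongr (Equiv.ofUnique _ _) (Equiv.refl _))
  have he : e.symm (.inl ()) = i₀ := rfl
  let b' : Matrix Unit (Unit ⊕ {j // j ≠ i₀}) F := fun u x => b u (e.symm x)
  have step1 : Nat.card {D : Matrix κ κ F // IsEpsHermitian σ ε D ∧
      (Matrix.fromBlocks (0 : Matrix Unit Unit F) b (epsAdjoint σ ε b) D).det ≠ 0} =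
      Nat.card {D : Matrix (Unit ⊕ {j // j ≠ i₀}) (Unit ⊕ {j // j ≠ i₀}) F //
        IsEpsHermitian σ ε D ∧
        (Matrix.fromBlocks (0 : Matrix Unit Unit F) b' (epsAdjoint σ ε b') D).det ≠ 0} := by
    refine Nat.card_congr ((Matrix.reindex e e).subtypeEquiv fun D => ?_)
    rw [isEpsHermitian_reindex]
    have : Matrix.fromBlocks (0 : Matrix Unit Unit F) b' (epsAdjoint σ ε b')
        (Matrix.reindex e e D) = Matrix.reindex ((Equiv.refl Unit).sumCongr e)
          ((Equiv.refl Unit).sumCongr e)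
          (Matrix.fromBlocks (0 : Matrix Unit Unit F) b (epsAdjoint σ ε b) D) := by
      ext (i | i) (j | j) <;> rfl
    rw [this, Matrix.det_reindex_self]
  have := Fintype.ofFinite F
  have := Fintype.ofFinite {A : Matrix Unit Unit F // IsEpsHermitian σ ε A}
  rw [step1, Nat.card_congr (epsHermitianBlocks hσ hε _ _ (fun D =>
    (Matrix.fromBlocks (0 : Matrix Unit Unit F) b' (epsAdjoint σ ε b') D).det ≠ 0)),
    Nat.card_sigma]
  have step2 : ∀ x : {A : Matrix Unit Unit F // IsEpsHermitian σ ε A} ×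
      Matrix Unit {j // j ≠ i₀} F, Nat.card {D : Matrix {j // j ≠ i₀} {j // j ≠ i₀} F //
        IsEpsHermitian σ ε D ∧ (Matrix.fromBlocks (0 : Matrix Unit Unit F) b' (epsAdjoint σ ε b')
          (Matrix.fromBlocks x.1.1 x.2 (epsAdjoint σ ε x.2) D)).det ≠ 0} =
      nondegCount σ ε (Fin m) := by
    intro x
    let A : Matrix (Unit ⊕ Unit) (Unit ⊕ Unit) F := Matrix.fromBlocks (0 : Matrix Unit Unit F)
      (fun _ _ => b () i₀) (epsAdjoint σ ε fun _ _ => b () i₀) x.1.1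
    let c : Matrix (Unit ⊕ Unit) {j // j ≠ i₀} F :=
      fun u j => Sum.elim (fun _ => b () j.1) (fun _ => x.2 () j) u
    have hA : IsEpsHermitian σ ε A :=
      (isEpsHermitian_fromBlocks hσ hε _ _ _ _).2 ⟨fun i j => by simp, rfl, x.1.2⟩
    have hε0 : ε ≠ 0 := left_ne_zero_of_mul (hε ▸ one_ne_zero)
    have hdet : A.det ≠ 0 := by
      have : A.det = - (b () i₀ * (ε * σ (b () i₀))) := by
        rw [← Matrix.det_reindex_self (Equiv.boolEquivPUnitSumPUnit.symm.trans finTwoEquiv.symm),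
          Matrix.det_fin_two]
        change 0 * x.1.1 () () - b () i₀ * (ε * σ (b () i₀)) = _
        ring
      rw [this]
      exact neg_ne_zero.2 (mul_ne_zero hi₀ (mul_ne_zero hε0 ((map_ne_zero σ).2 hi₀)))
    rw [← nondegCount_congr (Fintype.equivFinOfCardEq hcard), ← card_schur hσ hε hA hdet c]
    refine Nat.card_congr (Equiv.subtypeEquivRight fun D => and_congr_right fun _ => ?_)
    -- Regrouping the indices makes the invertible 2 × 2 corner a leading block, to which
    -- `card_schur` applies.
    rw [← Matrix.det_reindex_self (Equiv.sumAssoc Unit Unit {j // j ≠ i₀}).symm]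
    have : Matrix.reindex (Equiv.sumAssoc Unit Unit {j // j ≠ i₀}).symm
        (Equiv.sumAssoc Unit Unit {j // j ≠ i₀}).symm
        (Matrix.fromBlocks (0 : Matrix Unit Unit F) b' (epsAdjoint σ ε b')
          (Matrix.fromBlocks x.1.1 x.2 (epsAdjoint σ ε x.2) D)) =
        Matrix.fromBlocks A c (epsAdjoint σ ε c) D := by
      ext ((i | i) | i) ((j | j) | j) <;> rfl
    rw [this]
  rw [Finset.sum_congr rfl fun x _ => step2 x, Finset.sum_const, smul_eq_mul, Finset.card_univ,
    ← Nat.card_eq_fintype_card, Nat.card_prod, card_isEpsHermitian_unit]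
  congr 2
  rw [Matrix, Nat.card_fun, Nat.card_fun]
  rw [Nat.card_eq_fintype_card (α := {j // j ≠ i₀}), hcard]
  simp

/-- Splits by the first diagonal entry. If it is nonzero, b is free and the Schur complement has
index set κ; if it is zero, each b ≠ 0 contributes N. Keeping N as a parameter covers empty κ, where
no such b exists. -/
theorem nondegCount_unit_sum (hσ : ∀ a, σ (σ a) = a) (hε : ε * σ ε = 1)
    (κ : Type*) [Fintype κ] [DecidableEq κ] (N : ℕ)
    (hN : ∀ b : Matrix Unit κ F, b ≠ 0 → Nat.card {D : Matrix κ κ F // IsEpsHermitian σ ε D ∧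
      (Matrix.fromBlocks (0 : Matrix Unit Unit F) b (epsAdjoint σ ε b) D).det ≠ 0} = N) :
    (nondegCount σ ε (Unit ⊕ κ) : ℤ) =
      (Nat.card {a : F // a = ε * σ a} - 1) * (Nat.card F : ℤ) ^ Fintype.card κ *
        nondegCount σ ε κ + ((Nat.card F : ℤ) ^ Fintype.card κ - 1) * N := by
  classical
  have := Fintype.ofFinite F
  have := Fintype.ofFinite {A : Matrix Unit Unit F // IsEpsHermitian σ ε A}
  rw [nondegCount, Nat.card_congr (epsHermitianBlocks hσ hε _ _ (fun D => D.det ≠ 0)),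
    Nat.card_sigma]
  have hb : Fintype.card (Matrix Unit κ F) = Nat.card F ^ Fintype.card κ := by
    rw [← Nat.card_eq_fintype_card, Matrix, Nat.card_fun, Nat.card_fun]
    simp [← Nat.card_eq_fintype_card]
  let z : {A : Matrix Unit Unit F // IsEpsHermitian σ ε A} := ⟨0, fun i j => by simp⟩
  rw [Fintype.sum_prod_type, ← Finset.add_sum_erase _ _ (Finset.mem_univ z)]
  have h1 : ∀ A ∈ Finset.univ.erase z, ∑ b : Matrix Unit κ F,
      Nat.card {D : Matrix κ κ F // IsEpsHermitian σ ε D ∧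
        (Matrix.fromBlocks A.1 b (epsAdjoint σ ε b) D).det ≠ 0} =
      Nat.card F ^ Fintype.card κ * nondegCount σ ε κ := by
    intro A hA
    have hA0 : A.1.det ≠ 0 := by
      rw [Matrix.det_unique]
      intro h
      refine (Finset.mem_erase.1 hA).1 (Subtype.ext ?_)
      ext i j; exact h
    rw [Finset.sum_congr rfl fun b _ => card_schur hσ hε A.2 hA0 b, Finset.sum_const, smul_eq_mul,
      Finset.card_univ, hb]
  have h2 : ∑ b : Matrix Unit κ F, Nat.card {D : Matrix κ κ F // IsEpsHermitian σ ε D ∧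
        (Matrix.fromBlocks z.1 b (epsAdjoint σ ε b) D).det ≠ 0} =
      (Nat.card F ^ Fintype.card κ - 1) * N := by
    rw [← Finset.add_sum_erase _ _ (Finset.mem_univ (0 : Matrix Unit κ F)),
      Finset.sum_congr rfl fun b hb => hN b (Finset.mem_erase.1 hb).1, Finset.sum_const,
      smul_eq_mul, Finset.card_erase_of_mem (Finset.mem_univ _), Finset.card_univ, hb]
    -- For b = 0 the first row of the block matrix is zero, so this term vanishes.
    convert zero_add _
    rw [Nat.card_eq_zero]
    left
    refine ⟨fun D => D.2.2 (Matrix.det_eq_zero_of_row_eq_zero (Sum.inl ()) ?_)⟩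
    rintro (j | j) <;> rfl
  rw [h2, Finset.sum_congr rfl h1, Finset.sum_const, smul_eq_mul,
    Finset.card_erase_of_mem (Finset.mem_univ _), Finset.card_univ,
    ← Nat.card_eq_fintype_card (α := {A : Matrix Unit Unit F // IsEpsHermitian σ ε A}),
    card_isEpsHermitian_unit]
  have hs : 1 ≤ Nat.card {a : F // a = ε * σ a} := by
    have : Nonempty {a : F // a = ε * σ a} := ⟨⟨0, by simp⟩⟩
    exact Nat.card_pos
  have hq : 1 ≤ Nat.card F ^ Fintype.card κ := Nat.one_le_pow _ _ Nat.card_pos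
  push_cast [Nat.cast_sub hs, Nat.cast_sub hq]
  ring

theorem nondegCount_eq_nondegSeq (hσ : ∀ a, σ (σ a) = a) (hε : ε * σ ε = 1)
    (ι : Type*) [Fintype ι] [DecidableEq ι] :
    (nondegCount σ ε ι : ℤ) =
      nondegSeq (Nat.card {a : F // a = ε * σ a} : ℤ) (Nat.card F : ℤ) (Fintype.card ι) := by
  rw [nondegCount_congr (Fintype.equivFin ι)]
  generalize Fintype.card ι = m
  have hstep : ∀ m, nondegCount σ ε (Fin (m + 1)) = nondegCount σ ε (Unit ⊕ Fin m) := fun m =>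
    nondegCount_congr (Fintype.equivOfCardEq (by simp [add_comm]))
  induction m using nondegSeq.induct with
  | case1 =>
    rw [nondegSeq, nondegCount, Nat.cast_eq_one, Nat.card_eq_one_iff_unique]
    exact ⟨⟨fun a b => Subtype.ext (Subsingleton.elim _ _)⟩, ⟨⟨0, fun i => i.elim0, by simp⟩⟩⟩
  | case2 =>
    rw [hstep, nondegCount_unit_sum hσ hε (Fin 0) 0 fun b hb => (hb (by ext i j; exact j.elim0)).elim]
    have : nondegCount σ ε (Fin 0) = 1 := by
      rw [nondegCount, Nat.card_eq_one_iff_unique]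
      exact ⟨⟨fun a b => Subtype.ext (Subsingleton.elim _ _)⟩, ⟨⟨0, fun i => i.elim0, by simp⟩⟩⟩
    simp [nondegSeq, this]
  | case3 m h1 h2 =>
    rw [hstep, nondegCount_unit_sum hσ hε (Fin (m + 1)) _ fun b hb =>
      card_corner_zero hσ hε b hb m (by simp), nondegSeq, Fintype.card_fin, h1, ← h2]
    push_cast
    ring

end EpsHermitian


/-! ### Functionals on a uniserial algebra -/

/-- The fibres of φ over T inside S are cosets of the kernel, so a condition on φ(g) alone can be
counted in T. All counts by leading coefficients rest on this. -/
theorem card_subtype_and_eq_mul {G H : Type*} [AddCommGroup G] [AddCommGroup H] (φ : G →+ H)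
    (S : AddSubgroup G) (T : AddSubgroup H) (hST : ∀ g ∈ S, φ g ∈ T)
    (hsurj : ∀ h ∈ T, ∃ g ∈ S, φ g = h) (D : H → Prop) :
    Nat.card {g // g ∈ S ∧ D (φ g)} =
      Nat.card {g // g ∈ S ∧ φ g = 0} * Nat.card {h // h ∈ T ∧ D h} := by
  choose! s hs hs' using hsurj
  rw [← Nat.card_prod]
  refine Nat.card_congr
    { toFun := fun g => (⟨g.1 - s (φ g.1), S.sub_mem g.2.1 (hs _ (hST _ g.2.1)), by
        rw [map_sub, hs' _ (hST _ g.2.1), sub_self]⟩, ⟨φ g.1, hST _ g.2.1, g.2.2⟩)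
      invFun := fun x => ⟨x.1.1 + s x.2.1, S.add_mem x.1.2.1 (hs _ x.2.2.1), by
        rw [map_add, x.1.2.2, hs' _ x.2.2.1, zero_add]; exact x.2.2.2⟩
      left_inv := fun g => Subtype.ext (sub_add_cancel _ _)
      right_inv := ?_ }
  rintro ⟨⟨g, hg⟩, ⟨h, hh⟩⟩
  have : φ (g + s h) = h := by rw [map_add, hg.2, hs' _ hh.1, zero_add]
  simp [this]

/-- A `K`-algebra `R` with a surjection `ρ` onto a field `F` whose kernel is generated by `π`, and
such that `π` can be cancelled in divisibilities by powers of `π` up to the `N`-th. -/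
structure Uniformized (K R F : Type*) [Field K] [CommRing R] [Algebra K R] [Field F] [Algebra K F]
    (N : ℕ) where
  ρ : R →ₐ[K] F
  π : R
  surj : Function.Surjective ρ
  ker : ∀ u, ρ u = 0 ↔ π ∣ u
  cancel : ∀ a b u, a + b ≤ N → π ^ (a + b) ∣ π ^ b * u → π ^ a ∣ u

namespace Uniformized

variable {K R F : Type*} [Field K] [CommRing R] [Algebra K R] [Field F] [Algebra K F] {N : ℕ}
  (D : Uniformized K R F N)

/-- The functionals that vanish on the ideal generated by `π ^ a`. -/
def ann (a : ℕ) : Submodule K (Module.Dual K R) where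
  carrier := {ℓ | ∀ u, ℓ (D.π ^ a * u) = 0}
  add_mem' h h' u := by rw [LinearMap.add_apply, h, h', add_zero]
  zero_mem' _ := rfl
  smul_mem' c ℓ h u := by rw [LinearMap.smul_apply, h, smul_zero]

theorem ann_mono {a b : ℕ} (h : a ≤ b) : D.ann a ≤ D.ann b := fun ℓ hℓ u => by
  obtain ⟨c, rfl⟩ := Nat.exists_eq_add_of_le h
  rw [pow_add, mul_assoc]
  exact hℓ _

theorem apply_eq_zero {a : ℕ} {ℓ : Module.Dual K R} (h : ℓ ∈ D.ann a) {u : R}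
    (hu : D.π ^ a ∣ u) : ℓ u = 0 := by
  obtain ⟨v, rfl⟩ := hu
  exact h v

theorem mem_ann_zero {ℓ : Module.Dual K R} : ℓ ∈ D.ann 0 ↔ ℓ = 0 := by
  refine ⟨fun h => LinearMap.ext fun u => by simpa using h u, ?_⟩
  rintro rfl
  exact Submodule.zero_mem _

variable [FiniteDimensional K F] [Algebra.IsSeparable K F]

/-- The trace form is nondegenerate because F/K is separable. Composition with a linear section of ρ
makes κ linear on all functionals, although its values have a meaning only on those that factor
through ρ. -/
theorem exists_coef : ∃ κ : Module.Dual K R →ₗ[K] F,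
    (∀ ψ : Module.Dual K R, (∀ u, ρ D u = 0 → ψ u = 0) →
      ∀ u, ψ u = Algebra.trace K F (κ ψ * D.ρ u)) ∧
    ∀ (ψ : Module.Dual K R) (c : F), (∀ u, ψ u = Algebra.trace K F (c * D.ρ u)) → κ ψ = c := by
  obtain ⟨s, hs⟩ := LinearMap.exists_rightInverse_of_surjective D.ρ.toLinearMap
    (LinearMap.range_eq_top.2 D.surj)
  have hs' : ∀ y, D.ρ (s y) = y := fun y => LinearMap.congr_fun hs y
  let e := LinearMap.BilinForm.toDual (Algebra.traceForm K F) (traceForm_nondegenerate K F)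
  have he : ∀ c y, e c y = Algebra.trace K F (c * y) := fun c y => rfl
  refine ⟨e.symm.toLinearMap ∘ₗ s.dualMap, fun ψ hψ u => ?_, fun ψ c h => ?_⟩
  · rw [← he]
    simp only [LinearMap.comp_apply, LinearEquiv.coe_coe, LinearEquiv.apply_symm_apply,
      LinearMap.dualMap_apply]
    rw [← sub_eq_zero, ← map_sub]
    exact hψ _ (by rw [map_sub, hs', sub_self])
  · rw [LinearMap.comp_apply, LinearEquiv.coe_coe, LinearEquiv.symm_apply_eq]
    ext y
    rw [he, LinearMap.dualMap_apply, h, hs']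

/-- The element of `F` that represents a functional on `F` through the trace form. -/
noncomputable def coef : Module.Dual K R →ₗ[K] F := D.exists_coef.choose

/-- The leading coefficient of a functional that vanishes on the multiples of `π ^ (a + 1)`. -/
noncomputable def topCoef (a : ℕ) : Module.Dual K R →ₗ[K] F :=
  D.coef ∘ₗ (LinearMap.mulLeft K (D.π ^ a)).dualMap

theorem apply_eq_trace {a : ℕ} {ℓ : Module.Dual K R} (h : ℓ ∈ D.ann (a + 1)) (u : R) :
    ℓ (D.π ^ a * u) = Algebra.trace K F (D.topCoef a ℓ * D.ρ u) := by
  refine D.exists_coef.choose_spec.1 ((LinearMap.mulLeft K (D.π ^ a)).dualMap ℓ) (fun u hu => ?_) u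
  obtain ⟨v, rfl⟩ := (D.ker u).1 hu
  rw [LinearMap.dualMap_apply, LinearMap.mulLeft_apply, ← mul_assoc, ← pow_succ]
  exact h v

theorem topCoef_eq {a : ℕ} {ℓ : Module.Dual K R} {c : F}
    (h : ∀ u, ℓ (D.π ^ a * u) = Algebra.trace K F (c * D.ρ u)) : D.topCoef a ℓ = c :=
  D.exists_coef.choose_spec.2 _ _ h

theorem topCoef_eq_zero {a : ℕ} {ℓ : Module.Dual K R} (h : ℓ ∈ D.ann a) : D.topCoef a ℓ = 0 :=
  D.topCoef_eq fun u => by rw [h, zero_mul, map_zero]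

theorem topCoef_eq_zero_iff {a : ℕ} {ℓ : Module.Dual K R} (h : ℓ ∈ D.ann (a + 1)) :
    D.topCoef a ℓ = 0 ↔ ℓ ∈ D.ann a := by
  refine ⟨fun h0 u => ?_, D.topCoef_eq_zero⟩
  rw [D.apply_eq_trace h, h0, zero_mul, map_zero]

/-- By `cancel`, π^a u ∈ (π^{a+1}) forces ρ(u) = 0. Hence u ↦ Tr(c ρ(u)) factors through
multiplication by π^a into R/(π^{a+1}), and a functional on the image extends to the whole space. -/
theorem exists_topCoef_eq {a : ℕ} (ha : a + 1 ≤ N) (c : F) :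
    ∃ ℓ ∈ D.ann (a + 1), D.topCoef a ℓ = c := by
  let g : R →ₗ[K] R ⧸ (Ideal.span {D.π ^ (a + 1)}) :=
    (Ideal.Quotient.mkₐ K (Ideal.span {D.π ^ (a + 1)})).toLinearMap ∘ₗ
      LinearMap.mulLeft K (D.π ^ a)
  have hg : ∀ u, g u = Ideal.Quotient.mk _ (D.π ^ a * u) := fun u => rfl
  let ψ : Module.Dual K R := Algebra.trace K F ∘ₗ LinearMap.mulLeft K c ∘ₗ D.ρ.toLinearMap
  have hψ : ψ ∈ g.ker.dualAnnihilator := by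
    rw [Submodule.mem_dualAnnihilator]
    intro u hu
    rw [LinearMap.mem_ker, hg, Ideal.Quotient.eq_zero_iff_mem, Ideal.mem_span_singleton,
      add_comm] at hu
    have h1 := D.cancel 1 a u (by omega) hu
    rw [pow_one, ← D.ker] at h1
    change Algebra.trace K F (c * D.ρ u) = 0
    rw [h1, mul_zero, map_zero]
  rw [← LinearMap.range_dualMap_eq_dualAnnihilator_ker] at hψ
  obtain ⟨χ, hχ⟩ := hψ
  refine ⟨χ ∘ₗ (Ideal.Quotient.mkₐ K (Ideal.span {D.π ^ (a + 1)})).toLinearMap, fun u => ?_,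
    D.topCoef_eq fun u => LinearMap.congr_fun hχ u⟩
  have : Ideal.Quotient.mk (Ideal.span {D.π ^ (a + 1)}) (D.π ^ (a + 1) * u) = 0 := by
    rw [Ideal.Quotient.eq_zero_iff_mem, Ideal.mem_span_singleton]
    exact dvd_mul_right _ _
  change χ (Ideal.Quotient.mk _ (D.π ^ (a + 1) * u)) = 0
  rw [this, map_zero]

/-- Induction along the filtration: `topCoef a` maps `ann (a + 1)` onto F with kernel `ann a`. -/
theorem card_ann {a : ℕ} (ha : a ≤ N) : Nat.card (D.ann a) = Nat.card F ^ a := by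
  induction a with
  | zero =>
    rw [pow_zero, Nat.card_eq_one_iff_unique]
    exact ⟨⟨fun x y => Subtype.ext ((D.mem_ann_zero.1 x.2).trans (D.mem_ann_zero.1 y.2).symm)⟩,
      inferInstance⟩
  | succ a ih =>
    have := card_subtype_and_eq_mul (D.topCoef a).toAddMonoidHom (D.ann (a + 1)).toAddSubgroup ⊤
      (fun _ _ => trivial) (fun c _ => D.exists_topCoef_eq ha c) (fun _ => True)
    rw [pow_succ, ← ih (by omega)]
    refine Eq.trans ?_ (this.trans ?_)
    · exact Nat.card_congr (Equiv.subtypeEquivRight fun ℓ => by simp)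
    · congr 1
      · refine Nat.card_congr (Equiv.subtypeEquivRight fun ℓ => ⟨fun h => ?_, fun h => ⟨?_, ?_⟩⟩)
        · exact (D.topCoef_eq_zero_iff h.1).1 h.2
        · exact D.ann_mono (Nat.le_succ a) h
        · exact D.topCoef_eq_zero h
      · exact Nat.card_congr ((Equiv.subtypeEquivRight fun ℓ => by simp).trans
          (Equiv.Set.univ F))

/-! ### Leading coefficient matrices of families of functionals. -/

variable {I : Type*} (k : I → ℕ)

/-- The exponents of the families of functionals that describe the pairings. -/
def minExp (i j : I) : ℕ := min (k i) (k j)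

/-- The exponents of the families with vanishing leading coefficients. -/
def subExp (i j : I) : ℕ := if k i = k j then k i - 1 else min (k i) (k j)

/-- The matrix of leading coefficients of a family of functionals. -/
noncomputable def coefMatrix (ℓ : I → I → Module.Dual K R) : Matrix I I F :=
  Matrix.of fun i j => D.topCoef (k i - 1) (ℓ i j)

variable {k}

/-- Row i reads the coefficient at π^{k_i - 1}. If k_j < k_i, then ℓ_ij vanishes on the multiples of
π^{k_j}, hence on those of π^{k_i - 1}. -/
theorem coefMatrix_blockTriangular {ℓ : I → I → Module.Dual K R}
    (hℓ : ∀ i j, ℓ i j ∈ D.ann (minExp k i j)) : (D.coefMatrix k ℓ).BlockTriangular k := by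
  intro i j hij
  refine D.topCoef_eq_zero (D.ann_mono ?_ (hℓ i j))
  rw [minExp, min_eq_right hij.le]
  omega

variable (k) in
/-- The diagonal blocks of the matrix of leading coefficients. -/
noncomputable def blocks [Fintype I] : (I → I → Module.Dual K R) →+
    ∀ a : Finset.univ.image k, Matrix {i // k i = a} {i // k i = a} F where
  toFun ℓ a := (D.coefMatrix k ℓ).toSquareBlock k a
  map_zero' := by
    ext a i j
    exact map_zero (D.topCoef (k i.1 - 1))
  map_add' ℓ ℓ' := by
    ext a i j
    exact map_add (D.topCoef (k i.1 - 1)) _ _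

theorem det_coefMatrix_ne_zero [Fintype I] [DecidableEq I] {ℓ : I → I → Module.Dual K R}
    (hℓ : ∀ i j, ℓ i j ∈ D.ann (minExp k i j)) :
    (D.coefMatrix k ℓ).det ≠ 0 ↔ ∀ a : Finset.univ.image k, (D.blocks k ℓ a).det ≠ 0 := by
  rw [(D.coefMatrix_blockTriangular hℓ).det, Finset.prod_ne_zero_iff]
  exact ⟨fun h a => h a.1 a.2, fun h a ha => h ⟨a, ha⟩⟩

theorem subExp_le_minExp (i j : I) : subExp k i j ≤ minExp k i j := by
  unfold subExp minExp
  split_ifs with h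
  · rw [h, min_self]; omega
  · rfl

theorem minExp_of_eq (hk : ∀ i, 0 < k i) {i j : I} (h : k i = k j) :
    minExp k i j = k i - 1 + 1 := by
  have := hk i
  rw [minExp, ← h, min_self]; omega

theorem subExp_of_eq {i j : I} (h : k i = k j) : subExp k i j = k i - 1 := if_pos h

theorem subExp_of_ne {i j : I} (h : k i ≠ k j) : subExp k i j = minExp k i j := if_neg h

/-- A vanishing leading coefficient lowers the exponent by one at the positions with k_i = k_j; the
other positions lie in no diagonal block and keep their exponent. -/
theorem blocks_eq_zero_iff [Fintype I] (hk : ∀ i, 0 < k i) {ℓ : I → I → Module.Dual K R}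
    (hℓ : ∀ i j, ℓ i j ∈ D.ann (minExp k i j)) :
    D.blocks k ℓ = 0 ↔ ∀ i j, ℓ i j ∈ D.ann (subExp k i j) := by
  constructor
  · intro h i j
    by_cases hij : k i = k j
    · have := congrFun (congrFun (congrFun h ⟨k i, Finset.mem_image_of_mem k (Finset.mem_univ i)⟩)
        ⟨i, rfl⟩) ⟨j, hij.symm⟩
      rw [subExp_of_eq hij]
      refine (D.topCoef_eq_zero_iff ?_).1 this
      rw [← minExp_of_eq hk hij]
      exact hℓ i j
    · rw [subExp_of_ne hij]
      exact hℓ i j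
  · intro h
    ext a i j
    refine D.topCoef_eq_zero ?_
    have := h i.1 j.1
    rwa [subExp_of_eq (i.2.trans j.2.symm)] at this

theorem exists_blocks_eq [Fintype I] (hk : ∀ i, 0 < k i) (hN : ∀ i, k i ≤ N)
    (B : ∀ a : Finset.univ.image k, Matrix {i // k i = a} {i // k i = a} F) :
    ∃ ℓ : I → I → Module.Dual K R, (∀ i j, ℓ i j ∈ D.ann (minExp k i j)) ∧
      D.blocks k ℓ = B := by
  have h : ∀ i j, ∃ ℓ ∈ D.ann (minExp k i j), ∀ h : k j = k i, D.topCoef (k i - 1) ℓ =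
      B ⟨k i, Finset.mem_image_of_mem k (Finset.mem_univ i)⟩ ⟨i, rfl⟩ ⟨j, h⟩ := by
    intro i j
    by_cases hij : k j = k i
    · obtain ⟨ℓ, hℓ, h⟩ := D.exists_topCoef_eq (a := k i - 1)
        (by have := hk i; have := hN i; omega)
        (B ⟨k i, Finset.mem_image_of_mem k (Finset.mem_univ i)⟩ ⟨i, rfl⟩ ⟨j, hij⟩)
      refine ⟨ℓ, ?_, fun _ => h⟩
      rwa [minExp_of_eq hk hij.symm]
    -- The position (i, j) lies in no diagonal block, so any functional would do.
    · exact ⟨0, Submodule.zero_mem _, fun h => (hij h).elim⟩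
  choose ℓ hℓ hB using h
  refine ⟨ℓ, hℓ, ?_⟩
  funext a
  ext ⟨i, hi⟩ ⟨j, hj⟩
  obtain ⟨a, ha⟩ := a
  change k i = a at hi
  subst hi
  exact hB i j hj

variable (k) in
/-- The families of functionals that vanish to the orders `a i j`. -/
def family (a : I → I → ℕ) : AddSubgroup (I → I → Module.Dual K R) where
  carrier := {ℓ | ∀ i j, ℓ i j ∈ D.ann (a i j)}
  add_mem' h h' i j := Submodule.add_mem _ (h i j) (h' i j)
  zero_mem' _ _ := Submodule.zero_mem _
  neg_mem' h i j := Submodule.neg_mem _ (h i j)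

/-- Invertibility depends only on the diagonal blocks, which take all values; the families over the
zero blocks are those with exponents `subExp`. -/
theorem card_family_det_ne_zero [Fintype I] [DecidableEq I] (hk : ∀ i, 0 < k i)
    (hN : ∀ i, k i ≤ N) :
    Nat.card {ℓ : I → I → Module.Dual K R // (∀ i j, ℓ i j ∈ D.ann (minExp k i j)) ∧
      (D.coefMatrix k ℓ).det ≠ 0} =
    Nat.card F ^ (∑ i, ∑ j, subExp k i j) * ∏ a ∈ Finset.univ.image k,
      Nat.card {B : Matrix {i // k i = a} {i // k i = a} F // B.det ≠ 0} := by
  have h := card_subtype_and_eq_mul (D.blocks k) (D.family (minExp k)) ⊤ (fun _ _ => trivial)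
    (fun B _ => D.exists_blocks_eq hk hN B) (fun B => ∀ a, (B a).det ≠ 0)
  rw [Nat.card_congr (Equiv.subtypeEquivRight fun ℓ => and_congr_right fun hℓ =>
    D.det_coefMatrix_ne_zero hℓ)]
  refine h.trans ?_
  congr 1
  · rw [Nat.card_congr (β := ∀ i j, D.ann (subExp k i j))]
    · rw [Nat.card_pi, ← Finset.prod_pow_eq_pow_sum]
      refine Finset.prod_congr rfl fun i _ => ?_
      rw [Nat.card_pi, ← Finset.prod_pow_eq_pow_sum]
      refine Finset.prod_congr rfl fun j _ => D.card_ann ?_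
      exact (subExp_le_minExp i j).trans ((min_le_left _ _).trans (hN i))
    · exact
        { toFun := fun ℓ i j => ⟨ℓ.1 i j, (D.blocks_eq_zero_iff hk ℓ.2.1).1 ℓ.2.2 i j⟩
          invFun := fun ℓ =>
            have hℓ : ∀ i j, (ℓ i j).1 ∈ D.ann (minExp k i j) := fun i j =>
              D.ann_mono (subExp_le_minExp i j) (ℓ i j).2
            ⟨fun i j => (ℓ i j).1, hℓ, (D.blocks_eq_zero_iff hk hℓ).2 fun i j => (ℓ i j).2⟩
          left_inv := fun ℓ => rfl
          right_inv := fun ℓ => rfl }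
  · rw [← Finset.prod_coe_sort, ← Nat.card_pi]
    exact Nat.card_congr ((Equiv.subtypeEquivRight fun B => and_iff_right trivial).trans
      (Equiv.subtypePiEquivPi (p := fun (a : Finset.univ.image k)
        (B : Matrix {i // k i = a.1} {i // k i = a.1} F) => B.det ≠ 0)))

end Uniformized


/-! ### Symmetric families of functionals -/

/-- An involution `σ` of a uniformized algebra for which `π` is an eigenvector. -/
structure Uniformized.Involution {K R F : Type*} [Field K] [CommRing R] [Algebra K R] [Field F]
    [Algebra K F] {N : ℕ} (D : Uniformized K R F N) where
  σ : R →ₐ[K] R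
  τ : F →ₐ[K] F
  δ : K
  invol : ∀ u, σ (σ u) = u
  compat : ∀ u, D.ρ (σ u) = τ (D.ρ u)
  map_pi : σ D.π = algebraMap K R δ * D.π
  sq : δ * δ = 1

namespace Uniformized.Involution

variable {K R F : Type*} [Field K] [CommRing R] [Algebra K R] [Field F] [Algebra K F] {N : ℕ}
  {D : Uniformized K R F N} (S : D.Involution)

theorem invol_residue (c : F) : S.τ (S.τ c) = c := by
  obtain ⟨u, rfl⟩ := D.surj c
  rw [← S.compat, ← S.compat, S.invol]

/-- The sign `δ ^ a`, in `F`. -/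
def sign (a : ℕ) : F := algebraMap K F (S.δ ^ a)

theorem sign_mul (a : ℕ) : S.sign a * (S.τ : F →+* F) (S.sign a) = 1 := by
  have h : S.δ ^ a * S.δ ^ a = 1 := by rw [← mul_pow, S.sq, one_pow]
  rw [sign, RingHom.coe_coe, AlgHom.commutes, ← map_mul, h, map_one]

theorem map_pi_pow (a : ℕ) : S.σ (D.π ^ a) = algebraMap K R (S.δ ^ a) * D.π ^ a := by
  rw [map_pow, S.map_pi, mul_pow, map_pow]

theorem pi_pow_dvd_map {a : ℕ} {u : R} (h : D.π ^ a ∣ u) : D.π ^ a ∣ S.σ u := by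
  obtain ⟨v, rfl⟩ := h
  rw [map_mul, map_pi_pow, mul_assoc]
  exact ((dvd_mul_right _ _).mul_left _)

theorem pi_pow_dvd_map_iff {a : ℕ} {u : R} : D.π ^ a ∣ S.σ u ↔ D.π ^ a ∣ u :=
  ⟨fun h => S.invol u ▸ S.pi_pow_dvd_map h, S.pi_pow_dvd_map⟩

theorem comp_mem_ann {a : ℕ} {ℓ : Module.Dual K R} (h : ℓ ∈ D.ann a) :
    ℓ ∘ₗ S.σ.toLinearMap ∈ D.ann a := fun _ =>
  D.apply_eq_zero h (S.pi_pow_dvd_map (dvd_mul_right _ _))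

theorem trace_residue (c : F) : Algebra.trace K F (S.τ c) = Algebra.trace K F c :=
  Algebra.trace_eq_of_algEquiv (AlgEquiv.ofAlgHom S.τ S.τ (AlgHom.ext S.invol_residue)
    (AlgHom.ext S.invol_residue)) c

theorem comp_comp (ℓ : Module.Dual K R) :
    (ℓ ∘ₗ S.σ.toLinearMap) ∘ₗ S.σ.toLinearMap = ℓ :=
  LinearMap.ext fun u => congrArg ℓ (S.invol u)

variable [FiniteDimensional K F] [Algebra.IsSeparable K F]

/-- Since σ(π^a u) = δ^a π^a σ(u) and the trace is τ-invariant, σ twists the leading coefficient by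
δ^a τ. For δ = -1 this sign changes with the parity of a, which is why odd and even parts behave
differently at t ∓ 1. -/
theorem topCoef_comp {a : ℕ} {ℓ : Module.Dual K R} (h : ℓ ∈ D.ann (a + 1)) :
    D.topCoef a (ℓ ∘ₗ S.σ.toLinearMap) = S.sign a * S.τ (D.topCoef a ℓ) := by
  refine D.topCoef_eq fun u => ?_
  have h1 : (ℓ ∘ₗ S.σ.toLinearMap) (D.π ^ a * u) = S.δ ^ a • ℓ (D.π ^ a * S.σ u) := by
    rw [LinearMap.comp_apply, AlgHom.toLinearMap_apply, map_mul, map_pi_pow, mul_assoc,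
      ← Algebra.smul_def, map_smul]
  rw [h1, D.apply_eq_trace h, S.compat, ← S.trace_residue, map_mul, S.invol_residue, sign,
    ← Algebra.smul_def, smul_mul_assoc, map_smul]

/-- The functionals in `ann a` that are invariant under `σ`. -/
def fixedAnn (a : ℕ) : AddSubgroup (Module.Dual K R) where
  carrier := {ℓ | ℓ ∈ D.ann a ∧ ℓ = ℓ ∘ₗ S.σ.toLinearMap}
  add_mem' h h' := ⟨Submodule.add_mem _ h.1 h'.1, by
    rw [LinearMap.add_comp, ← h.2, ← h'.2]⟩
  zero_mem' := ⟨Submodule.zero_mem _, by rw [LinearMap.zero_comp]⟩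
  neg_mem' h := ⟨Submodule.neg_mem _ h.1, by rw [LinearMap.neg_comp, ← h.2]⟩

/-- The elements of `F` with `c = δ ^ a * τ c`. -/
def signFixed (a : ℕ) : AddSubgroup F where
  carrier := {c | c = S.sign a * (S.τ : F →+* F) c}
  add_mem' {c c'} h h' := by
    change c + c' = _
    rw [map_add, mul_add, ← h, ← h']
  zero_mem' := by simp
  neg_mem' {c} h := by
    change -c = _
    rw [map_neg, mul_neg, ← h]

theorem half_add_half (h2 : (2 : K) ≠ 0) {V : Type*} [AddCommGroup V] [Module K V] (v : V) :
    (2 : K)⁻¹ • (v + v) = v := by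
  rw [← two_smul K v, smul_smul, inv_mul_cancel₀ h2, one_smul]

/-- The filtration of `card_ann`, restricted to invariant functionals: the leading coefficient at
π^b satisfies c = δ^b τ(c), and every such c is lifted by averaging ℓ and ℓ ∘ σ. -/
theorem card_fixedAnn (h2 : (2 : K) ≠ 0) {a : ℕ} (ha : a ≤ N) :
    Nat.card (S.fixedAnn a) = ∏ b ∈ Finset.range a, Nat.card (S.signFixed b) := by
  induction a with
  | zero =>
    rw [Finset.prod_range_zero, Nat.card_eq_one_iff_unique]
    exact ⟨⟨fun x y => Subtype.ext ((D.mem_ann_zero.1 x.2.1).trans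
      (D.mem_ann_zero.1 y.2.1).symm)⟩, inferInstance⟩
  | succ a ih =>
    have := card_subtype_and_eq_mul (D.topCoef a).toAddMonoidHom (S.fixedAnn (a + 1))
      (S.signFixed a) (fun ℓ hℓ => (congrArg _ hℓ.2).trans (S.topCoef_comp hℓ.1)) (fun c hc => by
        obtain ⟨ℓ, hℓ, rfl⟩ := D.exists_topCoef_eq ha c
        refine ⟨(2 : K)⁻¹ • (ℓ + ℓ ∘ₗ S.σ.toLinearMap), ⟨Submodule.smul_mem _ _
          (Submodule.add_mem _ hℓ (S.comp_mem_ann hℓ)), ?_⟩, ?_⟩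
        · rw [LinearMap.smul_comp, LinearMap.add_comp, comp_comp, add_comm]
        · change D.topCoef a _ = _
          rw [map_smul, map_add, S.topCoef_comp hℓ]
          conv_rhs => rw [← half_add_half h2 (D.topCoef a ℓ)]
          congr 2
          exact hc.symm) (fun _ => True)
    rw [Finset.prod_range_succ, ← ih (by omega)]
    refine Eq.trans ?_ (this.trans ?_)
    · exact Nat.card_congr (Equiv.subtypeEquivRight fun ℓ => (and_iff_left trivial).symm)
    · congr 1
      · refine Nat.card_congr (Equiv.subtypeEquivRight fun ℓ => ⟨fun h => ⟨?_, h.1.2⟩,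
          fun h => ⟨⟨?_, h.2⟩, ?_⟩⟩)
        · exact (D.topCoef_eq_zero_iff h.1.1).1 h.2
        · exact D.ann_mono (Nat.le_succ a) h.1
        · exact D.topCoef_eq_zero h.1
      · exact Nat.card_congr (Equiv.subtypeEquivRight fun ℓ => and_iff_left trivial)

variable {I : Type*}

/-- The symmetric families of functionals that vanish to the orders `a i j`. -/
def symFamily (a : I → I → ℕ) : AddSubgroup (I → I → Module.Dual K R) where
  carrier := {ℓ | (∀ i j, ℓ i j ∈ D.ann (a i j)) ∧ ∀ i j, ℓ j i = ℓ i j ∘ₗ S.σ.toLinearMap}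
  add_mem' {ℓ ℓ'} h h' := ⟨fun i j => Submodule.add_mem _ (h.1 i j) (h'.1 i j), fun i j => by
    change ℓ j i + ℓ' j i = (ℓ i j + ℓ' i j) ∘ₗ _
    rw [LinearMap.add_comp, ← h.2, ← h'.2]⟩
  zero_mem' := ⟨fun _ _ => Submodule.zero_mem _, fun i j => by
    change 0 = 0 ∘ₗ _
    rw [LinearMap.zero_comp]⟩
  neg_mem' {ℓ} h := ⟨fun i j => Submodule.neg_mem _ (h.1 i j), fun i j => by
    change -ℓ j i = (-ℓ i j) ∘ₗ _
    rw [LinearMap.neg_comp, ← h.2]⟩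

/-- The entries with j < i are free and determine those with i < j, while the diagonal entries must
be σ-invariant. -/
theorem card_symFamily [Fintype I] [LinearOrder I] (h2 : (2 : K) ≠ 0) {a : I → I → ℕ}
    (ha : ∀ i j, a i j = a j i) (hN : ∀ i j, a i j ≤ N) :
    Nat.card (S.symFamily a) = Nat.card F ^ (∑ i, ∑ j with j < i, a i j) *
      ∏ i, ∏ b ∈ Finset.range (a i i), Nat.card (S.signFixed b) := by
  have e : S.symFamily a ≃ (∀ p : Σ i : I, {j // j < i}, D.ann (a p.1 p.2)) ×
      ∀ i, S.fixedAnn (a i i) :=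
    { toFun := fun ℓ => (fun p => ⟨ℓ.1 p.1 p.2, ℓ.2.1 _ _⟩,
        fun i => ⟨ℓ.1 i i, ℓ.2.1 i i, ℓ.2.2 i i⟩)
      invFun := fun x => ⟨fun i j => if h : j < i then (x.1 ⟨i, j, h⟩).1 else
          if h : i < j then (x.1 ⟨j, i, h⟩).1 ∘ₗ S.σ.toLinearMap else (x.2 i).1, by
        refine ⟨fun i j => ?_, fun i j => ?_⟩
        · rcases lt_trichotomy j i with h | rfl | h
          · simp only [h, dif_pos]
            exact (x.1 ⟨i, j, h⟩).2
          · simp only [lt_irrefl, dif_neg, not_false_eq_true]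
            exact (x.2 j).2.1
          · simp only [h, h.not_gt, dif_pos, dif_neg, not_false_eq_true]
            rw [ha]
            exact S.comp_mem_ann (x.1 ⟨j, i, h⟩).2
        · rcases lt_trichotomy j i with h | rfl | h
          · simp only [h, h.not_gt, dif_pos, dif_neg, not_false_eq_true]
          · simp only [lt_irrefl, dif_neg, not_false_eq_true]
            exact (x.2 j).2.2
          · simp only [h, h.not_gt, dif_pos, dif_neg, not_false_eq_true, comp_comp]⟩
      left_inv := fun ℓ => by
        ext1
        funext i j
        rcases lt_trichotomy j i with h | rfl | h
        · simp only [h, dif_pos]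
        · simp only [lt_irrefl, dif_neg, not_false_eq_true]
        · simp only [h, h.not_gt, dif_pos, dif_neg, not_false_eq_true]
          exact (ℓ.2.2 j i).symm
      right_inv := fun x => by
        refine Prod.ext (funext fun p => Subtype.ext ?_) (funext fun i => Subtype.ext ?_)
        · simp only [p.2.2, dif_pos]
        · simp only [lt_irrefl, dif_neg, not_false_eq_true] }
  rw [Nat.card_congr e, Nat.card_prod, Nat.card_pi, Nat.card_pi]
  congr 1
  · rw [Fintype.prod_sigma, ← Finset.prod_pow_eq_pow_sum]
    refine Finset.prod_congr rfl fun i _ => ?_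
    rw [← Finset.prod_pow_eq_pow_sum, Finset.prod_subtype _ (p := fun j => j < i) (by simp)]
    exact Finset.prod_congr rfl fun j _ => D.card_ann (hN _ _)
  · exact Finset.prod_congr rfl fun i _ => S.card_fixedAnn h2 (hN i i)

variable {k : I → ℕ}

theorem minExp_comm (i j : I) : minExp k i j = minExp k j i := min_comm _ _

theorem subExp_comm (i j : I) : subExp k i j = subExp k j i := by
  by_cases h : k i = k j
  · rw [subExp_of_eq h, subExp_of_eq h.symm, h]
  · rw [subExp_of_ne h, subExp_of_ne (Ne.symm h), minExp_comm]

variable (k) in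
/-- The families of `δ ^ (a - 1)`-hermitian blocks. -/
def hermitianBlocks [Fintype I] :
    AddSubgroup (∀ a : Finset.univ.image k, Matrix {i // k i = a} {i // k i = a} F) where
  carrier := {B | ∀ a : Finset.univ.image k, IsEpsHermitian (S.τ : F →+* F) (S.sign (a - 1)) (B a)}
  add_mem' h h' a := (h a).add (h' a)
  zero_mem' a i j := by simp
  neg_mem' {B} h a i j := by
    change -B a j i = _ * (S.τ : F →+* F) (-B a i j)
    rw [map_neg, mul_neg, ← h a i j]

/-- By `topCoef_comp` the diagonal blocks are δ^{a-1}-hermitian. Conversely, averaging any lift of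
hermitian blocks with its σ-transpose makes it symmetric and leaves the blocks unchanged. -/
theorem card_symFamily_det_ne_zero [Fintype I] [LinearOrder I] (h2 : (2 : K) ≠ 0)
    (hk : ∀ i, 0 < k i) (hN : ∀ i, k i ≤ N) :
    Nat.card {ℓ : I → I → Module.Dual K R // ℓ ∈ S.symFamily (minExp k) ∧
      (D.coefMatrix k ℓ).det ≠ 0} =
    Nat.card F ^ (∑ i, ∑ j with j < i, subExp k i j) *
      (∏ i, ∏ b ∈ Finset.range (k i - 1), Nat.card (S.signFixed b)) *
      ∏ a ∈ Finset.univ.image k,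
        nondegCount (S.τ : F →+* F) (S.sign (a - 1)) {i // k i = a} := by
  have hmin : ∀ i j, subExp k i j ≤ N := fun i j =>
    (subExp_le_minExp i j).trans ((min_le_left _ _).trans (hN i))
  have h := card_subtype_and_eq_mul (D.blocks k) (S.symFamily (minExp k)) (S.hermitianBlocks k)
    (by
      rintro ℓ ⟨h1, h2⟩ ⟨a, ha⟩ ⟨i, hi⟩ ⟨j, hj⟩
      change k i = a at hi
      change k j = a at hj
      change D.topCoef (k j - 1) (ℓ j i) = S.sign (a - 1) * S.τ (D.topCoef (k i - 1) (ℓ i j))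
      rw [h2 i j, hj, hi]
      refine S.topCoef_comp ?_
      have := h1 i j
      rwa [minExp_of_eq hk (hi.trans hj.symm), hi] at this)
    (by
      intro B hB
      obtain ⟨ℓ, hℓ, rfl⟩ := D.exists_blocks_eq hk hN B
      have hcomp : ∀ i j, ℓ j i ∘ₗ S.σ.toLinearMap ∈ D.ann (minExp k i j) := fun i j => by
        rw [minExp_comm]
        exact S.comp_mem_ann (hℓ j i)
      refine ⟨fun i j => (2 : K)⁻¹ • (ℓ i j + ℓ j i ∘ₗ S.σ.toLinearMap), ⟨fun i j =>
        Submodule.smul_mem _ _ (Submodule.add_mem _ (hℓ i j) (hcomp i j)), fun i j => ?_⟩, ?_⟩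
      · rw [LinearMap.smul_comp, LinearMap.add_comp, comp_comp, add_comm]
      · funext a
        ext ⟨i, hi⟩ ⟨j, hj⟩
        obtain ⟨a, ha⟩ := a
        change k i = a at hi
        change k j = a at hj
        have h1 : D.topCoef (k i - 1) (ℓ i j) =
            S.sign (a - 1) * S.τ (D.topCoef (k j - 1) (ℓ j i)) := hB ⟨a, ha⟩ ⟨j, hj⟩ ⟨i, hi⟩
        change D.topCoef (k i - 1) ((2 : K)⁻¹ • (ℓ i j + ℓ j i ∘ₗ S.σ.toLinearMap)) =
          D.topCoef (k i - 1) (ℓ i j)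
        have h3 : D.topCoef (k i - 1) (ℓ j i ∘ₗ S.σ.toLinearMap) =
            D.topCoef (k i - 1) (ℓ i j) := by
          rw [S.topCoef_comp, h1, hi, hj]
          rw [← minExp_of_eq hk (hi.trans hj.symm), minExp_comm]
          exact hℓ j i
        rw [map_smul, map_add, h3, half_add_half h2])
    (fun B => ∀ a, (B a).det ≠ 0)
  rw [Nat.card_congr (Equiv.subtypeEquivRight fun ℓ => and_congr_right fun hℓ =>
    D.det_coefMatrix_ne_zero hℓ.1)]
  refine h.trans ?_
  congr 1
  · have h3 := S.card_symFamily h2 (a := subExp k) subExp_comm hmin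
    simp only [fun i => subExp_of_eq (k := k) (rfl : k i = k i)] at h3
    rw [← h3]
    refine Nat.card_congr (Equiv.subtypeEquivRight fun ℓ => ⟨fun hℓ =>
      ⟨(D.blocks_eq_zero_iff hk hℓ.1.1).1 hℓ.2, hℓ.1.2⟩, fun hℓ => ?_⟩)
    have h4 : ∀ i j, ℓ i j ∈ D.ann (minExp k i j) := fun i j =>
      D.ann_mono (subExp_le_minExp i j) (hℓ.1 i j)
    exact ⟨⟨h4, hℓ.2⟩, (D.blocks_eq_zero_iff hk h4).2 hℓ.1⟩
  · rw [← Finset.prod_coe_sort]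
    unfold nondegCount
    rw [← Nat.card_pi]
    exact Nat.card_congr ((Equiv.subtypeEquivRight fun B => forall_and.symm).trans
      (Equiv.subtypePiEquivPi (p := fun (a : Finset.univ.image k)
        (B : Matrix {i // k i = a.1} {i // k i = a.1} F) =>
          IsEpsHermitian (S.τ : F →+* F) (S.sign (a - 1)) B ∧ B.det ≠ 0)))

end Uniformized.Involution


/-! ### Invariant pairings as families of functionals -/

/-- Presentation of a `K`-space by `R ^ I` with relations `π ^ (k i) = 0`. -/
structure Uniformized.Presentation {K R F : Type*} [Field K] [CommRing R] [Algebra K R] [Field F]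
    [Algebra K F] {N : ℕ} (D : Uniformized K R F N) {I : Type*} (k : I → ℕ) (M : Type*)
    [AddCommGroup M] [Module K M] where
  map : (I → R) →ₗ[K] M
  surj : Function.Surjective map
  ker : ∀ x, map x = 0 ↔ ∀ i, D.π ^ k i ∣ x i

theorem exists_bilin_of_surjective {K V V' M M' : Type*} [Field K] [AddCommGroup V] [Module K V]
    [AddCommGroup V'] [Module K V'] [AddCommGroup M] [Module K M] [AddCommGroup M'] [Module K M']
    (B : V →ₗ[K] V' →ₗ[K] K) (p : V →ₗ[K] M) (p' : V' →ₗ[K] M') (hp : Function.Surjective p)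
    (hp' : Function.Surjective p') (h : ∀ x y, p x = 0 → B x y = 0)
    (h' : ∀ x y, p' y = 0 → B x y = 0) :
    ∃ γ : M →ₗ[K] M' →ₗ[K] K, ∀ x y, γ (p x) (p' y) = B x y := by
  obtain ⟨s, hs⟩ := LinearMap.exists_rightInverse_of_surjective p (LinearMap.range_eq_top.2 hp)
  obtain ⟨s', hs'⟩ := LinearMap.exists_rightInverse_of_surjective p' (LinearMap.range_eq_top.2 hp')
  refine ⟨B.compl₁₂ s s', fun x y => ?_⟩
  rw [LinearMap.compl₁₂_apply]
  have h1 : B (s (p x) - x) (s' (p' y)) = 0 := h _ _ (by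
    rw [map_sub, sub_eq_zero]; exact LinearMap.congr_fun hs (p x))
  have h2 : B x (s' (p' y) - y) = 0 := h' _ _ (by
    rw [map_sub, sub_eq_zero]; exact LinearMap.congr_fun hs' (p' y))
  rw [map_sub, LinearMap.sub_apply, sub_eq_zero] at h1
  rw [map_sub, sub_eq_zero] at h2
  rw [h1, h2]

namespace Uniformized.Presentation

variable {K R F : Type*} [Field K] [CommRing R] [Algebra K R] [Field F] [Algebra K F] {N : ℕ}
  {D : Uniformized K R F N} {I : Type*} {k : I → ℕ} {M M' : Type*}
  [AddCommGroup M] [Module K M] [AddCommGroup M'] [Module K M']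
  (p : D.Presentation k M) (p' : D.Presentation k M')

/-- `γ` is balanced over `R`. -/
def IsBalanced (γ : M →ₗ[K] M' →ₗ[K] K) : Prop :=
  ∀ (r : R) x y, γ (p.map (r • x)) (p'.map y) = γ (p.map x) (p'.map (r • y))

/-- T' undoes multiplication by t on the second module, so invariance moves t across the pairing. As
t generates R over K, balance for t gives balance for R. -/
theorem isBalanced_iff {t : R} (ht : IsUnit t) (hadj : Algebra.adjoin K {t} = ⊤)
    {T : M →ₗ[K] M} {T' : M' →ₗ[K] M'} (hT : ∀ x, p.map (t • x) = T (p.map x))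
    (hT' : ∀ y, T' (p'.map (t • y)) = p'.map y) (γ : M →ₗ[K] M' →ₗ[K] K) :
    IsBalanced p p' γ ↔ ∀ m m', γ (T m) (T' m') = γ m m' := by
  constructor
  · intro h m m'
    obtain ⟨x, rfl⟩ := p.surj m
    obtain ⟨y, rfl⟩ := p'.surj m'
    obtain ⟨u, rfl⟩ := ht
    have hy : y = (u : R) • ((u⁻¹ : Rˣ) : R) • y := by
      rw [smul_smul, Units.mul_inv, one_smul]
    rw [hy, hT', ← hT, h]
  · intro h r
    have hr : r ∈ Algebra.adjoin K {t} := hadj ▸ Algebra.mem_top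
    induction hr using Algebra.adjoin_induction with
    | mem r hr =>
      rw [Set.mem_singleton_iff] at hr
      subst hr
      intro x y
      rw [hT, ← hT' y, h]
    | algebraMap c =>
      intro x y
      simp only [algebraMap_smul, map_smul, LinearMap.smul_apply]
    | add r s _ _ hr hs =>
      intro x y
      simp only [add_smul, map_add, LinearMap.add_apply, hr, hs]
    | mul r s _ _ hr hs =>
      intro x y
      rw [mul_smul, hr, hs, ← mul_smul, mul_comm]

variable [DecidableEq I]

/-- The family of functionals `u ↦ γ (u e_i) e_j`. -/
def toFamily (γ : M →ₗ[K] M' →ₗ[K] K) (i j : I) : Module.Dual K R :=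
  γ.flip (p'.map (Pi.single j 1)) ∘ₗ p.map ∘ₗ LinearMap.single K (fun _ => R) i

theorem toFamily_apply (γ : M →ₗ[K] M' →ₗ[K] K) (i j : I) (u : R) :
    toFamily p p' γ i j u = γ (p.map (Pi.single i u)) (p'.map (Pi.single j 1)) := rfl

theorem map_single_eq_zero {i : I} {u : R} (h : D.π ^ k i ∣ u) :
    p.map (Pi.single i u) = 0 := by
  rw [p.ker]
  intro j
  by_cases hj : j = i
  · subst hj; rwa [Pi.single_eq_same]
  · rw [Pi.single_eq_of_ne hj]; exact dvd_zero _

variable {p p'}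

/-- π^{k_i} kills the generator e_i, and π^{k_j}, once moved across by balance, kills e_j. -/
theorem IsBalanced.toFamily_mem {γ : M →ₗ[K] M' →ₗ[K] K} (h : IsBalanced p p' γ) (i j : I) :
    toFamily p p' γ i j ∈ D.ann (minExp k i j) := by
  intro u
  rw [toFamily_apply]
  rcases min_choice (k i) (k j) with h1 | h1
  · rw [map_single_eq_zero p, map_zero, LinearMap.zero_apply]
    rw [minExp, h1]; exact dvd_mul_right _ _
  · have h2 : (Pi.single i (D.π ^ minExp k i j * u) : I → R) =
        (D.π ^ minExp k i j * u) • Pi.single i 1 := by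
      rw [← Pi.single_smul, smul_eq_mul, mul_one]
    rw [h2, h, ← Pi.single_smul, smul_eq_mul, mul_one, map_single_eq_zero p', map_zero]
    rw [minExp, h1]; exact dvd_mul_right _ _

variable [Fintype I]

theorem IsBalanced.apply_eq_sum {γ : M →ₗ[K] M' →ₗ[K] K} (h : IsBalanced p p' γ) (x y : I → R) :
    γ (p.map x) (p'.map y) = ∑ i, ∑ j, toFamily p p' γ i j (x i * y j) := by
  conv_lhs => rw [← Finset.univ_sum_single x, ← Finset.univ_sum_single y]
  rw [map_sum p.map, map_sum γ, LinearMap.sum_apply]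
  refine Finset.sum_congr rfl fun i _ => ?_
  rw [map_sum p'.map, map_sum]
  refine Finset.sum_congr rfl fun j _ => ?_
  have h1 : (Pi.single j (y j) : I → R) = y j • Pi.single j 1 := by
    rw [← Pi.single_smul, smul_eq_mul, mul_one]
  rw [toFamily_apply, h1, ← h, ← Pi.single_smul, smul_eq_mul, mul_comm]

variable (p p')

theorem exists_toFamily_eq {ℓ : I → I → Module.Dual K R}
    (hℓ : ∀ i j, ℓ i j ∈ D.ann (minExp k i j)) :
    ∃ γ : M →ₗ[K] M' →ₗ[K] K, IsBalanced p p' γ ∧ toFamily p p' γ = ℓ := by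
  let B : (I → R) →ₗ[K] (I → R) →ₗ[K] K := LinearMap.mk₂ K
    (fun x y => ∑ i, ∑ j, ℓ i j (x i * y j))
    (fun x x' y => by simp only [Pi.add_apply, add_mul, map_add, Finset.sum_add_distrib])
    (fun c x y => by simp only [Pi.smul_apply, smul_mul_assoc, map_smul, Finset.smul_sum])
    (fun x y y' => by simp only [Pi.add_apply, mul_add, map_add, Finset.sum_add_distrib])
    (fun c x y => by simp only [Pi.smul_apply, mul_smul_comm, map_smul, Finset.smul_sum])
  have hB : ∀ x y, B x y = ∑ i, ∑ j, ℓ i j (x i * y j) := fun x y => rfl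
  obtain ⟨γ, hγ⟩ := exists_bilin_of_surjective B p.map p'.map p.surj p'.surj
    (fun x y hx => by
      rw [p.ker] at hx
      exact Finset.sum_eq_zero fun i _ => Finset.sum_eq_zero fun j _ => D.apply_eq_zero
        (D.ann_mono (min_le_left _ _) (hℓ i j)) ((hx i).mul_right _))
    (fun x y hy => by
      rw [p'.ker] at hy
      exact Finset.sum_eq_zero fun i _ => Finset.sum_eq_zero fun j _ => D.apply_eq_zero
        (D.ann_mono (min_le_right _ _) (hℓ i j)) ((hy j).mul_left _))
  refine ⟨γ, fun r x y => ?_, ?_⟩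
  · rw [hγ, hγ, hB, hB]
    refine Finset.sum_congr rfl fun i _ => Finset.sum_congr rfl fun j _ => ?_
    simp only [Pi.smul_apply, smul_eq_mul]
    congr 1
    ring
  · funext i j
    ext u
    rw [toFamily_apply, hγ, hB, Finset.sum_eq_single i, Finset.sum_eq_single j]
    · simp
    · intro j' _ hj'
      rw [Pi.single_eq_of_ne hj', mul_zero, map_zero]
    · simp
    · intro i' _ hi'
      exact Finset.sum_eq_zero fun j _ => by rw [Pi.single_eq_of_ne hi', zero_mul, map_zero]
    · simp

/-- Balanced pairings correspond to families of functionals. -/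
noncomputable def balancedEquiv : {γ : M →ₗ[K] M' →ₗ[K] K // IsBalanced p p' γ} ≃
    {ℓ : I → I → Module.Dual K R // ∀ i j, ℓ i j ∈ D.ann (minExp k i j)} :=
  Equiv.ofBijective (fun γ => ⟨toFamily p p' γ.1, γ.2.toFamily_mem⟩) <| by
    refine ⟨fun γ γ' h => Subtype.ext ?_, fun ℓ => ?_⟩
    · ext m m'
      obtain ⟨x, rfl⟩ := p.surj m
      obtain ⟨y, rfl⟩ := p'.surj m'
      rw [γ.2.apply_eq_sum, γ'.2.apply_eq_sum, Subtype.mk.inj h]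
    · obtain ⟨γ, hγ, h⟩ := exists_toFamily_eq p p' ℓ.2
      exact ⟨⟨γ, hγ⟩, Subtype.ext h⟩

variable {p p'} [FiniteDimensional K F] [Algebra.IsSeparable K F]

/-- The left radical is an R-submodule killed by a power of π, so it is zero unless it meets the
socle. The socle consists of the vectors with coordinates π^{k_i - 1} z_i and depends only on v =
ρ(z). Pairing such a vector with u e_j gives Tr((vC)_j ρ(u)), so the radical vectors in the socle
are the left null vectors of the coefficient matrix C. -/
theorem IsBalanced.separating_iff {γ : M →ₗ[K] M' →ₗ[K] K} (h : IsBalanced p p' γ)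
    (hk : ∀ i, 0 < k i) (hN : ∀ i, k i ≤ N) :
    (∀ m, (∀ m', γ m m' = 0) → m = 0) ↔ (D.coefMatrix k (toFamily p p' γ)).det ≠ 0 := by
  rw [ne_eq, ← Matrix.exists_vecMul_eq_zero_iff, not_exists]
  have key : ∀ (z : I → R) (j : I) (u : R),
      γ (p.map fun i => D.π ^ (k i - 1) * z i) (p'.map (Pi.single j u)) =
        Algebra.trace K F
          (Matrix.vecMul (fun i => D.ρ (z i)) (D.coefMatrix k (toFamily p p' γ)) j * D.ρ u) := by
    intro z j u
    rw [h.apply_eq_sum]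
    simp only [Matrix.vecMul, dotProduct]
    rw [Finset.sum_mul, map_sum]
    refine Finset.sum_congr rfl fun i _ => ?_
    rw [Finset.sum_eq_single j]
    · rw [Pi.single_eq_same, mul_assoc, D.apply_eq_trace, map_mul D.ρ]
      · congr 1
        simp only [coefMatrix, Matrix.of_apply]
        ring
      · refine D.ann_mono ?_ (h.toFamily_mem i j)
        have := hk i
        exact (min_le_left _ _).trans (by omega)
    · intro j' _ hj'
      rw [Pi.single_eq_of_ne hj', mul_zero, map_zero]
    · simp
  constructor
  · rintro hsep v ⟨hv, hv0⟩
    choose z hz using fun i => D.surj (v i)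
    have hz' : (fun i => D.ρ (z i)) = v := funext hz
    have h0 : p.map (fun i => D.π ^ (k i - 1) * z i) = 0 := by
      refine hsep _ fun m' => ?_
      obtain ⟨y, rfl⟩ := p'.surj m'
      rw [← Finset.univ_sum_single y, map_sum, map_sum]
      refine Finset.sum_eq_zero fun j _ => ?_
      rw [key, hz', hv0, Pi.zero_apply, zero_mul, map_zero]
    rw [p.ker] at h0
    refine hv (funext fun i => ?_)
    have h1 : 1 + (k i - 1) = k i := by have := hk i; omega
    have := D.cancel 1 (k i - 1) (z i) (by rw [h1]; exact hN i) (by rw [h1]; exact h0 i)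
    rw [pow_one, ← D.ker, hz] at this
    exact this
  · intro hv
    -- A radical vector killed by π is zero, because C has no left null vector.
    have hsoc : ∀ x : I → R, (∀ y, γ (p.map x) (p'.map y) = 0) → p.map (D.π • x) = 0 →
        p.map x = 0 := by
      intro x hx hπ
      rw [p.ker] at hπ
      have h1 : ∀ i, D.π ^ (k i - 1) ∣ x i := fun i => by
        have h1 : k i - 1 + 1 = k i := by have := hk i; omega
        refine D.cancel (k i - 1) 1 (x i) (by rw [h1]; exact hN i) ?_
        rw [h1, pow_one]
        exact hπ i
      choose z hz using h1
      obtain rfl : x = fun i => D.π ^ (k i - 1) * z i := funext hz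
      have h2 : Matrix.vecMul (fun i => D.ρ (z i)) (D.coefMatrix k (toFamily p p' γ)) = 0 := by
        funext j
        refine (traceForm_nondegenerate K F).1 _ fun c => ?_
        obtain ⟨u, rfl⟩ := D.surj c
        rw [Algebra.traceForm_apply, ← key]
        exact hx _
      have h3 : (fun i => D.ρ (z i)) = 0 := by
        by_contra h3
        exact hv _ ⟨h3, h2⟩
      rw [p.ker]
      intro i
      obtain ⟨w, hw⟩ := (D.ker _).1 (congrFun h3 i)
      rw [hw, ← mul_assoc, ← pow_succ, Nat.sub_add_cancel (hk i)]
      exact dvd_mul_right _ _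
    -- Reduction to the socle: if x lies in the radical, balance puts πx there too, and πx is killed
    -- by a smaller power of π.
    have hpow : ∀ (a : ℕ) (x : I → R), (∀ y, γ (p.map x) (p'.map y) = 0) →
        p.map (D.π ^ a • x) = 0 → p.map x = 0 := by
      intro a
      induction a with
      | zero => intro x _ h0; rwa [pow_zero, one_smul] at h0
      | succ a ih =>
        intro x hx h0
        refine hsoc x hx (ih _ (fun y => ?_) ?_)
        · rw [h]; exact hx _
        · rwa [smul_smul, ← pow_succ]
    intro m hm
    obtain ⟨x, rfl⟩ := p.surj m
    -- Any exponent that bounds all the k_i would do.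
    refine hpow (∑ i, k i) x (fun y => hm _) ?_
    rw [p.ker]
    intro i
    exact (pow_dvd_pow _ (Finset.single_le_sum (fun _ _ => Nat.zero_le _)
      (Finset.mem_univ i))).mul_right _

theorem card_separating_pairings (p : D.Presentation k M) (p' : D.Presentation k M')
    (hk : ∀ i, 0 < k i) (hN : ∀ i, k i ≤ N) {t : R} (ht : IsUnit t)
    (hadj : Algebra.adjoin K {t} = ⊤) {T : M →ₗ[K] M} {T' : M' →ₗ[K] M'}
    (hT : ∀ x, p.map (t • x) = T (p.map x)) (hT' : ∀ y, T' (p'.map (t • y)) = p'.map y) :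
    Nat.card {γ : M →ₗ[K] M' →ₗ[K] K // (∀ m, (∀ m', γ m m' = 0) → m = 0) ∧
      ∀ m m', γ (T m) (T' m') = γ m m'} =
    Nat.card F ^ (∑ i, ∑ j, subExp k i j) * ∏ a ∈ Finset.univ.image k,
      Nat.card {B : Matrix {i // k i = a} {i // k i = a} F // B.det ≠ 0} := by
  rw [← D.card_family_det_ne_zero hk hN]
  have h1 := isBalanced_iff p p' ht hadj hT hT'
  refine Nat.card_congr (Equiv.trans ?_ (((balancedEquiv p p').subtypeEquiv (p := fun γ =>
    ∀ m, (∀ m', γ.1 m m' = 0) → m = 0) (q := fun ℓ => (D.coefMatrix k ℓ.1).det ≠ 0)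
    fun γ => γ.2.separating_iff hk hN).trans
      (Equiv.subtypeSubtypeEquivSubtypeInter _ (fun ℓ => (D.coefMatrix k ℓ).det ≠ 0))))
  exact (Equiv.subtypeEquivRight fun γ => by rw [h1, and_comm]).trans
    (Equiv.subtypeSubtypeEquivSubtypeInter _ (fun γ : M →ₗ[K] M' →ₗ[K] K =>
      ∀ m, (∀ m', γ m m' = 0) → m = 0)).symm

end Uniformized.Presentation

/-! ### Symmetric forms through the twisted presentation. -/

namespace Uniformized.Involution

variable {K R F : Type*} [Field K] [CommRing R] [Algebra K R] [Field F] [Algebra K F] {N : ℕ}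
  {D : Uniformized K R F N} (S : D.Involution) {I : Type*} {k : I → ℕ} {M : Type*}
  [AddCommGroup M] [Module K M] (p : D.Presentation k M)

/-- The presentation twisted by the involution. -/
def twist : D.Presentation k M where
  map := p.map ∘ₗ S.σ.toLinearMap.compLeft I
  surj m := by
    obtain ⟨x, rfl⟩ := p.surj m
    refine ⟨fun i => S.σ (x i), ?_⟩
    rw [LinearMap.comp_apply]
    congr 1
    funext i
    exact S.invol (x i)
  ker x := by
    rw [LinearMap.comp_apply, p.ker]
    exact forall_congr' fun i => S.pi_pow_dvd_map_iff

theorem twist_map (x : I → R) : (S.twist p).map x = p.map fun i => S.σ (x i) := rfl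

theorem map_eq_twist_map (x : I → R) : p.map x = (S.twist p).map fun i => S.σ (x i) := by
  rw [twist_map]
  simp only [S.invol]

/-- In the twisted presentation β(x, y) = Σ ℓ_ij(x_i σ(y_j)), and exchanging x and y applies σ to
the arguments of the functionals. -/
theorem symmetric_iff [Fintype I] [DecidableEq I] {β : M →ₗ[K] M →ₗ[K] K}
    (h : Presentation.IsBalanced p (S.twist p) β) :
    (∀ m m', β m m' = β m' m) ↔ ∀ i j, Presentation.toFamily p (S.twist p) β j i =
      Presentation.toFamily p (S.twist p) β i j ∘ₗ S.σ.toLinearMap := by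
  have h1 : ∀ x y : I → R, β (p.map x) (p.map y) =
      ∑ i, ∑ j, Presentation.toFamily p (S.twist p) β i j (x i * S.σ (y j)) := fun x y => by
    rw [S.map_eq_twist_map p y, h.apply_eq_sum]
  have hsingle : ∀ i : I, (fun j => S.σ ((Pi.single i 1 : I → R) j)) = Pi.single i 1 := by
    intro i
    funext j
    by_cases hj : j = i
    · subst hj; simp
    · simp [hj]
  constructor
  · intro hs i j
    ext u
    have h2 : ∀ (i j : I) (u v : R), β (p.map (Pi.single i u)) (p.map (Pi.single j v)) =
        Presentation.toFamily p (S.twist p) β i j (u * S.σ v) := by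
      intro i j u v
      rw [h1, Finset.sum_eq_single i, Finset.sum_eq_single j]
      · simp
      · intro j' _ hj'
        rw [Pi.single_eq_of_ne hj', map_zero, mul_zero, map_zero]
      · simp
      · intro i' _ hi'
        exact Finset.sum_eq_zero fun j _ => by rw [Pi.single_eq_of_ne hi', zero_mul, map_zero]
      · simp
    have h3 := h2 j i u 1
    rw [hs, h2, map_one, mul_one, one_mul] at h3
    exact h3.symm
  · intro hs m m'
    obtain ⟨x, rfl⟩ := p.surj m
    obtain ⟨y, rfl⟩ := p.surj m'
    rw [h1, h1, Finset.sum_comm]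
    refine Finset.sum_congr rfl fun i _ => Finset.sum_congr rfl fun j _ => ?_
    rw [hs i j, LinearMap.comp_apply, AlgHom.toLinearMap_apply, map_mul, S.invol, mul_comm]

variable [FiniteDimensional K F] [Algebra.IsSeparable K F]

/-- Because t σ(t) = 1, twisting the second copy of M by σ makes multiplication by t the inverse of
T there, so that invariant forms become balanced pairings. -/
theorem card_symmetric_forms [Fintype I] [LinearOrder I] (h2 : (2 : K) ≠ 0)
    (hk : ∀ i, 0 < k i) (hN : ∀ i, k i ≤ N) {t : R} (ht : t * S.σ t = 1)
    (hadj : Algebra.adjoin K {t} = ⊤) {T : M →ₗ[K] M}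
    (hT : ∀ x, p.map (t • x) = T (p.map x)) :
    Nat.card {β : M →ₗ[K] M →ₗ[K] K // (∀ m m', β m m' = β m' m) ∧
      (∀ m, (∀ m', β m m' = 0) → m = 0) ∧ ∀ m m', β (T m) (T m') = β m m'} =
    Nat.card F ^ (∑ i, ∑ j with j < i, subExp k i j) *
      (∏ i, ∏ b ∈ Finset.range (k i - 1), Nat.card (S.signFixed b)) *
      ∏ a ∈ Finset.univ.image k,
        nondegCount (S.τ : F →+* F) (S.sign (a - 1)) {i // k i = a} := by
  rw [← S.card_symFamily_det_ne_zero h2 hk hN]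
  have hT' : ∀ y, T ((S.twist p).map (t • y)) = (S.twist p).map y := fun y => by
    rw [twist_map, twist_map, ← hT]
    congr 1
    funext i
    simp only [Pi.smul_apply, smul_eq_mul, map_mul]
    rw [← mul_assoc, ht, one_mul]
  have h1 := Presentation.isBalanced_iff p (S.twist p) (IsUnit.of_mul_eq_one _ ht) hadj hT hT'
  refine Nat.card_congr (Equiv.trans ?_
    (((Presentation.balancedEquiv p (S.twist p)).subtypeEquiv (p := fun β =>
      (∀ m m', β.1 m m' = β.1 m' m) ∧ ∀ m, (∀ m', β.1 m m' = 0) → m = 0)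
      (q := fun ℓ => (∀ i j, ℓ.1 j i = ℓ.1 i j ∘ₗ S.σ.toLinearMap) ∧
        (D.coefMatrix k ℓ.1).det ≠ 0)
      fun β => and_congr (S.symmetric_iff p β.2) (β.2.separating_iff hk hN)).trans
      ((Equiv.subtypeSubtypeEquivSubtypeInter _ (fun ℓ : I → I → Module.Dual K R =>
        (∀ i j, ℓ j i = ℓ i j ∘ₗ S.σ.toLinearMap) ∧ (D.coefMatrix k ℓ).det ≠ 0)).trans
        (Equiv.subtypeEquivRight fun ℓ => and_assoc.symm))))
  exact (Equiv.subtypeEquivRight fun β => by rw [h1, ← and_assoc, and_comm]).trans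
    (Equiv.subtypeSubtypeEquivSubtypeInter _ (fun β : M →ₗ[K] M →ₗ[K] K =>
      (∀ m m', β m m' = β m' m) ∧ ∀ m, (∀ m', β m m' = 0) → m = 0)).symm

end Uniformized.Involution


/-! ### The algebras `K[t] / (f ^ N)` -/

theorem Polynomial.reverse_pow_of_domain {K : Type*} [Field K] (p : K[X]) (n : ℕ) :
    (p ^ n).reverse = p.reverse ^ n := by
  induction n with
  | zero => rw [pow_zero, pow_zero, ← C_1, reverse_C]
  | succ n ih => rw [pow_succ, pow_succ, reverse_mul_of_domain, ih]

namespace Phi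

variable {K : Type*} [Field K]

instance (f : Phi K) : Fact (Irreducible f.1) := ⟨f.2.2.1⟩

instance (f : Phi K) : FiniteDimensional K (AdjoinRoot f.1) :=
  (AdjoinRoot.powerBasis f.2.2.1.ne_zero).finite

theorem natCard_adjoinRoot (f : Phi K) : Nat.card (AdjoinRoot f.1) = Nat.card K ^ f.deg := by
  rw [Module.natCard_eq_pow_finrank (K := K), PowerBasis.finrank (AdjoinRoot.powerBasis
    f.2.2.1.ne_zero), AdjoinRoot.powerBasis_dim]
  rfl

theorem deg_pos (f : Phi K) : 0 < f.deg := f.2.2.1.natDegree_pos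

theorem reverse_eq (f : Phi K) : f.1.reverse = C (f.1.coeff 0) * f.star.1 := by
  rw [star, ← mul_assoc, ← C_mul, mul_inv_cancel₀ f.2.2.2, C_1, one_mul]

theorem star_star (f : Phi K) : f.star.star = f := by
  have h1 : f.star.1.reverse = C (f.1.coeff 0)⁻¹ * f.1 := by
    change (C (f.1.coeff 0)⁻¹ * f.1.reverse).reverse = _
    rw [reverse_mul_of_domain, reverse_C, reverse_reverse_of_coeff_zero f.2.2.2]
  have h2 : f.star.1.coeff 0 = (f.1.coeff 0)⁻¹ := by
    change (C (f.1.coeff 0)⁻¹ * f.1.reverse).coeff 0 = _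
    rw [coeff_C_mul, coeff_zero_reverse, f.2.1.leadingCoeff, mul_one]
  apply Subtype.ext
  change C (f.star.1.coeff 0)⁻¹ * f.star.1.reverse = f.1
  rw [h1, h2, inv_inv, ← mul_assoc, ← C_mul, mul_inv_cancel₀ f.2.2.2, C_1, one_mul]

theorem star_deg (f : Phi K) : f.star.deg = f.deg := by
  have h : f.1.natTrailingDegree = 0 := natTrailingDegree_eq_zero.2 (Or.inr f.2.2.2)
  change (C (f.1.coeff 0)⁻¹ * f.1.reverse).natDegree = f.1.natDegree
  rw [natDegree_C_mul (inv_ne_zero f.2.2.2), reverse_natDegree, h, Nat.sub_zero]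

theorem coeff_zero_pow_ne_zero (f : Phi K) (N : ℕ) : (f.1 ^ N).coeff 0 ≠ 0 := by
  rw [coeff_zero_eq_eval_zero, eval_pow, ← coeff_zero_eq_eval_zero]
  exact pow_ne_zero _ f.2.2.2

theorem star_pow_dvd_reverse_of_dvd (f : Phi K) {k : ℕ} {p : K[X]} (h : f.1 ^ k ∣ p) :
    f.star.1 ^ k ∣ p.reverse := by
  obtain ⟨q, rfl⟩ := h
  rw [reverse_mul_of_domain, reverse_pow_of_domain, reverse_eq, mul_pow, mul_assoc]
  exact (dvd_mul_right _ _).mul_left _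

theorem star_pow_dvd_reverse_iff (f : Phi K) {k : ℕ} {p : K[X]} :
    f.star.1 ^ k ∣ p.reverse ↔ f.1 ^ k ∣ p := by
  refine ⟨fun h => ?_, f.star_pow_dvd_reverse_of_dvd⟩
  by_cases hp : p = 0
  · rw [hp]; exact dvd_zero _
  -- Reversal forgets factors X. Reversing twice recovers the part q of p prime to X, and
  -- divisibility of q suffices.
  obtain ⟨q, hq, hX⟩ := (Polynomial.finiteMultiplicity_X_sub_C 0 hp).exists_eq_pow_mul_and_not_dvd
  rw [C_0, sub_zero] at hq hX
  rw [X_dvd_iff] at hX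
  have h1 := f.star.star_pow_dvd_reverse_of_dvd h
  rw [star_star, hq, reverse_X_pow_mul, reverse_reverse_of_coeff_zero hX] at h1
  rw [hq]
  exact h1.mul_left _

end Phi

namespace AdjoinRoot

variable {K : Type*} [Field K]

theorem isUnit_root {g : K[X]} (h : g.coeff 0 ≠ 0) : IsUnit (root g) := by
  have h1 : root g * mk g g.divX = -algebraMap K (AdjoinRoot g) (g.coeff 0) := by
    rw [eq_neg_iff_add_eq_zero, ← mk_X, ← map_mul, algebraMap_eq, ← mk_C, ← map_add,
      X_mul_divX_add, mk_self]
  refine isUnit_of_mul_isUnit_left (y := mk g g.divX) ?_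
  rw [h1]
  exact ((isUnit_iff_ne_zero.2 h).map _).neg

/-- The inverse of the root. -/
noncomputable def invRoot (g : K[X]) : AdjoinRoot g := Ring.inverse (root g)

theorem root_mul_invRoot {g : K[X]} (h : g.coeff 0 ≠ 0) : root g * invRoot g = 1 :=
  Ring.mul_inverse_cancel _ (isUnit_root h)

theorem aeval_invRoot {h : K[X]} (hh : h.coeff 0 ≠ 0) (p : K[X]) :
    aeval (invRoot h) p = mk h p.reverse * invRoot h ^ p.natDegree := by
  let _ : Invertible (invRoot h) := ⟨root h, root_mul_invRoot hh, by
    rw [mul_comm]; exact root_mul_invRoot hh⟩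
  rw [aeval_def, ← eval₂_reverse_mul_pow, ← aeval_eq]
  rfl

/-- The homomorphism that maps the root to the inverse of the root. -/
noncomputable def swap (g h : K[X]) (hh : h.coeff 0 ≠ 0) (hd : h ∣ g.reverse) :
    AdjoinRoot g →ₐ[K] AdjoinRoot h :=
  liftAlgHom g (Algebra.ofId K _) (invRoot h) (by
    have := aeval_invRoot hh g
    rw [mk_eq_zero.2 hd, zero_mul] at this
    exact this)

variable {g h : K[X]} {hh : h.coeff 0 ≠ 0} {hd : h ∣ g.reverse}

theorem swap_root : swap g h hh hd (root g) = invRoot h := liftAlgHom_root _ _ _ _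

theorem root_mul_swap_root : root h * swap g h hh hd (root g) = 1 := by
  rw [swap_root, root_mul_invRoot hh]

theorem swap_mk (p : K[X]) : swap g h hh hd (mk g p) = mk h p.reverse * invRoot h ^ p.natDegree := by
  rw [← aeval_eq, ← aeval_algHom_apply, swap_root, aeval_invRoot hh]

theorem swap_mk_eq_zero_iff (p : K[X]) : swap g h hh hd (mk g p) = 0 ↔ h ∣ p.reverse := by
  have hu : IsUnit (invRoot h ^ p.natDegree) :=
    (IsUnit.of_mul_eq_one_right _ (root_mul_invRoot hh)).pow _
  rw [swap_mk, hu.mul_left_eq_zero, mk_eq_zero]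

theorem swap_surjective (hg : g.coeff 0 ≠ 0) : Function.Surjective (swap g h hh hd) := by
  rw [← AlgHom.range_eq_top, eq_top_iff, ← adjoinRoot_eq_top, Algebra.adjoin_le_iff,
    Set.singleton_subset_iff]
  refine ⟨invRoot g, ?_⟩
  have h1 : invRoot h * swap g h hh hd (invRoot g) = 1 := by
    rw [← swap_root (hd := hd) (hh := hh), ← map_mul, root_mul_invRoot hg, map_one]
  calc swap g h hh hd (invRoot g) = root h * invRoot h * swap g h hh hd (invRoot g) := by
        rw [root_mul_invRoot hh, one_mul]
    _ = root h := by rw [mul_assoc, h1, mul_one]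

/-- The natural homomorphism between quotients of `K[X]`. -/
noncomputable def factor (g h : K[X]) (hd : h ∣ g) : AdjoinRoot g →ₐ[K] AdjoinRoot h :=
  liftAlgHom g (Algebra.ofId K _) (root h) (by
    have := aeval_eq (f := h) g
    rw [mk_eq_zero.2 hd] at this
    exact this)

theorem factor_root {hd : h ∣ g} : factor g h hd (root g) = root h := liftAlgHom_root _ _ _ _

theorem factor_mk {hd : h ∣ g} (p : K[X]) : factor g h hd (mk g p) = mk h p := by
  rw [← aeval_eq, ← aeval_algHom_apply, factor_root, aeval_eq]

theorem factor_surjective {hd : h ∣ g} : Function.Surjective (factor g h hd) := fun y => by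
  obtain ⟨p, rfl⟩ := mk_surjective y
  exact ⟨mk g p, factor_mk p⟩

theorem mk_dvd_mk_iff {hd : h ∣ g} {p : K[X]} : mk g h ∣ mk g p ↔ h ∣ p := by
  refine ⟨fun ⟨q, hq⟩ => ?_, map_dvd _⟩
  obtain ⟨q, rfl⟩ := mk_surjective q
  rw [← map_mul, mk_eq_mk] at hq
  have := (hd.trans hq).add (dvd_mul_right h q)
  rwa [sub_add_cancel] at this

end AdjoinRoot

namespace Phi

open AdjoinRoot

variable {K : Type*} [Field K] (f : Phi K) {N : ℕ}

/-- A polynomial prime to f is prime to f^N, so K[t]/(f^N) is local. -/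
theorem isUnit_of_factor_ne_zero (hN : 0 < N) {u : AdjoinRoot (f.1 ^ N)}
    (hu : factor (f.1 ^ N) f.1 (dvd_pow_self _ hN.ne') u ≠ 0) : IsUnit u := by
  obtain ⟨p, rfl⟩ := mk_surjective u
  rw [factor_mk, ne_eq, mk_eq_zero] at hu
  obtain ⟨a, b, hab⟩ := ((f.2.2.1.coprime_iff_not_dvd).2 hu).pow_left (m := N)
  refine IsUnit.of_mul_eq_one_right (mk _ b) ?_
  rw [← map_mul, ← map_one (mk (f.1 ^ N)), mk_eq_mk]
  exact ⟨-a, by linear_combination hab⟩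

/-- The algebra `K[t] / (f ^ N)`, with the uniformizer `v * f` for a unit `v`. -/
noncomputable def uniformized (hN : 0 < N) {v : AdjoinRoot (f.1 ^ N)} (hv : IsUnit v) :
    Uniformized K (AdjoinRoot (f.1 ^ N)) (AdjoinRoot f.1) N where
  ρ := factor (f.1 ^ N) f.1 (dvd_pow_self _ hN.ne')
  π := v * mk _ f.1
  surj := factor_surjective
  ker u := by
    obtain ⟨p, rfl⟩ := mk_surjective u
    rw [hv.mul_left_dvd, mk_dvd_mk_iff (hd := dvd_pow_self _ hN.ne'), factor_mk, mk_eq_zero]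
  cancel a b u hab h := by
    obtain ⟨p, rfl⟩ := mk_surjective u
    rw [mul_pow, mul_pow, (hv.pow _).mul_left_dvd, mul_assoc, (hv.pow _).dvd_mul_left, ← map_pow,
      ← map_pow, ← map_mul, mk_dvd_mk_iff (hd := pow_dvd_pow _ hab), add_comm, pow_add,
      mul_dvd_mul_iff_left (pow_ne_zero _ f.2.2.1.ne_zero)] at h
    rw [mul_pow, (hv.pow _).mul_left_dvd, ← map_pow]
    exact map_dvd _ h

theorem uniformized_pi_pow_dvd_iff (hN : 0 < N) {v : AdjoinRoot (f.1 ^ N)} (hv : IsUnit v)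
    {a : ℕ} (ha : a ≤ N) (p : K[X]) :
    (f.uniformized hN hv).π ^ a ∣ mk (f.1 ^ N) p ↔ f.1 ^ a ∣ p := by
  change (v * mk _ f.1) ^ a ∣ _ ↔ _
  rw [mul_pow, (hv.pow _).mul_left_dvd, ← map_pow, mk_dvd_mk_iff (hd := pow_dvd_pow _ ha)]

theorem self_dvd_reverse (hf : f.star = f) (k : ℕ) : f.1 ^ k ∣ (f.1 ^ k).reverse := by
  have h := f.star_pow_dvd_reverse_of_dvd (dvd_refl (f.1 ^ k))
  rwa [hf] at h

theorem swap_swap {g : K[X]} (hg : g.coeff 0 ≠ 0) (hd : g ∣ g.reverse) (u : AdjoinRoot g) :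
    swap g g hg hd (swap g g hg hd u) = u := by
  have h : (swap g g hg hd).comp (swap g g hg hd) = AlgHom.id K _ := by
    refine AdjoinRoot.algHom_ext ?_
    rw [AlgHom.comp_apply, AlgHom.id_apply]
    have h1 := root_mul_swap_root (hh := hg) (hd := hd)
    have h2 := congrArg (swap g g hg hd) h1
    rw [map_mul, map_one] at h2
    calc _ = root g * swap g g hg hd (root g) * swap g g hg hd (swap g g hg hd (root g)) := by
            rw [h1, one_mul]
      _ = _ := by rw [mul_assoc, h2, mul_one]
  exact DFunLike.congr_fun h u

/-- With σ(f) = wf, the sum f + σ(f) = (1 + w)f is fixed by σ and the difference (1 - w)f is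
negated. One of 1 ± w is a unit, since both cannot vanish in the residue field when 2 ≠ 0; this
choice determines δ. -/
theorem exists_involution (h2 : (2 : K) ≠ 0) (hf : f.star = f) (hN : 0 < N) :
    ∃ (v : AdjoinRoot (f.1 ^ N)) (hv : IsUnit v) (S : (f.uniformized hN hv).Involution),
      root _ * S.σ (root _) = 1 ∧ root _ * S.τ (root _) = 1 ∧ (S.δ = 1 ∨ S.δ = -1) ∧
      (f.deg = 1 → S.δ = -1) := by
  have hd1 : f.1 ∣ f.1.reverse := by simpa using f.self_dvd_reverse hf 1
  let σ := swap (f.1 ^ N) (f.1 ^ N) (f.coeff_zero_pow_ne_zero N) (f.self_dvd_reverse hf N)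
  let τ := swap f.1 f.1 f.2.2.2 hd1
  let ρ := factor (f.1 ^ N) f.1 (dvd_pow_self _ hN.ne')
  have hσ : ∀ u, σ (σ u) = u := swap_swap _ _
  have hσr : root _ * σ (root _) = 1 :=
    root_mul_swap_root (hh := f.coeff_zero_pow_ne_zero N) (hd := f.self_dvd_reverse hf N)
  have hτr : root _ * τ (root _) = 1 := root_mul_swap_root (hh := f.2.2.2) (hd := hd1)
  have hcomp : ∀ u, ρ (σ u) = τ (ρ u) := by
    have h : ρ.comp σ = τ.comp ρ := by
      refine AdjoinRoot.algHom_ext ?_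
      rw [AlgHom.comp_apply, AlgHom.comp_apply]
      simp only [σ, τ, ρ, factor_root, swap_root]
      have h1 := congrArg ρ (root_mul_invRoot (f.coeff_zero_pow_ne_zero N))
      rw [map_mul, map_one] at h1
      simp only [ρ, factor_root] at h1
      have h3 := root_mul_invRoot f.2.2.2
      exact (isUnit_root f.2.2.2).mul_left_cancel (h1.trans h3.symm)
    exact DFunLike.congr_fun h
  -- Self-duality says that f(t⁻¹) = f(0) t^{-deg f} f(t), so w is the factor by which σ multiplies
  -- f.
  let w : AdjoinRoot (f.1 ^ N) := algebraMap K _ (f.1.coeff 0) * invRoot _ ^ f.1.natDegree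
  have hw : σ (mk _ f.1) = w * mk _ f.1 := by
    simp only [σ, w]
    rw [swap_mk, reverse_eq, hf, map_mul, mk_C, AdjoinRoot.algebraMap_eq]
    ring
  have hρ2 : (2 : AdjoinRoot f.1) ≠ 0 := by
    have := (map_ne_zero (algebraMap K (AdjoinRoot f.1))).2 h2
    rwa [map_ofNat] at this
  by_cases hu : ρ (1 + w) = 0
  · have hv : IsUnit (1 - w) := by
      refine f.isUnit_of_factor_ne_zero hN (fun h => hρ2 ?_)
      change ρ (1 - w) = 0 at h
      rw [map_add, map_one] at hu
      rw [map_sub, map_one] at h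
      linear_combination hu + h
    refine ⟨1 - w, hv, ⟨σ, τ, -1, hσ, hcomp, ?_, by ring⟩, hσr,
      hτr, Or.inr rfl, fun _ => rfl⟩
    change σ ((1 - w) * mk _ f.1) = algebraMap K _ (-1) * ((1 - w) * mk _ f.1)
    have h3 := congrArg σ hw
    rw [hσ, map_mul] at h3
    rw [map_mul, map_sub, map_one, sub_mul, ← h3, hw, map_neg, map_one]
    ring
  · refine ⟨1 + w, f.isUnit_of_factor_ne_zero hN hu, ⟨σ, τ, 1, hσ, hcomp, ?_, by ring⟩,
      hσr, hτr, Or.inl rfl, fun hdeg => (hu ?_).elim⟩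
    · change σ ((1 + w) * mk _ f.1) = algebraMap K _ 1 * ((1 + w) * mk _ f.1)
      have h3 := congrArg σ hw
      rw [hσ, map_mul] at h3
      rw [map_mul, map_add, map_one, add_mul, ← h3, hw, map_one]
      ring
    -- For f = t + c the root is -c, so w reduces to c(-c)⁻¹ = -1 and 1 + w is not a unit.
    · have h4 : f.1.natDegree = 1 := hdeg
      have h5 : f.1 = X + C (f.1.coeff 0) := by
        conv_lhs => rw [f.2.1.as_sum, h4]
        simp
      have h6 : root f.1 + algebraMap K _ (f.1.coeff 0) = 0 := by
        have h := (mk_self (f := f.1)).symm.trans (congrArg (mk f.1) h5)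
        rw [map_add, mk_X, mk_C] at h
        exact h.symm
      have h7 := congrArg ρ (root_mul_invRoot (f.coeff_zero_pow_ne_zero N))
      rw [map_mul, map_one] at h7
      have h8 : ρ (root (f.1 ^ N)) = root f.1 := factor_root
      rw [h8] at h7
      simp only [w, h4, pow_one]
      rw [map_add, map_one, map_mul, AlgHom.commutes]
      linear_combination ρ (invRoot (f.1 ^ N)) * h6 - h7

end Phi


/-! ### Invariant forms on the primary components -/

/-- The number of nondegenerate symmetric bilinear forms preserved by `T`. -/
noncomputable def invFormCount {K V : Type*} [Field K] [AddCommGroup V] [Module K V]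
    (T : V →ₗ[K] V) : ℕ :=
  Nat.card {β : V →ₗ[K] V →ₗ[K] K // (∀ m m', β m m' = β m' m) ∧
    (∀ m, (∀ m', β m m' = 0) → m = 0) ∧ ∀ m m', β (T m) (T m') = β m m'}

/-- The number of left separating pairings preserved by `(T, T')`. -/
noncomputable def invPairingCount {K V V' : Type*} [Field K] [AddCommGroup V] [Module K V]
    [AddCommGroup V'] [Module K V'] (T : V →ₗ[K] V) (T' : V' →ₗ[K] V') : ℕ :=
  Nat.card {γ : V →ₗ[K] V' →ₗ[K] K // (∀ m, (∀ m', γ m m' = 0) → m = 0) ∧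
    ∀ m m', γ (T m) (T' m') = γ m m'}

namespace Phi

open AdjoinRoot

variable {K : Type*} [Field K] (f : Phi K) {I : Type*} (k : I → ℕ)

/-- Multiplication by `t` on the sum of the `K[t] / (f ^ (k i))`. -/
noncomputable def mulRoot :
    (∀ i, AdjoinRoot (f.1 ^ k i)) →ₗ[K] ∀ i, AdjoinRoot (f.1 ^ k i) :=
  LinearMap.pi fun i => LinearMap.mulLeft K (root _) ∘ₗ LinearMap.proj i

theorem mulRoot_apply (x : ∀ i, AdjoinRoot (f.1 ^ k i)) (i : I) :
    f.mulRoot k x i = root _ * x i := rfl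

variable {k} {N : ℕ}

/-- The presentation of the sum of the `K[t] / (f ^ (k i))`. -/
noncomputable def presentation (hk : ∀ i, k i ≤ N) (hN : 0 < N) {v : AdjoinRoot (f.1 ^ N)}
    (hv : IsUnit v) :
    (f.uniformized hN hv).Presentation k (∀ i, AdjoinRoot (f.1 ^ k i)) where
  map := LinearMap.pi fun i =>
    (factor (f.1 ^ N) (f.1 ^ k i) (pow_dvd_pow _ (hk i))).toLinearMap ∘ₗ LinearMap.proj i
  surj y := by
    choose x hx using fun i => factor_surjective (hd := pow_dvd_pow f.1 (hk i)) (y i)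
    exact ⟨x, funext hx⟩
  ker x := by
    rw [funext_iff]
    refine forall_congr' fun i => ?_
    obtain ⟨p, hp⟩ := mk_surjective (x i)
    change factor (f.1 ^ N) (f.1 ^ k i) (pow_dvd_pow _ (hk i)) (x i) = 0 ↔ _
    rw [← hp, factor_mk, mk_eq_zero, f.uniformized_pi_pow_dvd_iff hN hv (hk i)]

/-- The presentation of the sum of the `K[t] / (f* ^ (k i))` on which `t` acts by the inverse. -/
noncomputable def starPresentation (hk : ∀ i, k i ≤ N) (hN : 0 < N) {v : AdjoinRoot (f.1 ^ N)}
    (hv : IsUnit v) :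
    (f.uniformized hN hv).Presentation k (∀ i, AdjoinRoot (f.star.1 ^ k i)) where
  map := LinearMap.pi fun i =>
    (swap (f.1 ^ N) (f.star.1 ^ k i) (f.star.coeff_zero_pow_ne_zero _)
      (f.star_pow_dvd_reverse_of_dvd (pow_dvd_pow _ (hk i)))).toLinearMap ∘ₗ LinearMap.proj i
  surj y := by
    choose x hx using fun i => swap_surjective (hh := f.star.coeff_zero_pow_ne_zero (k i))
      (hd := f.star_pow_dvd_reverse_of_dvd (pow_dvd_pow _ (hk i)))
      (f.coeff_zero_pow_ne_zero N) (y i)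
    exact ⟨x, funext hx⟩
  ker x := by
    rw [funext_iff]
    refine forall_congr' fun i => ?_
    obtain ⟨p, hp⟩ := mk_surjective (x i)
    change swap (f.1 ^ N) (f.star.1 ^ k i) (f.star.coeff_zero_pow_ne_zero _)
      (f.star_pow_dvd_reverse_of_dvd (pow_dvd_pow _ (hk i))) (x i) = 0 ↔ _
    rw [← hp, swap_mk_eq_zero_iff, f.uniformized_pi_pow_dvd_iff hN hv (hk i),
      star_pow_dvd_reverse_iff]

theorem presentation_root_smul (hk : ∀ i, k i ≤ N) (hN : 0 < N) {v : AdjoinRoot (f.1 ^ N)}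
    (hv : IsUnit v) (x : I → AdjoinRoot (f.1 ^ N)) :
    (f.presentation hk hN hv).map (root (f.1 ^ N) • x) =
      f.mulRoot k ((f.presentation hk hN hv).map x) := by
  funext i
  change factor (f.1 ^ N) (f.1 ^ k i) (pow_dvd_pow _ (hk i)) (root (f.1 ^ N) * x i) =
    root _ * factor (f.1 ^ N) (f.1 ^ k i) (pow_dvd_pow _ (hk i)) (x i)
  rw [map_mul, factor_root]

theorem mulRoot_starPresentation (hk : ∀ i, k i ≤ N) (hN : 0 < N) {v : AdjoinRoot (f.1 ^ N)}
    (hv : IsUnit v) (x : I → AdjoinRoot (f.1 ^ N)) :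
    f.star.mulRoot k ((f.starPresentation hk hN hv).map (root (f.1 ^ N) • x)) =
      (f.starPresentation hk hN hv).map x := by
  funext i
  change root _ * swap (f.1 ^ N) (f.star.1 ^ k i) (f.star.coeff_zero_pow_ne_zero _)
      (f.star_pow_dvd_reverse_of_dvd (pow_dvd_pow _ (hk i))) (root (f.1 ^ N) * x i) =
    swap (f.1 ^ N) (f.star.1 ^ k i) (f.star.coeff_zero_pow_ne_zero _)
      (f.star_pow_dvd_reverse_of_dvd (pow_dvd_pow _ (hk i))) (x i)
  rw [map_mul, ← mul_assoc, root_mul_swap_root, one_mul]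

variable [Finite K] [Fintype I]

instance : Finite (AdjoinRoot f.1) := Module.finite_of_finite K

theorem card_matrix_det_ne_zero {F : Type*} [Field F] [Finite F] (ι : Type*) [Fintype ι]
    [DecidableEq ι] :
    Nat.card {B : Matrix ι ι F // B.det ≠ 0} =
      ∏ i : Fin (Fintype.card ι), (Nat.card F ^ Fintype.card ι - Nat.card F ^ (i : ℕ)) := by
  have := Fintype.ofFinite F
  rw [Nat.card_eq_fintype_card (α := F), ← Matrix.card_GL_field]
  refine Nat.card_congr (((Matrix.reindex (Fintype.equivFin ι) (Fintype.equivFin ι)).subtypeEquiv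
    (q := fun B => B.det ≠ 0) fun B => by rw [Matrix.det_reindex_self]).trans ?_)
  exact
    { toFun := fun B => Matrix.GeneralLinearGroup.mkOfDetNeZero B.1 B.2
      invFun := fun B => ⟨B.1, (Matrix.isUnit_iff_isUnit_det B.1).1 B.isUnit |>.ne_zero⟩
      left_inv := fun B => rfl
      right_inv := fun B => Units.ext rfl }

theorem exists_pos_bound (k : I → ℕ) : ∃ N, 0 < N ∧ ∀ i, k i ≤ N :=
  ⟨∑ i, k i + 1, Nat.succ_pos _, fun i => (Finset.single_le_sum (fun _ _ => Nat.zero_le _)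
    (Finset.mem_univ i)).trans (Nat.le_succ _)⟩

theorem invPairingCount_mulRoot [DecidableEq I] (hk : ∀ i, 0 < k i) :
    invPairingCount (f.mulRoot k) (f.star.mulRoot k) =
      (Nat.card K ^ f.deg) ^ (∑ i, ∑ j, Uniformized.subExp k i j) * ∏ a ∈ Finset.univ.image k,
        ∏ i : Fin (Fintype.card {i // k i = a}),
          ((Nat.card K ^ f.deg) ^ Fintype.card {i // k i = a} -
            (Nat.card K ^ f.deg) ^ (i : ℕ)) := by
  obtain ⟨N, hN, hkN⟩ := exists_pos_bound k
  have h := Uniformized.Presentation.card_separating_pairings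
    (f.presentation hkN hN isUnit_one) (f.starPresentation hkN hN isUnit_one) hk hkN
    (isUnit_root (f.coeff_zero_pow_ne_zero N)) adjoinRoot_eq_top
    (f.presentation_root_smul hkN hN isUnit_one) (f.mulRoot_starPresentation hkN hN isUnit_one)
  refine h.trans ?_
  rw [natCard_adjoinRoot]
  congr 1
  refine Finset.prod_congr rfl fun a _ => ?_
  rw [card_matrix_det_ne_zero, natCard_adjoinRoot]

/-- The numbers `s b` of δ^b-fixed scalars are left open: only there do t ∓ 1 and the self-dual
polynomials of higher degree differ. -/
theorem exists_invFormCount_mulRoot [LinearOrder I] (h2 : (2 : K) ≠ 0) (hf : f.star = f)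
    (hk : ∀ i, 0 < k i) :
    ∃ (τ : AdjoinRoot f.1 →ₐ[K] AdjoinRoot f.1) (δ : K), root _ * τ (root _) = 1 ∧
      (δ = 1 ∨ δ = -1) ∧ (f.deg = 1 → δ = -1) ∧
      ∀ s : ℕ → ℕ, (∀ b, Nat.card {c // c = algebraMap K _ (δ ^ b) * τ c} = s b) →
      (invFormCount (f.mulRoot k) : ℤ) =
        ((Nat.card K : ℤ) ^ f.deg) ^ (∑ i, ∑ j with j < i, Uniformized.subExp k i j) *
        (∏ i, ∏ b ∈ Finset.range (k i - 1), (s b : ℤ)) *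
        ∏ a ∈ Finset.univ.image k, nondegSeq (s (a - 1) : ℤ) ((Nat.card K : ℤ) ^ f.deg)
          (Fintype.card {i // k i = a}) := by
  obtain ⟨N, hN, hkN⟩ := exists_pos_bound k
  obtain ⟨v, hv, S, h3, h4, h5, h6⟩ := f.exists_involution h2 hf hN
  refine ⟨S.τ, S.δ, h4, h5, h6, fun s hs => ?_⟩
  have h := S.card_symmetric_forms (f.presentation hkN hN hv) h2 hk hkN h3 adjoinRoot_eq_top
    (f.presentation_root_smul hkN hN hv)
  rw [invFormCount, h, natCard_adjoinRoot]
  push_cast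
  congr 1
  · congr 1
    refine Finset.prod_congr rfl fun i _ => Finset.prod_congr rfl fun b _ => ?_
    rw [← hs]
    rfl
  · refine Finset.prod_congr rfl fun a _ => ?_
    rw [nondegCount_eq_nondegSeq (σ := (S.τ : AdjoinRoot f.1 →+* AdjoinRoot f.1)) S.invol_residue
      (S.sign_mul _), natCard_adjoinRoot, ← hs,
      Nat.cast_pow]
    rfl

/-- The even numbers below n - 1 are ⌊n/2⌋ in number. -/
theorem prod_range_ite_even (q : ℤ) (n : ℕ) :
    ∏ b ∈ Finset.range (n - 1), (if Even b then q else 1) = q ^ (n / 2) := by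
  rcases n with _ | n
  · simp
  rw [Nat.add_sub_cancel]
  induction n with
  | zero => simp
  | succ n ih =>
    rw [Finset.prod_range_succ, ih]
    rcases Nat.even_or_odd n with h | h
    · rw [if_pos h, ← pow_succ]
      congr 1
      obtain ⟨m, rfl⟩ := h
      omega
    · rw [if_neg (Nat.not_even_iff_odd.2 h), mul_one]
      congr 1
      obtain ⟨m, rfl⟩ := h
      omega

/-- Here the residue field is K, τ = id and δ = -1. The condition c = (-1)^b c leaves all of K for
even b and only 0 for odd b, so odd parts carry symmetric and even parts alternating blocks. -/
theorem invFormCount_mulRoot_linear [LinearOrder I] (h2 : (2 : K) ≠ 0) (hf : f.star = f)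
    (hdeg : f.deg = 1) (hk : ∀ i, 0 < k i) :
    (invFormCount (f.mulRoot k) : ℤ) =
      (Nat.card K : ℤ) ^ (∑ i, ∑ j with j < i, Uniformized.subExp k i j) *
      (∏ i, (Nat.card K : ℤ) ^ (k i / 2)) *
      ∏ a ∈ Finset.univ.image k, nondegSeq (if Odd a then (Nat.card K : ℤ) else 1) (Nat.card K : ℤ)
        (Fintype.card {i // k i = a}) := by
  obtain ⟨τ, δ, hτ, -, hδ, h⟩ := f.exists_invFormCount_mulRoot h2 hf hk
  have hroot : ∃ c, root f.1 = algebraMap K _ c := by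
    have h4 : f.1.natDegree = 1 := hdeg
    have h5 : f.1 = X + C (f.1.coeff 0) := by
      conv_lhs => rw [f.2.1.as_sum, h4]
      simp
    have h6 := (mk_self (f := f.1)).symm.trans (congrArg (mk f.1) h5)
    rw [map_add, mk_X, mk_C] at h6
    exact ⟨-f.1.coeff 0, by rw [map_neg, AdjoinRoot.algebraMap_eq]; linear_combination -h6⟩
  have hid : τ = AlgHom.id K _ := by
    refine AdjoinRoot.algHom_ext ?_
    obtain ⟨c, hc⟩ := hroot
    rw [hc, AlgHom.commutes, AlgHom.commutes]
  rw [h (fun b => if Even b then Nat.card K else 1), hdeg, pow_one]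
  · congr 1
    · congr 1
      refine Finset.prod_congr rfl fun i _ => ?_
      push_cast
      exact prod_range_ite_even _ _
    · refine Finset.prod_congr rfl fun a ha => ?_
      obtain ⟨i, -, rfl⟩ := Finset.mem_image.1 ha
      -- The sign of the block of part size a is (-1)^{a-1}, which exchanges the parities.
      have h7 : Even (k i - 1) ↔ Odd (k i) := by
        have := hk i
        rw [← Nat.not_even_iff_odd, Nat.even_sub' this]
        simp
      simp only [h7]
      push_cast
      rfl
  · intro b
    rw [hδ hdeg, hid]
    split_ifs with hb
    · rw [hb.neg_one_pow, ← pow_one (Nat.card K), ← hdeg, ← natCard_adjoinRoot]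
      exact Nat.card_congr (Equiv.subtypeUnivEquiv fun c => by simp)
    · rw [(Nat.not_even_iff_odd.1 hb).neg_one_pow, Nat.card_eq_one_iff_unique]
      have h3 : ∀ c : AdjoinRoot f.1, c = algebraMap K _ (-1) * AlgHom.id K _ c → c = 0 := by
        intro c hc
        rw [map_neg, map_one, AlgHom.id_apply] at hc
        have : (2 : K) • c = 0 := by rw [two_smul]; linear_combination hc
        exact (smul_eq_zero.1 this).resolve_left h2
      exact ⟨⟨fun x y => Subtype.ext ((h3 _ x.2).trans (h3 _ y.2).symm)⟩, ⟨⟨0, by simp⟩⟩⟩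

/-- The residue field is the sum of the fixed and the negated elements of τ. Multiplication by θ =
root - τ(root), which τ negates, exchanges the two, so they have equal size. If θ were 0, the root
would have square 1, hence be ±1, and f would be linear. -/
theorem exists_card_fixed (h2 : (2 : K) ≠ 0) (hdeg : f.deg ≠ 1)
    {τ : AdjoinRoot f.1 →ₐ[K] AdjoinRoot f.1} (hτ : root _ * τ (root _) = 1) :
    ∃ d, f.deg = 2 * d ∧ ∀ ε : K, (ε = 1 ∨ ε = -1) →
      Nat.card {c // c = algebraMap K _ ε * τ c} = Nat.card K ^ d := by
  have hττ : ∀ c, τ (τ c) = c := by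
    have h : τ.comp τ = AlgHom.id K _ := by
      refine AdjoinRoot.algHom_ext ?_
      have h1 := congrArg τ hτ
      rw [map_mul, map_one] at h1
      rw [AlgHom.comp_apply, AlgHom.id_apply]
      linear_combination (root f.1) * h1 - τ (τ (root f.1)) * hτ
    exact DFunLike.congr_fun h
  have hθ : root f.1 - τ (root f.1) ≠ 0 := by
    intro h0
    have h1 : (root f.1 - 1) * (root f.1 + 1) = 0 := by
      linear_combination root f.1 * h0 + hτ
    have key : ∀ c : K, mk f.1 (X + C c) = 0 → False := by
      intro c hc
      rw [mk_eq_zero] at hc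
      have := natDegree_le_of_dvd hc (X_add_C_ne_zero c)
      rw [natDegree_X_add_C] at this
      exact hdeg (le_antisymm this f.deg_pos)
    rcases mul_eq_zero.1 h1 with h | h
    · refine key (-1) ?_
      rw [map_add, mk_X, mk_C, map_neg, map_one, ← h]
      ring
    · refine key 1 ?_
      rw [map_add, mk_X, mk_C, map_one, h]
  set θ := root f.1 - τ (root f.1) with hθdef
  have hθτ : τ θ = -θ := by rw [hθdef, map_sub, hττ]; ring
  let W : K → Submodule K (AdjoinRoot f.1) := fun ε =>
    LinearMap.ker (LinearMap.id - ε • τ.toLinearMap)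
  have hW : ∀ ε c, c ∈ W ε ↔ c = algebraMap K _ ε * τ c := by
    intro ε c
    rw [LinearMap.mem_ker, LinearMap.sub_apply, sub_eq_zero, LinearMap.smul_apply,
      Algebra.smul_def]
    rfl
  have hcardW : Nat.card (W 1) = Nat.card (W (-1)) := by
    refine Nat.card_congr ((Equiv.mulLeft₀ θ hθ).subtypeEquiv fun c => ?_)
    rw [hW, hW, Equiv.mulLeft₀_apply, map_mul, hθτ, map_neg, map_one]
    constructor
    · intro h
      linear_combination θ * h
    · intro h
      refine mul_left_cancel₀ hθ ?_
      linear_combination h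
  have hprod : Nat.card (AdjoinRoot f.1) = Nat.card (W 1) * Nat.card (W (-1)) := by
    have hhalf : ∀ c : AdjoinRoot f.1, (2 : K)⁻¹ • (c + c) = c := fun c =>
      Uniformized.Involution.half_add_half h2 c
    rw [← Nat.card_prod]
    refine Nat.card_congr
      { toFun := fun c => (⟨(2 : K)⁻¹ • (c + τ c), (hW _ _).2 (by
            rw [map_smul, map_add, hττ, map_one, one_mul, add_comm])⟩,
          ⟨(2 : K)⁻¹ • (c - τ c), (hW _ _).2 (by
            rw [map_smul, map_sub, hττ, map_neg, map_one, neg_one_mul, ← smul_neg, neg_sub])⟩)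
        invFun := fun x => x.1.1 + x.2.1
        left_inv := fun c => ?_
        right_inv := fun x => ?_ }
    · change (2 : K)⁻¹ • (c + τ c) + (2 : K)⁻¹ • (c - τ c) = c
      rw [← smul_add, ← hhalf c]
      congr 1
      rw [hhalf]
      ring
    · have h3 := (hW _ _).1 x.1.2
      have h4 := (hW _ _).1 x.2.2
      rw [map_one, one_mul] at h3
      rw [map_neg, map_one, neg_one_mul] at h4
      refine Prod.ext (Subtype.ext ?_) (Subtype.ext ?_)
      · change (2 : K)⁻¹ • (x.1.1 + x.2.1 + τ (x.1.1 + x.2.1)) = x.1.1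
        rw [map_add, ← h3, ← neg_eq_iff_eq_neg.2 h4,
          show x.1.1 + x.2.1 + (x.1.1 + -x.2.1) = x.1.1 + x.1.1 by ring, hhalf]
      · change (2 : K)⁻¹ • (x.1.1 + x.2.1 - τ (x.1.1 + x.2.1)) = x.2.1
        rw [map_add, ← h3, ← neg_eq_iff_eq_neg.2 h4,
          show x.1.1 + x.2.1 - (x.1.1 + -x.2.1) = x.2.1 + x.2.1 by ring, hhalf]
  have hK : 1 < Nat.card K := Finite.one_lt_card
  have hd := Module.natCard_eq_pow_finrank (K := K) (V := W 1)
  refine ⟨Module.finrank K (W 1), ?_, ?_⟩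
  · rw [natCard_adjoinRoot, ← hcardW, hd, ← pow_add] at hprod
    have := Nat.pow_right_injective hK hprod
    omega
  · rintro ε (rfl | rfl)
    · rw [← hd]
      exact Nat.card_congr (Equiv.subtypeEquivRight fun c => (hW _ c).symm)
    · rw [← hd, hcardW]
      exact Nat.card_congr (Equiv.subtypeEquivRight fun c => (hW _ c).symm)

theorem even_deg_of_selfDual (h2 : (2 : K) ≠ 0) (hf : f.star = f) (hdeg : f.deg ≠ 1) :
    ∃ d, f.deg = 2 * d := by
  obtain ⟨v, hv, S, h3, h4, -⟩ := f.exists_involution h2 hf (N := 1) one_pos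
  obtain ⟨d, hd, -⟩ := f.exists_card_fixed h2 hdeg h4
  exact ⟨d, hd⟩

/-- Both signs have q^d fixed scalars, so the value of δ does not matter. -/
theorem invFormCount_mulRoot_selfDual [LinearOrder I] (h2 : (2 : K) ≠ 0) (hf : f.star = f)
    {d : ℕ} (hd : f.deg = 2 * d) (hk : ∀ i, 0 < k i) :
    (invFormCount (f.mulRoot k) : ℤ) =
      (((Nat.card K : ℤ) ^ d) ^ 2) ^ (∑ i, ∑ j with j < i, Uniformized.subExp k i j) *
      (∏ i, ((Nat.card K : ℤ) ^ d) ^ (k i - 1)) *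
      ∏ a ∈ Finset.univ.image k, nondegSeq ((Nat.card K : ℤ) ^ d) (((Nat.card K : ℤ) ^ d) ^ 2)
        (Fintype.card {i // k i = a}) := by
  obtain ⟨τ, δ, hτ, hδ, -, h⟩ := f.exists_invFormCount_mulRoot h2 hf hk
  obtain ⟨d', hd', hcard⟩ := f.exists_card_fixed h2 (by omega) hτ
  obtain rfl : d' = d := by omega
  rw [h (fun _ => Nat.card K ^ d'), hd, mul_comm 2 d', pow_mul]
  · push_cast
    simp only [Finset.prod_const, Finset.card_range]
  · intro b
    refine hcard _ ?_
    rcases hδ with rfl | rfl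
    · exact Or.inl (one_pow b)
    · exact neg_one_pow_eq_or K b

end Phi


/-! ### Invariant forms on direct sums -/

section Pairings

variable {K V V' : Type*} [Field K] [AddCommGroup V] [Module K V] [AddCommGroup V'] [Module K V']

/-- Moving T across γ costs a power of T'. Supplying T' to the power deg p in advance pays for every
term and reverses the order of the coefficients. -/
theorem pairing_aeval_apply {T : V →ₗ[K] V} {T' : V' →ₗ[K] V'} {γ : V →ₗ[K] V' →ₗ[K] K}
    (hγ : ∀ m m', γ (T m) (T' m') = γ m m') (p : K[X]) (x : V) (y : V') :
    γ (aeval T p x) ((T' ^ p.natDegree) y) = γ x (aeval T' p.reverse y) := by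
  have hpow : ∀ (i : ℕ) x y, γ ((T ^ i) x) ((T' ^ i) y) = γ x y := by
    intro i
    induction i with
    | zero => intro x y; rfl
    | succ i ih =>
      intro x y
      rw [pow_succ', pow_succ', Module.End.mul_apply, Module.End.mul_apply, hγ, ih]
  rw [aeval_eq_sum_range, aeval_eq_sum_range' (n := p.natDegree + 1)
    (Nat.lt_succ_of_le (reverse_natDegree_le p))]
  rw [LinearMap.sum_apply, LinearMap.sum_apply, map_sum, map_sum, LinearMap.sum_apply,
    ← Finset.sum_range_reflect]
  refine Finset.sum_congr rfl fun i hi => ?_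
  have hi' : i ≤ p.natDegree := Nat.lt_succ_iff.1 (Finset.mem_range.1 hi)
  have h1 : p.natDegree + 1 - 1 - i = p.natDegree - i := by omega
  rw [h1, coeff_reverse, revAt_le hi', LinearMap.smul_apply, LinearMap.smul_apply, map_smul,
    map_smul, LinearMap.smul_apply]
  congr 1
  conv_lhs => rw [show p.natDegree = (p.natDegree - i) + i by omega, pow_add]
  rw [Module.End.mul_apply, Nat.add_sub_cancel, hpow]

/-- By coprimality the reversed polynomial at T' is onto V', and the adjoint formula turns it into
p(T) = 0. -/
theorem pairing_eq_zero {T : V →ₗ[K] V} {T' : V' →ₗ[K] V'} {γ : V →ₗ[K] V' →ₗ[K] K}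
    (hγ : ∀ m m', γ (T m) (T' m') = γ m m') {p q : K[X]} (hp : aeval T p = 0)
    (hq : aeval T' q = 0) (hpq : IsCoprime p.reverse q) (x : V) (y : V') : γ x y = 0 := by
  obtain ⟨u, v, huv⟩ := hpq
  have h1 : y = aeval T' p.reverse (aeval T' u y) := by
    have h2 := LinearMap.congr_fun (congrArg (aeval T') huv) y
    rw [map_add, map_mul, map_mul, hq, mul_zero, add_zero, map_one, Module.End.one_apply,
      ← map_mul, mul_comm, map_mul, Module.End.mul_apply] at h2
    exact h2.symm
  rw [h1, ← pairing_aeval_apply hγ, hp, LinearMap.zero_apply, map_zero, LinearMap.zero_apply]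

theorem invFormCount_congr {T : V →ₗ[K] V} {T' : V' →ₗ[K] V'} (e : V ≃ₗ[K] V')
    (he : ∀ x, e (T x) = T' (e x)) : invFormCount T = invFormCount T' := by
  have he' : ∀ y, e.symm (T' y) = T (e.symm y) := fun y => by
    rw [LinearEquiv.symm_apply_eq, he, LinearEquiv.apply_symm_apply]
  refine Nat.card_congr
    { toFun := fun β => ⟨β.1.compl₁₂ e.symm.toLinearMap e.symm.toLinearMap, ?_, ?_, ?_⟩
      invFun := fun β => ⟨β.1.compl₁₂ e.toLinearMap e.toLinearMap, ?_, ?_, ?_⟩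
      left_inv := fun β => ?_
      right_inv := fun β => ?_ }
  · exact fun m m' => β.2.1 _ _
  · intro m hm
    have := β.2.2.1 (e.symm m) fun m' => by simpa using hm (e m')
    simpa using this
  · intro m m'
    simp only [LinearMap.compl₁₂_apply, LinearEquiv.coe_coe, he']
    exact β.2.2.2 _ _
  · exact fun m m' => β.2.1 _ _
  · intro m hm
    have := β.2.2.1 (e m) fun m' => by simpa using hm (e.symm m')
    simpa using this
  · intro m m'
    simp only [LinearMap.compl₁₂_apply, LinearEquiv.coe_coe, he]
    exact β.2.2.2 _ _
  · ext x y
    simp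
  · ext x y
    simp

/-- Left separation embeds V in the dual of V'. Equal finite cardinalities make this embedding onto,
and functionals separate the points of V'. -/
theorem separating_right_of_card_eq [Finite V] [Finite V'] (hcard : Nat.card V = Nat.card V')
    {γ : V →ₗ[K] V' →ₗ[K] K} (h : ∀ m, (∀ m', γ m m' = 0) → m = 0) :
    ∀ m', (∀ m, γ m m' = 0) → m' = 0 := by
  have : FiniteDimensional K V := Module.Finite.of_finite
  have : FiniteDimensional K V' := Module.Finite.of_finite
  have hinj : Function.Injective γ := by
    rw [← LinearMap.ker_eq_bot, LinearMap.ker_eq_bot']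
    exact fun m hm => h m fun m' => by rw [hm, LinearMap.zero_apply]
  have hsurj : Function.Surjective γ := by
    by_cases hK : Finite K
    · have : Finite (Module.Dual K V') := Module.finite_of_finite K
      refine ((Nat.bijective_iff_injective_and_card γ).2 ⟨hinj, ?_⟩).2
      rw [hcard, Module.natCard_eq_pow_finrank (K := K),
        Module.natCard_eq_pow_finrank (K := K) (V := Module.Dual K V'), Subspace.dual_finrank_eq]
    -- A finite vector space over an infinite field is zero.
    · have h0 : Subsingleton V' := by
        by_contra hn
        rw [not_subsingleton_iff_nontrivial] at hn
        obtain ⟨v, hv⟩ := exists_ne (0 : V')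
        exact hK (Finite.of_injective (fun c : K => c • v) (smul_left_injective K hv))
      exact fun φ => ⟨0, LinearMap.ext fun y => by
        rw [Subsingleton.elim y 0, map_zero, map_zero]⟩
  intro m' hm'
  refine (Module.forall_dual_apply_eq_zero_iff K m').1 fun φ => ?_
  obtain ⟨m, rfl⟩ := hsurj φ
  exact hm' m

/-- Both summands are totally isotropic, so an invariant form is its restriction to V × V'
symmetrized. Nondegeneracy then needs separation on both sides, and one follows from the other by
equality of cardinalities. -/
theorem invFormCount_prodMap [Finite V] [Finite V'] (hcard : Nat.card V = Nat.card V')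
    {T : V →ₗ[K] V} {T' : V' →ₗ[K] V'}
    (h1 : ∀ γ : V →ₗ[K] V →ₗ[K] K, (∀ m m', γ (T m) (T m') = γ m m') → γ = 0)
    (h2 : ∀ γ : V' →ₗ[K] V' →ₗ[K] K, (∀ m m', γ (T' m) (T' m') = γ m m') → γ = 0) :
    invFormCount (T.prodMap T') = invPairingCount T T' := by
  have key : ∀ β : V × V' →ₗ[K] V × V' →ₗ[K] K, (∀ m m', β m m' = β m' m) →
      (∀ m m', β (T.prodMap T' m) (T.prodMap T' m') = β m m') → ∀ m m',
      β m m' = β (m.1, 0) (0, m'.2) + β (m'.1, 0) (0, m.2) := by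
    intro β hs hi m m'
    have e1 := LinearMap.congr_fun (LinearMap.congr_fun (h1 (β.compl₁₂ (LinearMap.inl K V V')
      (LinearMap.inl K V V')) fun x y => by
        simpa using hi (x, 0) (y, 0)) m.1) m'.1
    have e2 := LinearMap.congr_fun (LinearMap.congr_fun (h2 (β.compl₁₂ (LinearMap.inr K V V')
      (LinearMap.inr K V V')) fun x y => by
        simpa using hi (0, x) (0, y)) m.2) m'.2
    simp only [LinearMap.compl₁₂_apply, LinearMap.inl_apply, LinearMap.inr_apply,
      LinearMap.zero_apply] at e1 e2
    have hm : ∀ m : V × V', m = (m.1, 0) + (0, m.2) := fun m => by simp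
    conv_lhs => rw [hm m, hm m', map_add β, LinearMap.add_apply, map_add, map_add, e1, e2]
    rw [hs (0, m.2)]
    ring
  refine Nat.card_congr
    { toFun := fun β => ⟨β.1.compl₁₂ (LinearMap.inl K V V') (LinearMap.inr K V V'), ?_, ?_⟩
      invFun := fun γ => ⟨γ.1.compl₁₂ (LinearMap.fst K V V') (LinearMap.snd K V V') +
        γ.1.flip.compl₁₂ (LinearMap.snd K V V') (LinearMap.fst K V V'), ?_, ?_, ?_⟩
      left_inv := fun β => ?_
      right_inv := fun γ => ?_ }
  · intro m hm
    have := β.2.2.1 (m, 0) fun m' => by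
      have h3 := hm m'.2
      rw [LinearMap.compl₁₂_apply] at h3
      rw [key β.1 β.2.1 β.2.2.2]
      refine (congrArg₂ (· + ·) h3 (map_zero _)).trans (add_zero 0)
    exact (Prod.mk.inj this).1
  · intro m m'
    simpa using β.2.2.2 (m, 0) (0, m')
  · intro m m'
    simp [add_comm]
  · intro m hm
    have hr := separating_right_of_card_eq hcard γ.2.1
    refine Prod.ext (γ.2.1 _ fun m' => ?_) (hr _ fun m' => ?_)
    · simpa using hm (0, m')
    · simpa using hm (m', 0)
  · intro m m'
    simp [γ.2.2]
  · ext1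
    refine LinearMap.ext fun m => LinearMap.ext fun m' => ?_
    rw [key β.1 β.2.1 β.2.2.2]
    simp
  · ext m m'
    simp

end Pairings

/-! ### Orthogonal decomposition along the fibres of a map. -/

section Pi

variable {K ι : Type*} [Field K] {V : ι → Type*} [∀ i, AddCommGroup (V i)] [∀ i, Module K (V i)]

/-- The product of a family of endomorphisms. -/
def piEnd (T : ∀ i, V i →ₗ[K] V i) : (∀ i, V i) →ₗ[K] ∀ i, V i :=
  LinearMap.pi fun i => T i ∘ₗ LinearMap.proj i

theorem piEnd_apply (T : ∀ i, V i →ₗ[K] V i) (x : ∀ i, V i) (i : ι) :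
    piEnd T x i = T i (x i) := rfl

variable {Ω : Type*} [DecidableEq Ω] (r : ι → Ω)

variable (K V) in
/-- Extension by zero of vectors supported on a fibre. -/
def fiberExtend (ω : Ω) : (∀ i : {i // r i = ω}, V i) →ₗ[K] ∀ i, V i where
  toFun x i := if h : r i = ω then x ⟨i, h⟩ else 0
  map_add' x y := by
    funext i
    by_cases h : r i = ω <;> simp [h]
  map_smul' c x := by
    funext i
    by_cases h : r i = ω <;> simp [h]

variable (K V) in
/-- Restriction of vectors to a fibre. -/
def fiberRestrict (ω : Ω) : (∀ i, V i) →ₗ[K] ∀ i : {i // r i = ω}, V i where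
  toFun x i := x i
  map_add' _ _ := rfl
  map_smul' _ _ := rfl

variable {r}

theorem fiberExtend_apply_of_eq {ω : Ω} (x : ∀ i : {i // r i = ω}, V i) {i : ι} (h : r i = ω) :
    fiberExtend K V r ω x i = x ⟨i, h⟩ := dif_pos h

theorem fiberExtend_apply_of_ne {ω : Ω} (x : ∀ i : {i // r i = ω}, V i) {i : ι} (h : r i ≠ ω) :
    fiberExtend K V r ω x i = 0 := dif_neg h

theorem fiberRestrict_fiberExtend {ω : Ω} (x : ∀ i : {i // r i = ω}, V i) :
    fiberRestrict K V r ω (fiberExtend K V r ω x) = x :=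
  funext fun i => fiberExtend_apply_of_eq (K := K) x i.2

theorem fiberRestrict_fiberExtend_of_ne {ω ω' : Ω} (h : ω ≠ ω') (x : ∀ i : {i // r i = ω}, V i) :
    fiberRestrict K V r ω' (fiberExtend K V r ω x) = 0 :=
  funext fun i => fiberExtend_apply_of_ne (K := K) x fun hi => h (hi.symm.trans i.2)

theorem fiberExtend_piEnd (T : ∀ i, V i →ₗ[K] V i) {ω : Ω} (x : ∀ i : {i // r i = ω}, V i) :
    fiberExtend K V r ω (piEnd (fun i : {i // r i = ω} => T i) x) =
      piEnd T (fiberExtend K V r ω x) := by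
  funext i
  rw [piEnd_apply]
  by_cases h : r i = ω
  · rw [fiberExtend_apply_of_eq _ h, fiberExtend_apply_of_eq _ h]; rfl
  · rw [fiberExtend_apply_of_ne _ h, fiberExtend_apply_of_ne _ h, map_zero]

variable [Fintype ι]

theorem sum_fiberExtend (x : ∀ i, V i) :
    ∑ ω : Finset.univ.image r, fiberExtend K V r ω.1 (fiberRestrict K V r ω.1 x) = x := by
  funext i
  rw [Finset.sum_apply, Finset.sum_eq_single ⟨r i, Finset.mem_image_of_mem r (Finset.mem_univ i)⟩]
  · exact fiberExtend_apply_of_eq _ rfl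
  · intro ω _ hω
    exact fiberExtend_apply_of_ne _ fun h => hω (Subtype.ext h.symm)
  · intro h
    exact (h (Finset.mem_univ _)).elim

/-- Summands in different fibres of r pair to zero, so an invariant form is the orthogonal sum of
its restrictions to the fibres. -/
theorem invFormCount_piEnd [DecidableEq ι] (T : ∀ i, V i →ₗ[K] V i) (r : ι → Ω)
    (hr : ∀ i j, r i ≠ r j → ∀ γ : V i →ₗ[K] V j →ₗ[K] K,
      (∀ m m', γ (T i m) (T j m') = γ m m') → γ = 0) :
    invFormCount (piEnd T) = ∏ ω ∈ Finset.univ.image r,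
      invFormCount (piEnd fun i : {i // r i = ω} => T i) := by
  have hsingle : ∀ (i : ι) (x : V i), piEnd T (Pi.single i x) = Pi.single i (T i x) := by
    intro i x
    funext j
    rw [piEnd_apply]
    by_cases h : j = i
    · subst h; simp
    · simp [h]
  have hcross : ∀ β : (∀ i, V i) →ₗ[K] (∀ i, V i) →ₗ[K] K,
      (∀ m m', β (piEnd T m) (piEnd T m') = β m m') → ∀ ω ω' : Ω, ω ≠ ω' →
      ∀ (x : ∀ i : {i // r i = ω}, V i) (y : ∀ i : {i // r i = ω'}, V i),
      β (fiberExtend K V r ω x) (fiberExtend K V r ω' y) = 0 := by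
    intro β hβ ω ω' hω x y
    rw [← Finset.univ_sum_single (fiberExtend K V r ω x),
      ← Finset.univ_sum_single (fiberExtend K V r ω' y), map_sum β, LinearMap.sum_apply]
    refine Finset.sum_eq_zero fun i _ => ?_
    rw [map_sum]
    refine Finset.sum_eq_zero fun j _ => ?_
    by_cases hi : r i = ω
    · by_cases hj : r j = ω'
      · have := hr i j (fun h => hω (by rw [← hi, h, hj])) (β.compl₁₂ (LinearMap.single K V i)
          (LinearMap.single K V j)) fun m m' => by
            simp only [LinearMap.compl₁₂_apply, LinearMap.single_apply]
            rw [← hsingle, ← hsingle, hβ]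
        exact LinearMap.congr_fun (LinearMap.congr_fun this _) _
      · rw [fiberExtend_apply_of_ne _ hj, Pi.single_zero, map_zero]
    · rw [fiberExtend_apply_of_ne _ hi, Pi.single_zero, map_zero, LinearMap.zero_apply]
  rw [← Finset.prod_coe_sort]
  unfold invFormCount
  rw [← Nat.card_pi]
  refine Nat.card_congr
    { toFun := fun β ω =>
        ⟨β.1.compl₁₂ (fiberExtend K V r ω.1) (fiberExtend K V r ω.1), ?_, ?_, ?_⟩
      invFun := fun β => ⟨∑ ω, (β ω).1.compl₁₂ (fiberRestrict K V r ω.1)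
        (fiberRestrict K V r ω.1), ?_, ?_, ?_⟩
      left_inv := fun β => ?_
      right_inv := fun β => ?_ }
  · exact fun m m' => β.2.1 _ _
  · intro m hm
    have h0 := β.2.2.1 (fiberExtend K V r ω.1 m) fun m' => by
      rw [← sum_fiberExtend (K := K) (r := r) m', map_sum]
      refine Finset.sum_eq_zero fun ω' _ => ?_
      by_cases h : ω = ω'
      · subst h
        exact hm _
      · exact hcross β.1 β.2.2.2 _ _ (fun h' => h (Subtype.ext h')) _ _
    rw [← fiberRestrict_fiberExtend (K := K) m, h0, map_zero]
  · intro m m'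
    simp only [LinearMap.compl₁₂_apply]
    rw [fiberExtend_piEnd, fiberExtend_piEnd, β.2.2.2]
  · intro m m'
    simp only [LinearMap.sum_apply, LinearMap.compl₁₂_apply]
    exact Finset.sum_congr rfl fun ω _ => (β ω).2.1 _ _
  · intro m hm
    have h0 : ∀ ω : Finset.univ.image r, fiberRestrict K V r ω.1 m = 0 := by
      intro ω
      refine (β ω).2.2.1 _ fun m' => ?_
      have h1 := hm (fiberExtend K V r ω.1 m')
      simp only [LinearMap.sum_apply, LinearMap.compl₁₂_apply] at h1
      rw [Finset.sum_eq_single ω, fiberRestrict_fiberExtend] at h1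
      · exact h1
      · intro ω' _ hω'
        rw [fiberRestrict_fiberExtend_of_ne fun h => hω' (Subtype.ext h.symm), map_zero]
      · intro h
        exact (h (Finset.mem_univ _)).elim
    rw [← sum_fiberExtend (K := K) (r := r) m]
    exact Finset.sum_eq_zero fun ω _ => by rw [h0, map_zero]
  · intro m m'
    simp only [LinearMap.sum_apply, LinearMap.compl₁₂_apply]
    exact Finset.sum_congr rfl fun ω _ => (β ω).2.2.2 _ _
  · ext1
    refine LinearMap.ext fun m => LinearMap.ext fun m' => ?_
    simp only [LinearMap.sum_apply, LinearMap.compl₁₂_apply]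
    conv_rhs => rw [← sum_fiberExtend (K := K) (r := r) m, map_sum, LinearMap.sum_apply]
    refine Finset.sum_congr rfl fun ω _ => ?_
    conv_rhs => rw [← sum_fiberExtend (K := K) (r := r) m', map_sum]
    rw [Finset.sum_eq_single ω]
    · intro ω' _ hω'
      exact hcross β.1 β.2.2.2 _ _ (fun h => hω' (Subtype.ext h.symm)) _ _
    · intro h
      exact (h (Finset.mem_univ _)).elim
  · funext ω
    ext1
    refine LinearMap.ext fun m => LinearMap.ext fun m' => ?_
    simp only [LinearMap.sum_apply, LinearMap.compl₁₂_apply]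
    rw [Finset.sum_eq_single ω, fiberRestrict_fiberExtend, fiberRestrict_fiberExtend]
    · intro ω' _ hω'
      rw [fiberRestrict_fiberExtend_of_ne fun h => hω' (Subtype.ext h.symm), map_zero,
        LinearMap.zero_apply]
    · intro h
      exact (h (Finset.mem_univ _)).elim

end Pi

/-! ### Symmetric matrices and bilinear forms. -/

section Matrix

variable {K : Type*} [Field K]

/-- A B Aᵀ = B is equivalent to Aᵀ B⁻¹ A = B⁻¹, which is invariance under A of the form with Gram
matrix B⁻¹. -/
theorem formCount_eq_invFormCount {n : ℕ} (A : GL (Fin n) K) :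
    formCount A = invFormCount (Matrix.toLin' (A : Matrix (Fin n) (Fin n) K)) := by
  have hinj : ∀ M M' : Matrix (Fin n) (Fin n) K,
      M = M' ↔ ∀ x y : Fin n → K, x ⬝ᵥ M.mulVec y = x ⬝ᵥ M'.mulVec y := by
    intro M M'
    refine ⟨fun h x y => by rw [h], fun h => ?_⟩
    ext i j
    simpa using h (Pi.single i 1) (Pi.single j 1)
  have step : invFormCount (Matrix.toLin' (A : Matrix (Fin n) (Fin n) K)) =
      Nat.card {M : Matrix (Fin n) (Fin n) K // M.transpose = M ∧ M.det ≠ 0 ∧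
        (A : Matrix (Fin n) (Fin n) K).transpose * M * A = M} := by
    refine (Nat.card_congr ((Matrix.toLinearMap₂' K).toEquiv.subtypeEquiv fun M => ?_)).symm
    refine and_congr ?_ (and_congr ?_ ?_)
    · rw [hinj]
      refine forall_congr' fun x => forall_congr' fun y => ?_
      change _ ↔ Matrix.toLinearMap₂' K M x y = Matrix.toLinearMap₂' K M y x
      rw [Matrix.toLinearMap₂'_apply', Matrix.toLinearMap₂'_apply', Matrix.mulVec_transpose,
        dotProduct_comm x, ← Matrix.dotProduct_mulVec, eq_comm]
    · rw [ne_eq, ← Matrix.exists_vecMul_eq_zero_iff, not_exists]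
      refine forall_congr' fun x => ?_
      have h1 : (∀ y, x ⬝ᵥ M.mulVec y = 0) ↔ Matrix.vecMul x M = 0 := by
        simp only [Matrix.dotProduct_mulVec]
        exact dotProduct_eq_zero_iff
      have h2 : ∀ y, (Matrix.toLinearMap₂' K).toEquiv M x y = x ⬝ᵥ M.mulVec y := fun y =>
        Matrix.toLinearMap₂'_apply' _ _ _
      simp only [h2]
      rw [h1]
      tauto
    · rw [hinj]
      refine forall_congr' fun x => forall_congr' fun y => ?_
      change _ ↔ Matrix.toLinearMap₂' K M (Matrix.toLin' A.1 x) (Matrix.toLin' A.1 y) =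
        Matrix.toLinearMap₂' K M x y
      rw [Matrix.toLinearMap₂'_apply', Matrix.toLinearMap₂'_apply', Matrix.toLin'_apply,
        Matrix.toLin'_apply, ← Matrix.mulVec_mulVec, ← Matrix.mulVec_mulVec,
        Matrix.dotProduct_mulVec, Matrix.vecMul_transpose]
  rw [step, formCount]
  refine Nat.card_congr
    { toFun := fun B => ⟨(B.1⁻¹ : GL (Fin n) K).1, ?_, ?_, ?_⟩
      invFun := fun M => ⟨(Matrix.GeneralLinearGroup.mkOfDetNeZero M.1 M.2.2.1)⁻¹, ?_, ?_⟩
      left_inv := fun B => ?_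
      right_inv := fun M => ?_ }
  · rw [Matrix.coe_units_inv, Matrix.transpose_nonsing_inv, B.2.1]
  · exact ((Matrix.isUnit_iff_isUnit_det _).1 (B.1⁻¹).isUnit).ne_zero
  · have h1 : (B.1⁻¹ : GL (Fin n) K).1 * B.1.1 = 1 := B.1.inv_mul
    have h2 : ((B.1⁻¹ : GL (Fin n) K).1 * A.1 * B.1.1) * A.1.transpose = 1 := by
      rw [← h1]
      conv_rhs => rw [← B.2.2]
      simp only [Matrix.mul_assoc]
    -- One-sided inverses of square matrices are two-sided; this carries Aᵀ from the right end to
    -- the left.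
    rw [mul_eq_one_comm] at h2
    have h3 : (A.1.transpose * (B.1⁻¹ : GL (Fin n) K).1 * A.1) * B.1.1 = 1 := by
      rw [← h2]
      simp only [Matrix.mul_assoc]
    calc _ = (A.1.transpose * (B.1⁻¹ : GL (Fin n) K).1 * A.1) * (B.1.1 * (B.1⁻¹ : GL (Fin n) K).1) := by
          rw [B.1.mul_inv, mul_one]
      _ = _ := by rw [← mul_assoc, h3, one_mul]
  · rw [Matrix.coe_units_inv, Matrix.transpose_nonsing_inv]
    congr 1
    exact M.2.1
  · set B := (Matrix.GeneralLinearGroup.mkOfDetNeZero M.1 M.2.2.1)⁻¹ with hB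
    have h1 : M.1 * B.1 = 1 := (Matrix.GeneralLinearGroup.mkOfDetNeZero M.1 M.2.2.1).mul_inv
    have h1' : B.1 * M.1 = 1 := (Matrix.GeneralLinearGroup.mkOfDetNeZero M.1 M.2.2.1).inv_mul
    have h2 : A.1.transpose * (M.1 * A.1 * B.1) = 1 := by
      rw [← h1]
      conv_rhs => rw [← M.2.2.2]
      simp only [Matrix.mul_assoc]
    rw [mul_eq_one_comm] at h2
    calc _ = (B.1 * M.1) * (A.1 * B.1 * A.1.transpose) := by rw [h1', one_mul]
      _ = B.1 * (M.1 * A.1 * B.1 * A.1.transpose) := by simp only [Matrix.mul_assoc]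
      _ = _ := by rw [h2, mul_one]
  · ext1
    simp only
    rw [inv_eq_iff_eq_inv]
    exact Units.ext rfl
  · ext1
    simp only [inv_inv]
    rfl

end Matrix


/-! ### The modules of the conjugacy classes -/

theorem exists_equiv_of_map_univ_eq {α β γ : Type*} [Fintype α] [Fintype β] [DecidableEq γ]
    {f : α → γ} {g : β → γ}
    (h : (Finset.univ : Finset α).val.map f = (Finset.univ : Finset β).val.map g) :
    ∃ e : α ≃ β, ∀ a, g (e a) = f a := by
  have hc : ∀ c, Nonempty ({a // f a = c} ≃ {b // g b = c}) := by
    intro c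
    refine ⟨Fintype.equivOfCardEq ?_⟩
    have h1 := congrArg (Multiset.count c) h
    rw [Multiset.count_map, Multiset.count_map] at h1
    rw [Fintype.card_subtype, Fintype.card_subtype]
    simp only [eq_comm (a := c)] at h1
    exact h1
  exact ⟨Equiv.ofFiberEquiv fun c => (hc c).some, fun a => Equiv.ofFiberEquiv_map _ a⟩

namespace IntPartition

/-- The number of parts. -/
abbrev length (lam : IntPartition) : ℕ := lam.sortedParts.length

/-- The `i`-th largest part. -/
def part (lam : IntPartition) (i : Fin lam.length) : ℕ := (lam.sortedParts.get i : ℕ)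

theorem part_pos (lam : IntPartition) (i : Fin lam.length) : 0 < lam.part i := PNat.pos _

theorem coe_sortedParts (lam : IntPartition) : (lam.sortedParts : Multiset ℕ+) = lam :=
  Multiset.sort_eq _ _

theorem map_get_univ (lam : IntPartition) :
    (Finset.univ : Finset (Fin lam.length)).val.map (fun i => lam.sortedParts.get i) = lam := by
  conv_rhs => rw [← coe_sortedParts lam]
  have := Fin.univ_val_map (fun i : Fin lam.length => lam.sortedParts.get i)
  rw [this]
  congr 1
  exact List.ofFn_get _

theorem exists_equiv_toType (lam : IntPartition) :
    ∃ e : Fin lam.length ≃ lam.ToType, ∀ i, ((e i).1 : ℕ) = lam.part i := by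
  obtain ⟨e, he⟩ := exists_equiv_of_map_univ_eq (f := fun i : Fin lam.length =>
    lam.sortedParts.get i) (g := fun x : lam.ToType => x.1) (by
      rw [map_get_univ]
      exact (Multiset.map_univ_coe lam).symm)
  exact ⟨e, fun i => congrArg _ (he i)⟩

theorem sum_part {M : Type*} [AddCommMonoid M] (lam : IntPartition) (g : ℕ → M) :
    ∑ i, g (lam.part i) = (lam.map fun d : ℕ+ => g d).sum := by
  conv_rhs => rw [← map_get_univ lam, Multiset.map_map]
  rfl

theorem card_part_eq (lam : IntPartition) (d : ℕ+) :
    Fintype.card {i // lam.part i = d} = lam.count d := by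
  conv_rhs => rw [← map_get_univ lam, Multiset.count_map]
  rw [Fintype.card_subtype, ← Finset.filter_val, Finset.card_val]
  refine congrArg _ (Finset.filter_congr fun i _ => ?_)
  rw [part, PNat.coe_inj, eq_comm]

end IntPartition

/-! ### Primary components and the orbits of the duality. -/

section Primary

open AdjoinRoot

variable {K : Type*} [Field K]

/-- The sum of the `K[t] / (f ^ k)` over the parts `k` of `lam`. -/
abbrev PrimaryModule (f : Phi K) (lam : IntPartition) : Type _ :=
  ∀ i, AdjoinRoot (f.1 ^ lam.part i)

/-- Multiplication by `t`. -/
noncomputable abbrev primaryEnd (f : Phi K) (lam : IntPartition) :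
    PrimaryModule f lam →ₗ[K] PrimaryModule f lam := f.mulRoot lam.part

theorem Phi.natCard_adjoinRoot_pow (f : Phi K) (k : ℕ) :
    Nat.card (AdjoinRoot (f.1 ^ k)) = (Nat.card K ^ f.deg) ^ k := by
  have := (AdjoinRoot.powerBasis (pow_ne_zero k f.2.2.1.ne_zero)).finite
  rw [Module.natCard_eq_pow_finrank (K := K), PowerBasis.finrank (AdjoinRoot.powerBasis
    (pow_ne_zero _ f.2.2.1.ne_zero)), AdjoinRoot.powerBasis_dim, natDegree_pow, mul_comm, pow_mul]
  rfl

theorem Phi.finite_adjoinRoot_pow [Finite K] (f : Phi K) (k : ℕ) : Finite (AdjoinRoot (f.1 ^ k)) := by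
  have := (AdjoinRoot.powerBasis (pow_ne_zero k f.2.2.1.ne_zero)).finite
  exact Module.finite_of_finite K

theorem aeval_mulRoot_apply (f : Phi K) {I : Type*} (k : I → ℕ) (p : K[X])
    (x : ∀ i, AdjoinRoot (f.1 ^ k i)) (i : I) :
    aeval (f.mulRoot k) p x i = mk _ p * x i := by
  induction p using Polynomial.induction_on' with
  | add p q hp hq => rw [map_add, LinearMap.add_apply, Pi.add_apply, hp, hq, map_add, add_mul]
  | monomial n a =>
    rw [aeval_monomial, ← C_mul_X_pow_eq_monomial, map_mul, map_pow, mk_X, mk_C]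
    have h : ∀ n : ℕ, (f.mulRoot k ^ n) x i = root _ ^ n * x i := by
      intro n
      induction n with
      | zero => rw [pow_zero, pow_zero, one_mul]; rfl
      | succ n ih =>
        rw [pow_succ', Module.End.mul_apply, Phi.mulRoot_apply, ih, pow_succ', mul_assoc]
    rw [Module.End.mul_apply, Module.algebraMap_end_apply, Pi.smul_apply, h, Algebra.smul_def,
      AdjoinRoot.algebraMap_eq, mul_assoc]

theorem exists_pow_aeval_primaryEnd (f : Phi K) (lam : IntPartition) :
    ∃ N, aeval (primaryEnd f lam) (f.1 ^ N) = 0 := by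
  obtain ⟨N, -, hN⟩ := Phi.exists_pos_bound lam.part
  refine ⟨N, LinearMap.ext fun x => funext fun i => ?_⟩
  rw [aeval_mulRoot_apply, mk_eq_zero.2 (pow_dvd_pow _ (hN i)), zero_mul]
  rfl

theorem Phi.isCoprime_of_ne {f g : Phi K} (h : f ≠ g) : IsCoprime f.1 g.1 := by
  rw [f.2.2.1.coprime_iff_not_dvd]
  intro hd
  exact h (Subtype.ext (eq_of_monic_of_associated f.2.1 g.2.1
    (f.2.2.1.associated_of_dvd g.2.2.1 hd)))

/-- The reversal of f^N is a nonzero constant times (f*)^N, which is prime to every power of g. -/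
theorem primary_pairing_eq_zero {f g : Phi K} (h : f.star ≠ g) {lam nu : IntPartition}
    {γ : PrimaryModule f lam →ₗ[K] PrimaryModule g nu →ₗ[K] K}
    (hγ : ∀ m m', γ (primaryEnd f lam m) (primaryEnd g nu m') = γ m m') : γ = 0 := by
  obtain ⟨N, hN⟩ := exists_pow_aeval_primaryEnd f lam
  obtain ⟨N', hN'⟩ := exists_pow_aeval_primaryEnd g nu
  refine LinearMap.ext fun x => LinearMap.ext fun y => pairing_eq_zero hγ hN hN' ?_ x y
  rw [reverse_pow_of_domain, Phi.reverse_eq]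
  refine IsCoprime.pow ?_
  exact (isCoprime_mul_unit_left_left (isUnit_C.2 (isUnit_iff_ne_zero.2 f.2.2.2)) _ _).2
    (Phi.isCoprime_of_ne h)

variable (μ : Phi K →₀ IntPartition)

/-- The product over the support of the primary components. -/
abbrev SupportModule : Type _ := ∀ f : μ.support, PrimaryModule f.1 (μ f.1)

/-- Multiplication by `t`. -/
noncomputable abbrev supportEnd : SupportModule μ →ₗ[K] SupportModule μ :=
  piEnd fun f : μ.support => primaryEnd f.1 (μ f.1)

/-- Outside the support the summands vanish, so the direct sum is a finite product; its parts are
reindexed by their positions in decreasing order. -/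
theorem exists_equiv_supportModule {n : ℕ} {A : GL (Fin n) K} (hA : A ∈ conjClass n μ) :
    ∃ e : (Fin n → K) ≃ₗ[K] SupportModule μ,
      ∀ x, e (Matrix.toLin' (A : Matrix (Fin n) (Fin n) K) x) = supportEnd μ (e x) := by
  classical
  obtain ⟨e⟩ := hA
  choose ε hε using fun lam : IntPartition => lam.exists_equiv_toType
  have hcast : ∀ (f : Phi K) (i : Fin (μ f).length),
      Ideal.span {f.1 ^ ((ε (μ f) i).1 : ℕ)} = Ideal.span {f.1 ^ (μ f).part i} := fun f i => by
    rw [hε]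
  let φ : (⨁ f : Phi K, ⨁ i : (μ f).ToType, (K[X] ⧸ Ideal.span {f.1 ^ (i.1 : ℕ)})) →+
      SupportModule μ :=
    { toFun := fun x f i => Ideal.quotEquivOfEq (hcast f.1 i) (x f.1 (ε (μ f.1) i))
      map_zero' := by
        funext f i
        exact map_zero _
      map_add' := fun x y => by
        funext f i
        exact map_add (Ideal.quotEquivOfEq (hcast f.1 i)) _ _ }
  have hφX : ∀ (p : K[X]) x f i, φ (p • x) f i = mk _ p * φ x f i := by
    intro p x f i
    change Ideal.quotEquivOfEq (hcast f.1 i) (p • x f.1 (ε (μ f.1) i)) = _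
    obtain ⟨r, hr⟩ := Ideal.Quotient.mk_surjective (x f.1 (ε (μ f.1) i))
    change _ = Ideal.Quotient.mk _ p * Ideal.quotEquivOfEq (hcast f.1 i) (x f.1 (ε (μ f.1) i))
    rw [← hr, Ideal.quotEquivOfEq_mk]
    rfl
  have hinj : Function.Injective φ := by
    intro x y hxy
    refine DFinsupp.ext fun f => DFinsupp.ext fun i => ?_
    by_cases hf : f ∈ μ.support
    · have h1 := congrFun (congrFun hxy ⟨f, hf⟩) ((ε (μ f)).symm i)
      change Ideal.quotEquivOfEq (hcast f _) (x f (ε (μ f) ((ε (μ f)).symm i))) =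
        Ideal.quotEquivOfEq (hcast f _) (y f (ε (μ f) ((ε (μ f)).symm i))) at h1
      have h2 := (Ideal.quotEquivOfEq (hcast f _)).injective h1
      rw [Equiv.apply_symm_apply] at h2
      exact h2
    -- Off the support the partition is empty, so there is no index i.
    · rw [Finsupp.notMem_support_iff] at hf
      have h0 : Multiset.count i.1 (μ f) = 0 := by
        simp only [hf, Multiset.count_zero]
      exact absurd (i.2.isLt.trans_eq h0) (Nat.not_lt_zero _)
  have hsurj : Function.Surjective φ := by
    intro y
    let z : ∀ f : μ.support, ∀ i : (μ f.1).ToType, K[X] ⧸ Ideal.span {f.1.1 ^ (i.1 : ℕ)} :=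
      fun f i => Ideal.quotEquivOfEq (by
        rw [← hcast, Equiv.apply_symm_apply]) (y f ((ε (μ f.1)).symm i))
    refine ⟨DFinsupp.mk μ.support fun f => DFinsupp.mk Finset.univ fun i => z f i.1, ?_⟩
    funext f i
    change Ideal.quotEquivOfEq (hcast f.1 i) ((DFinsupp.mk μ.support (fun f =>
      (DFinsupp.mk Finset.univ fun i => z f i.1 :
        ⨁ i : (μ f.1).ToType, (K[X] ⧸ Ideal.span {f.1.1 ^ (i.1 : ℕ)})))
        : ⨁ f : Phi K, ⨁ i : (μ f).ToType, (K[X] ⧸ Ideal.span {f.1 ^ (i.1 : ℕ)})) f.1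
          (ε (μ f.1) i)) = y f i
    rw [DFinsupp.mk_of_mem f.2, DFinsupp.mk_of_mem (Finset.mem_univ _)]
    simp only [z]
    -- The index i' returned by the round trip through `ε` is made a variable, so that it can be
    -- replaced by i inside the dependent types.
    have key : ∀ (i' : Fin (μ f.1).length) (h : Ideal.span {f.1.1 ^ (μ f.1).part i'} =
        Ideal.span {f.1.1 ^ ((ε (μ f.1) i).1 : ℕ)}), i' = i →
        Ideal.quotEquivOfEq (hcast f.1 i) (Ideal.quotEquivOfEq h (y f i')) = y f i := by
      rintro i' h rfl
      obtain ⟨p, hp⟩ := Ideal.Quotient.mk_surjective (y f i')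
      rw [← hp, Ideal.quotEquivOfEq_mk, Ideal.quotEquivOfEq_mk]
    exact key _ _ (Equiv.symm_apply_apply _ _)
  let ψ : (Fin n → K) →ₗ[K] SupportModule μ :=
    { toFun := fun x => φ (e (Module.AEval'.of _ x))
      map_add' := fun x y => by rw [map_add, map_add, map_add]
      map_smul' := fun c x => by
        have h1 : Module.AEval'.of (Matrix.toLin' (A : Matrix (Fin n) (Fin n) K)) (c • x) =
            (C c : K[X]) • Module.AEval'.of _ x := by
          rw [map_smul]
          exact (Module.AEval.C_smul _ _ _).symm
        rw [h1, map_smul]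
        funext f i
        rw [hφX, mk_C, RingHom.id_apply]
        exact (Algebra.smul_def c (φ (e (Module.AEval'.of _ x)) f i)).symm }
  refine ⟨LinearEquiv.ofBijective ψ ⟨?_, ?_⟩, fun x => ?_⟩
  · exact hinj.comp (e.injective.comp (Module.AEval'.of _).injective)
  · exact hsurj.comp (e.surjective.comp (Module.AEval'.of _).surjective)
  · change φ (e (Module.AEval'.of _ (Matrix.toLin' (A : Matrix (Fin n) (Fin n) K) x))) =
      supportEnd μ (φ (e (Module.AEval'.of _ x)))
    have h1 : Module.AEval'.of (Matrix.toLin' (A : Matrix (Fin n) (Fin n) K))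
        (Matrix.toLin' (A : Matrix (Fin n) (Fin n) K) x) = (X : K[X]) • Module.AEval'.of _ x :=
      (Module.AEval'.X_smul_of _ _).symm
    rw [h1, map_smul]
    funext f i
    rw [hφX, mk_X]
    rfl

theorem formCount_eq_supportEnd {n : ℕ} {A : GL (Fin n) K} (hA : A ∈ conjClass n μ) :
    formCount A = invFormCount (supportEnd μ) := by
  obtain ⟨e, he⟩ := exists_equiv_supportModule μ hA
  rw [formCount_eq_invFormCount, invFormCount_congr e he]

/-- The orbit `{f, f*}`. -/
noncomputable def Phi.orbit (f : Phi K) : Sym2 (Phi K) := s(f, f.star)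

theorem Phi.orbit_eq_iff {f g : Phi K} : f.orbit = g.orbit ↔ f = g ∨ f = g.star := by
  rw [orbit, orbit, Sym2.eq_iff]
  constructor
  · rintro (⟨h, -⟩ | ⟨h, -⟩)
    · exact Or.inl h
    · exact Or.inr h
  · rintro (rfl | rfl)
    · exact Or.inl ⟨rfl, rfl⟩
    · exact Or.inr ⟨rfl, Phi.star_star g⟩

theorem invFormCount_supportEnd [DecidableEq (Sym2 (Phi K))] :
    invFormCount (supportEnd μ) = ∏ ω ∈ Finset.univ.image (fun f : μ.support => f.1.orbit),
      invFormCount (piEnd fun f : {f : μ.support // f.1.orbit = ω} =>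
        primaryEnd f.1.1 (μ f.1.1)) := by
  classical
  refine invFormCount_piEnd _ _ fun f g hfg γ hγ => primary_pairing_eq_zero ?_ hγ
  intro h
  refine hfg (Phi.orbit_eq_iff.2 (Or.inr ?_))
  rw [← h, Phi.star_star]

theorem invFormCount_orbit_selfDual {f : Phi K} (hf : f.star = f) (hμ : f ∈ μ.support) :
    invFormCount (piEnd fun g : {g : μ.support // g.1.orbit = f.orbit} =>
      primaryEnd g.1.1 (μ g.1.1)) = invFormCount (primaryEnd f (μ f)) := by
  let a : {g : μ.support // g.1.orbit = f.orbit} := ⟨⟨f, hμ⟩, rfl⟩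
  have ha : ∀ g : {g : μ.support // g.1.orbit = f.orbit}, g = a := by
    rintro ⟨⟨g, hg⟩, h⟩
    have : g = f := by
      rcases Phi.orbit_eq_iff.1 h with h | h
      · exact h
      · exact Eq.trans h hf
    subst this
    rfl
  let _ : Unique {g : μ.support // g.1.orbit = f.orbit} := ⟨⟨a⟩, ha⟩
  refine invFormCount_congr (LinearEquiv.piUnique K
    fun g : {g : μ.support // g.1.orbit = f.orbit} => PrimaryModule g.1.1 (μ g.1.1)) fun x => rfl

/-- As f ≠ f*, neither component carries a nonzero invariant form. Symmetry of μ gives the two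
components the same partition, hence the same size. -/
theorem invFormCount_orbit_pair [Finite K] (hsymm : IsSymmetricMap μ) {f : Phi K}
    (hf : f.star ≠ f) (hμ : f ∈ μ.support) :
    invFormCount (piEnd fun g : {g : μ.support // g.1.orbit = f.orbit} =>
      primaryEnd g.1.1 (μ g.1.1)) =
      invPairingCount (f.mulRoot (μ f).part) (f.star.mulRoot (μ f).part) := by
  classical
  have hμ' : f.star ∈ μ.support := by
    rw [Finsupp.mem_support_iff, ← hsymm f]
    exact Finsupp.mem_support_iff.1 hμ
  let a : {g : μ.support // g.1.orbit = f.orbit} := ⟨⟨f, hμ⟩, rfl⟩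
  let b : {g : μ.support // g.1.orbit = f.orbit} :=
    ⟨⟨f.star, hμ'⟩, Phi.orbit_eq_iff.2 (Or.inr rfl)⟩
  have hab : b ≠ a := fun h => hf (congrArg (fun g => g.1.1) h)
  have hcases : ∀ g, g = a ∨ g = b := by
    rintro ⟨⟨g, hg⟩, h⟩
    rcases Phi.orbit_eq_iff.1 h with h | h
    · exact Or.inl (Subtype.ext (Subtype.ext h))
    · exact Or.inr (Subtype.ext (Subtype.ext h))
  let V : {g : μ.support // g.1.orbit = f.orbit} → Type _ :=
    fun g => PrimaryModule g.1.1 (μ g.1.1)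
  let e : (∀ g, V g) ≃ₗ[K] V a × V b :=
    LinearEquiv.ofBijective ((LinearMap.proj a).prod (LinearMap.proj b)) <| by
      constructor
      · rw [← LinearMap.ker_eq_bot, LinearMap.ker_eq_bot']
        intro x hx
        funext g
        rcases hcases g with rfl | rfl
        · exact congrArg Prod.fst hx
        · exact congrArg Prod.snd hx
      · rintro ⟨x, y⟩
        refine ⟨Pi.single a x + Pi.single b y, ?_⟩
        refine Prod.ext ?_ ?_
        · change (Pi.single a x + Pi.single b y : ∀ g, V g) a = x
          rw [Pi.add_apply, Pi.single_eq_same, Pi.single_eq_of_ne hab.symm, add_zero]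
        · change (Pi.single a x + Pi.single b y : ∀ g, V g) b = y
          rw [Pi.add_apply, Pi.single_eq_same, Pi.single_eq_of_ne hab, zero_add]
  have h1 := invFormCount_congr (T := piEnd fun g : {g : μ.support // g.1.orbit = f.orbit} =>
      primaryEnd g.1.1 (μ g.1.1)) (T' := (primaryEnd f (μ f)).prodMap
        (primaryEnd f.star (μ f.star))) e (fun x => rfl)
  have hfin : ∀ (g : Phi K) (k : ℕ), Finite (AdjoinRoot (g.1 ^ k)) := Phi.finite_adjoinRoot_pow
  rw [h1, ← hsymm f]
  refine invFormCount_prodMap ?_ (fun γ hγ => primary_pairing_eq_zero hf hγ)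
    (fun γ hγ => primary_pairing_eq_zero ?_ hγ)
  · rw [Nat.card_pi, Nat.card_pi]
    refine Finset.prod_congr rfl fun i _ => ?_
    rw [Phi.natCard_adjoinRoot_pow, Phi.natCard_adjoinRoot_pow, Phi.star_deg]
  · rw [Phi.star_star]
    exact hf.symm

end Primary


/-! ### Vanishing for maps that are not symmetric -/

theorem map_aeval_of_intertwine {K V W : Type*} [Field K] [AddCommGroup V] [Module K V]
    [AddCommGroup W] [Module K W] {T : V →ₗ[K] V} {T' : W →ₗ[K] W} (φ : V →ₗ[K] W)
    (h : ∀ x, φ (T x) = T' (φ x)) (p : K[X]) (x : V) : φ (aeval T p x) = aeval T' p (φ x) := by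
  induction p using Polynomial.induction_on' with
  | add p q hp hq =>
    rw [map_add, map_add, LinearMap.add_apply, LinearMap.add_apply, map_add, hp, hq]
  | monomial n a =>
    have hpow : φ ((T ^ n) x) = (T' ^ n) (φ x) := by
      induction n with
      | zero => rfl
      | succ n ih => rw [pow_succ', pow_succ', Module.End.mul_apply, Module.End.mul_apply, h, ih]
    rw [aeval_monomial, aeval_monomial, Module.End.mul_apply, Module.End.mul_apply,
      Module.algebraMap_end_apply, Module.algebraMap_end_apply, map_smul, hpow]

/-- By the adjoint formula and surjectivity of powers of T, ker p(T) is the orthogonal complement of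
the image of the reversed polynomial at T; rank-nullity concludes. -/
theorem finrank_ker_aeval_reverse {K V : Type*} [Field K] [AddCommGroup V] [Module K V]
    [FiniteDimensional K V] {T : V →ₗ[K] V} {β : V →ₗ[K] V →ₗ[K] K}
    (hsymm : ∀ m m', β m m' = β m' m) (hsep : ∀ m, (∀ m', β m m' = 0) → m = 0)
    (hT : ∀ m m', β (T m) (T m') = β m m') (p : K[X]) :
    Module.finrank K (LinearMap.ker (aeval T p)) =
      Module.finrank K (LinearMap.ker (aeval T p.reverse)) := by
  have hinj : Function.Injective T := by
    rw [← LinearMap.ker_eq_bot, LinearMap.ker_eq_bot']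
    intro m hm
    refine hsep m fun m' => ?_
    rw [← hT, hm, map_zero, LinearMap.zero_apply]
  have hsurj : Function.Surjective (T ^ p.natDegree) := by
    rw [Module.End.coe_pow]
    exact (LinearMap.surjective_of_injective hinj).iterate _
  have hnd : LinearMap.BilinForm.Nondegenerate β :=
    ⟨hsep, fun m h => hsep m fun m' => by rw [hsymm, h]⟩
  have hker : LinearMap.ker (aeval T p) =
      LinearMap.BilinForm.orthogonal β (LinearMap.range (aeval T p.reverse)) := by
    ext x
    rw [LinearMap.mem_ker, LinearMap.BilinForm.mem_orthogonal_iff]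
    constructor
    · rintro h _ ⟨y, rfl⟩
      change β _ x = 0
      rw [hsymm, ← pairing_aeval_apply hT, h, map_zero, LinearMap.zero_apply]
    · intro h
      refine hsep _ fun y => ?_
      obtain ⟨z, rfl⟩ := hsurj y
      rw [pairing_aeval_apply hT, hsymm]
      exact h _ ⟨z, rfl⟩
  rw [hker, LinearMap.BilinForm.finrank_orthogonal hnd]
  have := LinearMap.finrank_range_add_finrank_ker (aeval T p.reverse)
  omega

namespace IntPartition

/-- The sum of the parts, truncated at `m`. -/
def truncWeight (lam : IntPartition) (m : ℕ) : ℕ := (lam.map fun d : ℕ+ => min (d : ℕ) m).sum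

/-- The second difference of m ↦ min(a, m) at d ≥ 1 is -1 if a = d and 0 otherwise. Truncated
weights thus determine the multiplicities. -/
theorem two_mul_truncWeight (lam : IntPartition) (d : ℕ+) :
    2 * lam.truncWeight d = lam.truncWeight (d - 1) + lam.truncWeight (d + 1) + lam.count d := by
  have hd := d.pos
  induction lam using Multiset.induction with
  | empty => rfl
  | cons a s ih =>
    simp only [truncWeight, Multiset.map_cons, Multiset.sum_cons, Multiset.count_cons] at ih ⊢
    have ha : d = a ↔ (d : ℕ) = a := PNat.coe_inj.symm
    split_ifs with h
    · rw [ha] at h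
      omega
    · rw [ha] at h
      omega

theorem eq_of_truncWeight_eq {lam nu : IntPartition}
    (h : ∀ m, lam.truncWeight m = nu.truncWeight m) : lam = nu := by
  ext d
  have h1 := lam.two_mul_truncWeight d
  have h2 := nu.two_mul_truncWeight d
  rw [h, h, h] at h1
  omega

end IntPartition

section Asymmetric

open AdjoinRoot

variable {K : Type*} [Field K]

theorem Phi.one_lt_natCard_pow_deg [Finite K] (f : Phi K) : 1 < Nat.card K ^ f.deg :=
  Nat.one_lt_pow f.deg_pos.ne' Finite.one_lt_card

/-- f^m y = 0 means that y is divisible by f^{k-m}; truncated subtraction covers m ≥ k, where every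
y qualifies. The count is that of the kernel of a reduction map. -/
theorem Phi.natCard_ker_pow_mul [Finite K] (f : Phi K) (k m : ℕ) :
    Nat.card {y : AdjoinRoot (f.1 ^ k) // mk _ (f.1 ^ m) * y = 0} =
      (Nat.card K ^ f.deg) ^ min k m := by
  have hd : f.1 ^ (k - m) ∣ f.1 ^ k := pow_dvd_pow _ (Nat.sub_le _ _)
  let φ : AdjoinRoot (f.1 ^ k) →+ AdjoinRoot (f.1 ^ (k - m)) :=
    (factor (f.1 ^ k) (f.1 ^ (k - m)) hd : AdjoinRoot (f.1 ^ k) →+ AdjoinRoot (f.1 ^ (k - m)))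
  have h1 := card_subtype_and_eq_mul φ ⊤ ⊤ (fun _ _ => trivial) (fun y _ =>
    (factor_surjective (hd := hd) y).imp fun x hx => ⟨trivial, hx⟩) (fun _ => True)
  have h2 : ∀ y : AdjoinRoot (f.1 ^ k), mk _ (f.1 ^ m) * y = 0 ↔
      (y ∈ (⊤ : AddSubgroup (AdjoinRoot (f.1 ^ k))) ∧
        φ y = 0) := by
    intro y
    obtain ⟨r, rfl⟩ := mk_surjective y
    change _ ↔ True ∧ factor (f.1 ^ k) (f.1 ^ (k - m)) hd (mk _ r) = 0
    rw [factor_mk, ← map_mul, mk_eq_zero, mk_eq_zero, true_and]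
    rcases le_total k m with h | h
    · rw [Nat.sub_eq_zero_of_le h, pow_zero]
      exact ⟨fun _ => one_dvd _, fun _ => (pow_dvd_pow _ h).mul_right _⟩
    · conv_lhs => rw [show k = m + (k - m) by omega, pow_add]
      exact mul_dvd_mul_iff_left (pow_ne_zero _ f.2.2.1.ne_zero)
  rw [Nat.card_congr (Equiv.subtypeEquivRight h2)]
  have h3 : ∀ G : Type _, [AddCommGroup G] →
      Nat.card {g : G // g ∈ (⊤ : AddSubgroup G) ∧ True} = Nat.card G := fun G _ =>
    Nat.card_congr (Equiv.subtypeUnivEquiv fun _ => ⟨trivial, trivial⟩)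
  rw [h3, h3, natCard_adjoinRoot_pow, natCard_adjoinRoot_pow] at h1
  have h4 : 0 < (Nat.card K ^ f.deg) ^ (k - m) :=
    pow_pos (zero_lt_one.trans f.one_lt_natCard_pow_deg) _
  refine (Nat.eq_of_mul_eq_mul_right h4 ?_).symm
  rw [← h1, ← pow_add]
  congr 1
  omega

theorem Phi.natCard_ker_pow_mul_of_ne {f g : Phi K} (h : f ≠ g) (k m : ℕ) :
    Nat.card {y : AdjoinRoot (g.1 ^ k) // mk _ (f.1 ^ m) * y = 0} = 1 := by
  have hu : IsUnit (mk (g.1 ^ k) (f.1 ^ m)) := by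
    obtain ⟨u, v, huv⟩ := (Phi.isCoprime_of_ne h).pow (m := m) (n := k)
    refine IsUnit.of_mul_eq_one (mk _ u) ?_
    rw [← map_mul, ← map_one (mk (g.1 ^ k)), ← sub_eq_zero, ← map_sub, mk_eq_zero, ← huv]
    exact ⟨-v, by ring⟩
  rw [Nat.card_eq_one_iff_unique]
  exact ⟨⟨fun x y => Subtype.ext ((hu.mul_right_eq_zero.1 x.2).trans
    (hu.mul_right_eq_zero.1 y.2).symm)⟩, ⟨⟨0, mul_zero _⟩⟩⟩

variable [Finite K] (μ : Phi K →₀ IntPartition)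

/-- f acts invertibly on the other components, and a summand of exponent k of its own component
contributes min(k, m). -/
theorem natCard_ker_aeval_supportEnd (f : Phi K) (m : ℕ) :
    Nat.card {x : SupportModule μ // aeval (supportEnd μ) (f.1 ^ m) x = 0} =
      (Nat.card K ^ f.deg) ^ (μ f).truncWeight m := by
  classical
  have h1 : ∀ x : SupportModule μ, aeval (supportEnd μ) (f.1 ^ m) x = 0 ↔
      ∀ g : μ.support, ∀ i, mk (g.1.1 ^ (μ g.1).part i) (f.1 ^ m) * x g i = 0 := by
    intro x
    have h2 : ∀ g : μ.support, ∀ i, aeval (supportEnd μ) (f.1 ^ m) x g i =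
        mk (g.1.1 ^ (μ g.1).part i) (f.1 ^ m) * x g i := by
      intro g i
      rw [← aeval_mulRoot_apply]
      exact congrFun (map_aeval_of_intertwine (T := supportEnd μ)
        (T' := primaryEnd g.1 (μ g.1)) (LinearMap.proj g) (fun y => rfl) (f.1 ^ m) x) i
    constructor
    · intro h g i
      rw [← h2, h]
      rfl
    · intro h
      funext g i
      rw [h2, h]
      rfl
  rw [Nat.card_congr (Equiv.subtypeEquivRight h1), Nat.card_congr (Equiv.subtypePiEquivPi
    (p := fun (g : μ.support) (y : PrimaryModule g.1 (μ g.1)) =>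
      ∀ i, mk (g.1.1 ^ (μ g.1).part i) (f.1 ^ m) * y i = 0)), Nat.card_pi]
  have h3 : ∀ g : μ.support, Nat.card {y : PrimaryModule g.1 (μ g.1) //
      ∀ i, mk (g.1.1 ^ (μ g.1).part i) (f.1 ^ m) * y i = 0} =
      ∏ i, Nat.card {y : AdjoinRoot (g.1.1 ^ (μ g.1).part i) // mk _ (f.1 ^ m) * y = 0} := by
    intro g
    rw [Nat.card_congr (Equiv.subtypePiEquivPi (p := fun i y =>
      mk (g.1.1 ^ (μ g.1).part i) (f.1 ^ m) * y = 0)), Nat.card_pi]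
  by_cases hf : f ∈ μ.support
  · rw [Fintype.prod_eq_single ⟨f, hf⟩, h3]
    · simp only [Phi.natCard_ker_pow_mul]
      rw [Finset.prod_pow_eq_pow_sum, IntPartition.sum_part _ fun d => min d m]
      rfl
    · intro g hg
      rw [h3]
      exact Finset.prod_eq_one fun i _ => Phi.natCard_ker_pow_mul_of_ne
        (fun h => hg (Subtype.ext h.symm)) _ _
  · rw [Finset.prod_eq_one, Finsupp.notMem_support_iff.1 hf]
    · rfl
    · intro g _
      rw [h3]
      exact Finset.prod_eq_one fun i _ => Phi.natCard_ker_pow_mul_of_ne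
        (ne_of_mem_of_not_mem g.2 hf).symm _ _

/-- An invariant form equates the kernel dimensions of f^m and (f*)^m for all m; since deg f = deg
f*, the truncated weights of μ(f) and μ(f*) agree. -/
theorem invFormCount_eq_zero_of_not_symmetric (hμ : ¬ IsSymmetricMap μ) :
    invFormCount (supportEnd μ) = 0 := by
  by_contra hne
  obtain ⟨⟨β, hsymm, hsep, hT⟩⟩ := (Nat.card_ne_zero.1 hne).1
  refine hμ fun f => IntPartition.eq_of_truncWeight_eq fun m => ?_
  have hfin : ∀ (g : Phi K) (k : ℕ), Finite (AdjoinRoot (g.1 ^ k)) := Phi.finite_adjoinRoot_pow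
  have h1 := finrank_ker_aeval_reverse hsymm hsep hT (f.1 ^ m)
  have h2 : LinearMap.ker (aeval (supportEnd μ) (f.1 ^ m).reverse) =
      LinearMap.ker (aeval (supportEnd μ) (f.star.1 ^ m)) := by
    rw [reverse_pow_of_domain, Phi.reverse_eq, mul_pow, ← C_pow]
    ext x
    rw [LinearMap.mem_ker, LinearMap.mem_ker, map_mul, aeval_C, Module.End.mul_apply,
      Module.algebraMap_end_apply, smul_eq_zero, or_iff_right (pow_ne_zero _ f.2.2.2)]
  have h3 : ∀ p : K[X], Nat.card {x : SupportModule μ // aeval (supportEnd μ) p x = 0} =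
      Nat.card K ^ Module.finrank K (LinearMap.ker (aeval (supportEnd μ) p)) := fun p => by
    rw [← Module.natCard_eq_pow_finrank]
    rfl
  have h4 := natCard_ker_aeval_supportEnd μ f m
  have h5 := natCard_ker_aeval_supportEnd μ f.star m
  rw [h3, h1, h2, ← h3, h5, Phi.star_deg] at h4
  exact (Nat.pow_right_injective f.one_lt_natCard_pow_deg h4).symm

end Asymmetric


/-! ### The polynomials of the primary components -/

/-! ### Sums over pairs of parts. -/

section Sums

variable {I : Type*} [Fintype I]

theorem sum_sum_eq_of_symm [LinearOrder I] (g : I → I → ℕ) (hg : ∀ i j, g i j = g j i) :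
    ∑ i, ∑ j, g i j = 2 * (∑ i, ∑ j with j < i, g i j) + ∑ i, g i i := by
  have h1 : ∀ i, ∑ j, g i j = ∑ j with j < i, g i j + (∑ j with i < j, g i j) + g i i := by
    intro i
    rw [Finset.sum_filter, Finset.sum_filter, ← Finset.sum_add_distrib,
      ← (Finset.sum_ite_eq' Finset.univ i (g i)).trans (if_pos (Finset.mem_univ i)),
      ← Finset.sum_add_distrib]
    refine Finset.sum_congr rfl fun j _ => ?_
    rcases lt_trichotomy j i with h | h | h
    · simp [h, h.not_gt, h.ne]
    · simp [h]
    · simp [h, h.not_gt, h.ne']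
  have h2 : ∑ i, ∑ j with i < j, g i j = ∑ i, ∑ j with j < i, g i j := by
    simp only [Finset.sum_filter]
    rw [Finset.sum_comm]
    refine Finset.sum_congr rfl fun i _ => Finset.sum_congr rfl fun j _ => ?_
    rw [hg]
  rw [Finset.sum_congr rfl fun i _ => h1 i, Finset.sum_add_distrib, Finset.sum_add_distrib, h2,
    two_mul]

theorem sum_image_card_mul {M : Type*} [CommSemiring M] (k : I → ℕ) (g : ℕ → M) :
    ∑ a ∈ Finset.univ.image k, (Fintype.card {i // k i = a} : M) * g a = ∑ i, g (k i) := by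
  rw [Finset.sum_comp]
  refine Finset.sum_congr rfl fun a _ => ?_
  rw [Fintype.card_subtype, nsmul_eq_mul]

/-- Both sides count ordered pairs of indices with equal parts, on the right split into off-diagonal
and diagonal pairs. -/
theorem sum_image_card_sq [LinearOrder I] (k : I → ℕ) :
    ∑ a ∈ Finset.univ.image k, Fintype.card {i // k i = a} * Fintype.card {i // k i = a} =
      2 * (∑ i, ∑ j with j < i, if k i = k j then 1 else 0) + Fintype.card I := by
  have h := sum_image_card_mul k fun a => Fintype.card {i // k i = a}
  simp only [Nat.cast_id] at h
  rw [h]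
  have h1 : ∀ i, Fintype.card {j // k j = k i} = ∑ j, if k i = k j then 1 else 0 := fun i => by
    rw [Fintype.card_subtype, Finset.card_filter]
    simp only [eq_comm]
  rw [Finset.sum_congr rfl fun i _ => h1 i, sum_sum_eq_of_symm _ fun i j => by simp only [eq_comm]]
  simp

theorem sum_subExp [LinearOrder I] (k : I → ℕ) :
    ∑ i, ∑ j, Uniformized.subExp k i j =
      2 * (∑ i, ∑ j with j < i, Uniformized.subExp k i j) + ∑ i, (k i - 1) := by
  rw [sum_sum_eq_of_symm _ fun i j => Uniformized.Involution.subExp_comm i j]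
  simp only [Uniformized.subExp_of_eq]

/-- For j < i the smaller part is k_i, and `subExp` falls one short of it exactly when k_i = k_j;
the index i has i predecessors. -/
theorem sum_subExp_add {n : ℕ} {k : Fin n → ℕ} (hk : ∀ i, 0 < k i) (hanti : Antitone k) :
    (∑ i, ∑ j with j < i, Uniformized.subExp k i j) +
      (∑ i, ∑ j with j < i, if k i = k j then 1 else 0) = ∑ i : Fin n, (i : ℕ) * k i := by
  rw [← Finset.sum_add_distrib]
  refine Finset.sum_congr rfl fun i _ => ?_
  rw [← Finset.sum_add_distrib]
  have h : ∀ j ∈ Finset.univ.filter (· < i),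
      (Uniformized.subExp k i j + if k i = k j then 1 else 0) = k i := by
    intro j hj
    have h1 := hanti (Finset.mem_filter.1 hj).2.le
    have h2 := hk i
    unfold Uniformized.subExp
    split_ifs <;> omega
  rw [Finset.sum_congr rfl h, Finset.sum_const, smul_eq_mul]
  have hc : (Finset.univ.filter (· < i)).card = i := by
    rw [Finset.filter_gt_eq_Iio, Fin.card_Iio]
  rw [hc]

end Sums

/-! ### Degrees of the terms of the recursion. -/

section NondegSeq

/-- The first term of the recursion dominates: the second has degree exactly one less. The symmetric
case is e = 1, the hermitian case e = 2. -/
theorem isMonicOfDegree_nondegSeq_X {Q : ℤ[X]} {e : ℕ} (he : 0 < e) (hQ : IsMonicOfDegree Q e)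
    (m : ℕ) : IsMonicOfDegree (nondegSeq X Q m) (m + e * m.choose 2) := by
  have hX1 : IsMonicOfDegree (X - 1 : ℤ[X]) 1 := by
    simpa using isMonicOfDegree_X_sub_one (1 : ℤ)
  induction m using nondegSeq.induct with
  | case1 => simp [nondegSeq]
  | case2 => simpa [nondegSeq] using hX1
  | case3 m h1 h2 =>
    have hQ1 : IsMonicOfDegree (Q ^ (m + 1) - 1) (e * (m + 1)) :=
      (hQ.pow (m + 1)).sub (by rw [natDegree_one]; positivity)
    have h3 : (m + 1).choose 2 = m + m.choose 2 := by rw [Nat.choose_succ_succ', Nat.choose_one_right]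
    have h4 : (m + 2).choose 2 = m + 1 + (m + 1).choose 2 := by
      rw [Nat.choose_succ_succ', Nat.choose_one_right]
    have h5 := (hX1.mul (hQ.pow (m + 1))).mul h1
    have h6 := hQ1.mul (((isMonicOfDegree_X ℤ).mul (hQ.pow m)).mul h2)
    have h7 : 1 + e * (m + 1) + (m + 1 + e * (m + 1).choose 2) = m + 2 + e * (m + 2).choose 2 := by
      rw [h4]; ring
    rw [h7] at h5
    rw [nondegSeq]
    refine h5.add_right ?_
    rw [h6.natDegree_eq, ← h7, h3]
    nlinarith

/-- For s = 1 the first term drops out and the recursion goes in steps of two from the value 0 at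
size 1: alternating forms in odd dimension are degenerate. -/
theorem nondegSeq_one_of_odd (Q : ℤ[X]) {m : ℕ} (hm : Odd m) : nondegSeq 1 Q m = 0 := by
  obtain ⟨j, rfl⟩ := hm
  induction j with
  | zero => simp [nondegSeq]
  | succ j ih =>
    rw [show 2 * (j + 1) + 1 = 2 * j + 1 + 2 by ring, nondegSeq, ih]
    ring

theorem isMonicOfDegree_nondegSeq_one {m : ℕ} (hm : Even m) :
    IsMonicOfDegree (nondegSeq 1 (X : ℤ[X]) m) (m.choose 2) := by
  obtain ⟨j, rfl⟩ := hm.two_dvd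
  induction j with
  | zero => simp [nondegSeq]
  | succ j ih =>
    have h1 : IsMonicOfDegree (X ^ (2 * j + 1) - 1 : ℤ[X]) (2 * j + 1) :=
      (isMonicOfDegree_X_pow ℤ _).sub (by rw [natDegree_one]; positivity)
    rw [show 2 * (j + 1) = 2 * j + 2 by ring, nondegSeq, sub_self, zero_mul, zero_mul, zero_add,
      one_mul]
    have h2 := h1.mul ((isMonicOfDegree_X_pow ℤ (2 * j)).mul (ih (even_two_mul j)))
    convert h2 using 1
    rw [Nat.choose_succ_succ', Nat.choose_one_right, Nat.choose_succ_succ', Nat.choose_one_right]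

theorem Polynomial.IsMonicOfDegree.prod {ι : Type*} (s : Finset ι) {p : ι → ℤ[X]} {n : ι → ℕ}
    (h : ∀ i ∈ s, IsMonicOfDegree (p i) (n i)) :
    IsMonicOfDegree (∏ i ∈ s, p i) (∑ i ∈ s, n i) := by
  classical
  induction s using Finset.induction_on with
  | empty => simp
  | insert a s ha ih =>
    rw [Finset.prod_insert ha, Finset.sum_insert ha]
    exact (h a (Finset.mem_insert_self a s)).mul
      (ih fun i hi => h i (Finset.mem_insert_of_mem hi))

end NondegSeq

namespace IntPartition

variable (lam : IntPartition)

/-- The number of indices of the parts equal to `a`. -/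
def mult (a : ℕ) : ℕ := Fintype.card {i // lam.part i = a}

/-- The polynomial counting the forms on the primary component of `t - 1` or `t + 1`. -/
noncomputable def linearPoly : ℤ[X] :=
  X ^ (∑ i, ∑ j with j < i, Uniformized.subExp lam.part i j) * (∏ i, X ^ (lam.part i / 2)) *
    ∏ a ∈ Finset.univ.image lam.part, nondegSeq (if Odd a then X else 1) X (lam.mult a)

/-- The polynomial in `q ^ d` counting the forms on the primary component of a self-dual `f` of
degree `2 d`. -/
noncomputable def selfDualPoly : ℤ[X] :=
  (X ^ 2) ^ (∑ i, ∑ j with j < i, Uniformized.subExp lam.part i j) *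
    (∏ i, X ^ (lam.part i - 1)) *
    ∏ a ∈ Finset.univ.image lam.part, nondegSeq X (X ^ 2) (lam.mult a)

/-- The polynomial in `q ^ d` counting the forms on the primary components of a pair `{f, f*}` of
polynomials of degree `d`. -/
noncomputable def pairPoly : ℤ[X] :=
  X ^ (∑ i, ∑ j, Uniformized.subExp lam.part i j) * ∏ a ∈ Finset.univ.image lam.part,
    ∏ i : Fin (lam.mult a), (X ^ lam.mult a - X ^ (i : ℕ))

theorem antitone_part : Antitone lam.part := fun i j hij => by
  have h : lam.sortedParts.Pairwise fun a b => b ≤ a := Multiset.pairwise_sort _ _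
  rcases hij.eq_or_lt with rfl | hij
  · exact le_rfl
  · exact List.pairwise_iff_get.1 h i j hij

theorem weight_eq : lam.weight = ∑ i, lam.part i := (lam.sum_part fun d => d).symm

theorem lengthOdd_eq : lam.lengthOdd = ∑ i, if Odd (lam.part i) then 1 else 0 := by
  rw [lam.sum_part fun d => if Odd d then 1 else 0, lengthOdd]
  induction lam using Multiset.induction with
  | empty => rfl
  | cons a s ih =>
    rw [Multiset.countP_cons, Multiset.map_cons, Multiset.sum_cons, ih, add_comm]

theorem sum_subExp_part : (∑ i, ∑ j with j < i, Uniformized.subExp lam.part i j) +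
    (∑ i, ∑ j with j < i, if lam.part i = lam.part j then 1 else 0) = lam.nStat :=
  sum_subExp_add lam.part_pos lam.antitone_part

theorem sum_mult_sq : ∑ a ∈ Finset.univ.image lam.part, lam.mult a * lam.mult a =
    2 * (∑ i, ∑ j with j < i, if lam.part i = lam.part j then 1 else 0) + lam.length :=
  (sum_image_card_sq lam.part).trans (by rw [Fintype.card_fin])

theorem sum_part_sub_one : ∑ i, (lam.part i - 1) + lam.length = lam.weight := by
  rw [weight_eq]
  have h : lam.length = ∑ _i : Fin lam.length, 1 := by simp
  conv_lhs => rhs; rw [h]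
  rw [← Finset.sum_add_distrib]
  exact Finset.sum_congr rfl fun i _ => Nat.sub_add_cancel (lam.part_pos i)

/-- A block of size m has degree m², and the sum of these squares restores what `subExp` loses at
equal parts and k_i - 1 on the diagonal. -/
theorem isMonicOfDegree_selfDualPoly :
    IsMonicOfDegree lam.selfDualPoly (2 * lam.nStat + lam.weight) := by
  have h := ((((isMonicOfDegree_X_pow ℤ 2).pow
    (∑ i, ∑ j with j < i, Uniformized.subExp lam.part i j)).mul
    (IsMonicOfDegree.prod Finset.univ fun i _ => isMonicOfDegree_X_pow ℤ (lam.part i - 1))).mul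
    (IsMonicOfDegree.prod (Finset.univ.image lam.part) fun a _ =>
      isMonicOfDegree_nondegSeq_X two_pos (isMonicOfDegree_X_pow ℤ 2) (lam.mult a)))
  refine ⟨h.natDegree_eq.trans ?_, h.monic⟩
  have h1 : ∀ m : ℕ, m + 2 * m.choose 2 = m * m := fun m => by
    induction m with
    | zero => rfl
    | succ m ih => rw [Nat.choose_succ_succ', Nat.choose_one_right]; nlinarith
  simp only [h1]
  have h2 := lam.sum_subExp_part
  have h3 := lam.sum_mult_sq
  have h4 := lam.sum_part_sub_one
  omega

/-- The order of GL_m also has degree m², and summing over ordered pairs yields the same total as in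
the hermitian case. -/
theorem isMonicOfDegree_pairPoly :
    IsMonicOfDegree lam.pairPoly (2 * lam.nStat + lam.weight) := by
  have h := (isMonicOfDegree_X_pow ℤ (∑ i, ∑ j, Uniformized.subExp lam.part i j)).mul
    (IsMonicOfDegree.prod (Finset.univ.image lam.part) fun a _ =>
      IsMonicOfDegree.prod (Finset.univ : Finset (Fin (lam.mult a))) fun i _ =>
        (isMonicOfDegree_X_pow ℤ (lam.mult a)).sub (q := X ^ (i : ℕ))
          (by rw [natDegree_X_pow]; exact i.2))
  refine ⟨h.natDegree_eq.trans ?_, h.monic⟩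
  simp only [Finset.sum_const, Finset.card_univ, Fintype.card_fin, smul_eq_mul]
  have h2 := lam.sum_subExp_part
  have h3 := lam.sum_mult_sq
  have h4 := lam.sum_part_sub_one
  have h5 := sum_subExp lam.part
  omega

theorem even_mult (h : ∀ d : ℕ+, Even (d : ℕ) → Even (lam.count d)) {a : ℕ}
    (ha : a ∈ Finset.univ.image lam.part) (hae : ¬ Odd a) : Even (lam.mult a) := by
  obtain ⟨i, -, rfl⟩ := Finset.mem_image.1 ha
  have := h ⟨lam.part i, lam.part_pos i⟩ (Nat.not_odd_iff_even.1 hae)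
  have hm : lam.mult (lam.part i) = lam.count ⟨lam.part i, lam.part_pos i⟩ := lam.card_part_eq _
  rwa [hm]

/-- Twice the degree of a block of size m is m² + m for odd and m² - m for even part size, while
2⌊k/2⌋ loses one for each odd part k. Together this leaves one copy of ℓ_odd. -/
theorem exists_isMonicOfDegree_linearPoly
    (h : ∀ d : ℕ+, Even (d : ℕ) → Even (lam.count d)) :
    ∃ D, IsMonicOfDegree lam.linearPoly D ∧ 2 * D = 2 * lam.nStat + lam.weight + lam.lengthOdd := by
  have h1 := (((isMonicOfDegree_X_pow ℤ
    (∑ i, ∑ j with j < i, Uniformized.subExp lam.part i j)).mul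
    (IsMonicOfDegree.prod Finset.univ fun i _ => isMonicOfDegree_X_pow ℤ (lam.part i / 2))).mul
    (IsMonicOfDegree.prod (Finset.univ.image lam.part)
      (p := fun a => nondegSeq (if Odd a then X else 1) X (lam.mult a))
      (n := fun a => (if Odd a then lam.mult a else 0) + (lam.mult a).choose 2) fun a ha => by
        split_ifs with hao
        · simpa using isMonicOfDegree_nondegSeq_X one_pos (isMonicOfDegree_X ℤ) (lam.mult a)
        · simpa using isMonicOfDegree_nondegSeq_one (lam.even_mult h ha hao)))
  refine ⟨_, h1, ?_⟩
  have hc : ∀ m : ℕ, 2 * m.choose 2 + m = m * m := fun m => by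
    induction m with
    | zero => rfl
    | succ m ih => rw [Nat.choose_succ_succ', Nat.choose_one_right]; nlinarith
  have h2 := lam.sum_subExp_part
  have h3 := lam.sum_mult_sq
  have h4 : 2 * (∑ a ∈ Finset.univ.image lam.part,
      ((if Odd a then lam.mult a else 0) + (lam.mult a).choose 2)) + lam.length =
      2 * lam.lengthOdd + ∑ a ∈ Finset.univ.image lam.part, lam.mult a * lam.mult a := by
    have h5 := sum_image_card_mul lam.part fun _ => (1 : ℕ)
    have h6 := sum_image_card_mul lam.part fun a => if Odd a then (1 : ℕ) else 0
    rw [← lengthOdd_eq] at h6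
    rw [Finset.sum_const, Finset.card_univ, Fintype.card_fin, smul_eq_mul, mul_one] at h5
    rw [← h6]
    nth_rw 4 [← h5]
    rw [Finset.mul_sum, Finset.mul_sum, ← Finset.sum_add_distrib, ← Finset.sum_add_distrib]
    refine Finset.sum_congr rfl fun a _ => ?_
    have := hc (lam.mult a)
    simp only [Nat.cast_id, mult] at this ⊢
    split_ifs <;> linarith
  have h7 : 2 * (∑ i, lam.part i / 2) + lam.lengthOdd = lam.weight := by
    rw [lengthOdd_eq, weight_eq, Finset.mul_sum, ← Finset.sum_add_distrib]
    refine Finset.sum_congr rfl fun i _ => ?_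
    split_ifs with ho
    · exact Nat.two_mul_div_two_add_one_of_odd ho
    · exact Nat.two_mul_div_two_of_even (Nat.not_odd_iff_even.1 ho)
  omega

/-- The offending even part has an alternating block of odd size, whose factor is 0. -/
theorem linearPoly_eq_zero (h : ¬ ∀ d : ℕ+, Even (d : ℕ) → Even (lam.count d)) :
    lam.linearPoly = 0 := by
  push Not at h
  obtain ⟨d, hd, hc⟩ := h
  have hm : lam.mult d = lam.count d := lam.card_part_eq d
  have hmem : (d : ℕ) ∈ Finset.univ.image lam.part := by
    by_contra hne
    have : lam.mult d = 0 := by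
      rw [mult, Fintype.card_eq_zero_iff]
      exact ⟨fun i => hne (Finset.mem_image.2 ⟨i.1, Finset.mem_univ _, i.2⟩)⟩
    rw [hm] at this
    rw [this] at hc
    exact hc (by simp)
  rw [linearPoly, Finset.prod_eq_zero hmem, mul_zero]
  rw [if_neg (Nat.not_odd_iff_even.2 hd), hm]
  exact nondegSeq_one_of_odd _ (Nat.not_even_iff_odd.1 hc)

/-- Makes t ∓ 1 contribute a trivial factor when it lies outside the support. -/
theorem linearPoly_zero : linearPoly 0 = 1 := by
  have h0 : IsEmpty (Fin (length 0)) := by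
    have : length 0 = 0 := by simp [length, sortedParts]
    rw [this]
    infer_instance
  simp [linearPoly]

end IntPartition

/-! ### Evaluation of the polynomials at the size of the field. -/

section Evaluation

variable {K : Type*} [Field K] [Finite K] (f : Phi K) (lam : IntPartition)

theorem invFormCount_primaryEnd_linear (h2 : (2 : K) ≠ 0) (hf : f.star = f) (hdeg : f.deg = 1) :
    (invFormCount (primaryEnd f lam) : ℤ) = lam.linearPoly.eval (Nat.card K : ℤ) := by
  rw [Phi.invFormCount_mulRoot_linear f h2 hf hdeg lam.part_pos, IntPartition.linearPoly, eval_mul,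
    eval_mul, eval_pow, eval_X, eval_prod, eval_prod]
  congr 1
  · simp only [eval_pow, eval_X]
  · refine Finset.prod_congr rfl fun a _ => ?_
    have := map_nondegSeq (evalRingHom (Nat.card K : ℤ)) (if Odd a then X else 1) X (lam.mult a)
    rw [coe_evalRingHom] at this
    rw [this, eval_X, apply_ite (eval (Nat.card K : ℤ)), eval_X, eval_one]
    rfl

theorem invFormCount_primaryEnd_selfDual (h2 : (2 : K) ≠ 0) (hf : f.star = f) {d : ℕ}
    (hd : f.deg = 2 * d) : (invFormCount (primaryEnd f lam) : ℤ) =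
      (lam.selfDualPoly.comp (X ^ d)).eval (Nat.card K : ℤ) := by
  rw [Phi.invFormCount_mulRoot_selfDual f h2 hf hd lam.part_pos, eval_comp,
    IntPartition.selfDualPoly, eval_mul, eval_mul, eval_pow, eval_pow, eval_pow, eval_X, eval_X,
    eval_prod, eval_prod]
  congr 1
  · simp only [eval_pow, eval_X]
  · refine Finset.prod_congr rfl fun a _ => ?_
    have := map_nondegSeq (evalRingHom ((Nat.card K : ℤ) ^ d)) X (X ^ 2) (lam.mult a)
    rw [coe_evalRingHom] at this
    rw [this, eval_pow, eval_X]
    rfl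

theorem invPairingCount_primaryEnd :
    (invPairingCount (primaryEnd f lam) (primaryEnd f.star lam) : ℤ) =
      (lam.pairPoly.comp (X ^ f.deg)).eval (Nat.card K : ℤ) := by
  rw [Phi.invPairingCount_mulRoot f lam.part_pos, eval_comp, IntPartition.pairPoly, eval_mul,
    eval_pow, eval_pow, eval_X, eval_X, eval_prod]
  push_cast
  congr 1
  refine Finset.prod_congr rfl fun a _ => ?_
  rw [eval_prod]
  refine Finset.prod_congr rfl fun i _ => ?_
  -- The natural subtraction is a true one, since i is smaller than the multiplicity.
  rw [eval_sub, eval_pow, eval_pow, eval_X, Nat.cast_sub (Nat.pow_le_pow_right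
    (zero_lt_one.trans f.one_lt_natCard_pow_deg) i.2.le)]
  push_cast
  rfl

end Evaluation


/-! ### The polynomial of a symmetric type -/

namespace SymType

/-- The multiplicity of `d` in `η_s(lam)`. -/
def selfDualMult (η : SymType) (b : IntPartition × ℕ) : ℕ :=
  if h : b.1 ≠ 0 ∧ 0 < b.2 then η.selfDual ⟨b.1, h.1⟩ ⟨b.2, h.2⟩ else 0

/-- The multiplicity of `d` in `η_p(lam)`. -/
def pairMult (η : SymType) (b : IntPartition × ℕ) : ℕ :=
  if h : b.1 ≠ 0 ∧ 0 < b.2 then η.pairs ⟨b.1, h.1⟩ ⟨b.2, h.2⟩ else 0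

/-- The polynomial counting the nondegenerate symmetric forms preserved by a matrix of symmetric
type `η`. -/
noncomputable def formPoly (η : SymType) : ℤ[X] :=
  η.plus.linearPoly * η.minus.linearPoly *
    (∏ᶠ b : IntPartition × ℕ, (b.1.selfDualPoly.comp (X ^ b.2)) ^ η.selfDualMult b) *
    ∏ᶠ b : IntPartition × ℕ, (b.1.pairPoly.comp (X ^ b.2)) ^ η.pairMult b

end SymType

/-- Groups a finite product by the value of `key`. The exponents vanish off the image of S, so the
`∏ᶠ` in `formPoly` are finite products for the type of an actual μ. -/
theorem finprod_pow_eq_prod {ι κ M : Type*} [CommMonoid M] [DecidableEq κ] (S : Finset ι)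
    (key : ι → κ) (g : κ → M) (c : κ → ℕ)
    (hc : ∀ b, c b = (S.filter fun a => key a = b).card) :
    ∏ᶠ b, g b ^ c b = ∏ a ∈ S, g (key a) := by
  rw [Finset.prod_comp, finprod_eq_prod_of_mulSupport_subset (s := S.image key)]
  · exact Finset.prod_congr rfl fun b _ => by rw [hc]
  · intro b hb
    by_contra hne
    refine hb ?_
    have : (S.filter fun a => key a = b) = ∅ := by
      rw [Finset.filter_eq_empty_iff]
      exact fun a ha h => hne (Finset.mem_coe.2 (Finset.mem_image.2 ⟨a, ha, h⟩))
    change g b ^ c b = 1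
    rw [hc, this, Finset.card_empty, pow_zero]

namespace Phi

variable {K : Type*} [Field K]

theorem orbit_star (f : Phi K) : f.star.orbit = f.orbit := orbit_eq_iff.2 (Or.inr rfl)

/-- A representative of an orbit. -/
noncomputable def rep (ω : Sym2 (Phi K)) : Phi K := (Quot.out ω).1

theorem rep_orbit (f : Phi K) : rep f.orbit = f ∨ rep f.orbit = f.star :=
  Sym2.mem_iff.1 (Sym2.out_fst_mem f.orbit)

theorem rep_orbit_of_selfDual {f : Phi K} (hf : f.star = f) : rep f.orbit = f :=
  f.rep_orbit.elim id fun h => h.trans hf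

theorem orbit_rep_orbit (f : Phi K) : (rep f.orbit).orbit = f.orbit := by
  rcases f.rep_orbit with h | h
  · rw [h]
  · rw [h, orbit_star]

theorem star_linear {a : Kˣ} (ha : a⁻¹ = a) : (linear a).star = linear a := by
  have h0 : (a : K) ≠ 0 := a.ne_zero
  have h1 : (a : K) * a = 1 := by
    rw [← Units.val_mul, ← Units.val_one]
    refine congrArg _ ?_
    nth_rw 2 [← ha]
    exact mul_inv_cancel a
  refine Subtype.ext ?_
  change C ((X - C (a : K)).coeff 0)⁻¹ * (X - C (a : K)).reverse = X - C (a : K)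
  have h2 : (X - C (a : K)).reverse = 1 - C (a : K) * X := by
    rw [reverse, natDegree_X_sub_C, reflect_sub, reflect_one_X, reflect_C, pow_one]
  rw [h2, coeff_sub, coeff_X_zero, coeff_C_zero, zero_sub, mul_sub, mul_one, ← mul_assoc, ← C_mul,
    inv_neg, neg_mul, inv_mul_cancel₀ h0, ← eq_inv_of_mul_eq_one_left h1, C_neg, C_neg, C_1]
  ring

theorem deg_linear (a : Kˣ) : (linear a).deg = 1 := natDegree_X_sub_C _

/-- Comparing constant terms in f = f* gives f(0)⁻¹ = f(0), so f(0) = ±1. -/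
theorem eq_linear_of_selfDual {f : Phi K} (hf : f.star = f) (hdeg : f.deg = 1) :
    f = linear 1 ∨ f = linear (-1) := by
  have hd : f.1.natDegree = 1 := hdeg
  have h1 : f.1 = X + C (f.1.coeff 0) := f.2.1.eq_X_add_C hd
  have h2 : C (f.1.coeff 0)⁻¹ * f.1.reverse = f.1 := congrArg Subtype.val hf
  have h3 : (f.1.coeff 0)⁻¹ = f.1.coeff 0 := by
    have := congrArg (fun p => coeff p 0) h2
    simpa [f.2.1.leadingCoeff] using this
  have h4 : f.1.coeff 0 * f.1.coeff 0 = 1 := by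
    nth_rw 1 [← h3]
    exact inv_mul_cancel₀ f.2.2.2
  rcases mul_self_eq_one_iff.1 h4 with h | h
  · right
    refine Subtype.ext ?_
    rw [h1, h]
    simp [linear]
  · left
    refine Subtype.ext ?_
    rw [h1, h]
    simp [linear, sub_eq_add_neg]

theorem linear_one_ne (h2 : (2 : K) ≠ 0) : linear (1 : Kˣ) ≠ linear (-1) := by
  intro h
  have := congrArg (fun f : Phi K => f.1.coeff 0) h
  simp only [linear, coeff_sub, coeff_X_zero, coeff_C_zero, Units.val_one, Units.val_neg] at this
  refine h2 ?_
  linear_combination -this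

end Phi

/-! ### Assembly over the orbits {f, f*}. -/

section Assembly

variable {K : Type*} [Field K] (μ : Phi K →₀ IntPartition)

open Classical in
/-- The orbits of the duality that meet the support of `μ`. -/
noncomputable def orbits : Finset (Sym2 (Phi K)) := μ.support.image Phi.orbit

open Classical in
/-- The polynomial counting the forms on the components of the orbit of `f`. -/
noncomputable def orbitPoly (f : Phi K) : ℤ[X] :=
  if f.star = f then
    if f.deg = 1 then (μ f).linearPoly else (μ f).selfDualPoly.comp (X ^ (f.deg / 2))
  else (μ f).pairPoly.comp (X ^ f.deg)

variable {μ}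

theorem mem_orbits {ω : Sym2 (Phi K)} : ω ∈ orbits μ ↔ ∃ f ∈ μ.support, f.orbit = ω := by
  classical
  rw [orbits]
  exact Finset.mem_image

theorem IsSymmetricMap.star_mem_support (hμ : IsSymmetricMap μ) {f : Phi K} :
    f.star ∈ μ.support ↔ f ∈ μ.support := by
  rw [Finsupp.mem_support_iff, Finsupp.mem_support_iff, ← hμ f]

/-- The chosen representative is f or f*; the data that enter the factor of an orbit do not depend
on this choice. -/
theorem IsSymmetricMap.rep_orbit (hμ : IsSymmetricMap μ) (f : Phi K) :
    μ (Phi.rep f.orbit) = μ f ∧ (Phi.rep f.orbit).deg = f.deg ∧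
      ((Phi.rep f.orbit).star = Phi.rep f.orbit ↔ f.star = f) := by
  rcases f.rep_orbit with h | h
  · rw [h]
    exact ⟨rfl, rfl, Iff.rfl⟩
  · rw [h, Phi.star_deg, Phi.star_star]
    exact ⟨(hμ f).symm, rfl, eq_comm⟩

theorem IsSymmetricMap.rep_spec (hμ : IsSymmetricMap μ) {ω : Sym2 (Phi K)} (hω : ω ∈ orbits μ) :
    Phi.rep ω ∈ μ.support ∧ (Phi.rep ω).orbit = ω := by
  obtain ⟨f, hf, rfl⟩ := mem_orbits.1 hω
  refine ⟨?_, f.orbit_rep_orbit⟩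
  rw [Finsupp.mem_support_iff, (hμ.rep_orbit f).1]
  exact Finsupp.mem_support_iff.1 hf

theorem invFormCount_supportEnd_eq_eval [Finite K] (h2 : (2 : K) ≠ 0) (hμ : IsSymmetricMap μ) :
    (invFormCount (supportEnd μ) : ℤ) =
      (∏ ω ∈ orbits μ, orbitPoly μ (Phi.rep ω)).eval (Nat.card K : ℤ) := by
  classical
  have himg : Finset.univ.image (fun f : μ.support => f.1.orbit) = orbits μ := by
    ext ω
    rw [mem_orbits, Finset.mem_image]
    exact ⟨fun ⟨f, _, h⟩ => ⟨f.1, f.2, h⟩, fun ⟨f, hf, h⟩ => ⟨⟨f, hf⟩, Finset.mem_univ _, h⟩⟩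
  rw [invFormCount_supportEnd, himg, eval_prod, Nat.cast_prod]
  refine Finset.prod_congr rfl fun ω hω => ?_
  obtain ⟨h1, h3⟩ := hμ.rep_spec hω
  generalize Phi.rep ω = r at h1 h3
  subst h3
  rw [orbitPoly]
  split_ifs with hs hd
  · rw [invFormCount_orbit_selfDual μ hs h1, invFormCount_primaryEnd_linear r _ h2 hs hd]
  · obtain ⟨d, hd'⟩ := r.even_deg_of_selfDual h2 hs hd
    rw [invFormCount_orbit_selfDual μ hs h1, invFormCount_primaryEnd_selfDual r _ h2 hs hd', hd',
      Nat.mul_div_cancel_left _ two_pos]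
  · rw [invFormCount_orbit_pair μ hμ hs h1, invPairingCount_primaryEnd]

/-- Spreads the factor of t - a over all orbits. If t - a is not in the support, no orbit matches
and the factor is that of the empty partition, which is 1. -/
theorem prod_orbits_ite_linear (hμ : IsSymmetricMap μ) {a : Kˣ} (ha : a⁻¹ = a)
    [DecidableEq (Phi K)] :
    ∏ ω ∈ orbits μ, (if Phi.rep ω = Phi.linear a then (μ (Phi.linear a)).linearPoly else 1) =
      (μ (Phi.linear a)).linearPoly := by
  classical
  have hrep := Phi.rep_orbit_of_selfDual (Phi.star_linear ha)
  have h1 : ∀ ω ∈ orbits μ, (if Phi.rep ω = Phi.linear a then (μ (Phi.linear a)).linearPoly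
      else 1) = if ω = (Phi.linear a).orbit then (μ (Phi.linear a)).linearPoly else 1 := by
    intro ω hω
    refine if_congr ⟨fun h => ?_, fun h => ?_⟩ rfl rfl
    · rw [← (hμ.rep_spec hω).2, h]
    · rw [h, hrep]
  rw [Finset.prod_congr rfl h1, Finset.prod_ite_eq']
  split_ifs with h
  · rfl
  · by_cases h0 : μ (Phi.linear a) = 0
    · rw [h0, IntPartition.linearPoly_zero]
    · exact absurd (mem_orbits.2 ⟨_, Finsupp.mem_support_iff.2 h0, rfl⟩) h

/-- A self-dual f is recovered from its orbit. Degree 2d with d ≥ 1 excludes degree one, and any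
other self-dual degree is even, so halving it loses nothing. -/
theorem selfDualMult_symType [Finite K] (h2 : (2 : K) ≠ 0) (hμ : IsSymmetricMap μ)
    [DecidableEq (Phi K)] [DecidableEq (IntPartition × ℕ)] (b : IntPartition × ℕ) :
    (symType μ).selfDualMult b = (((orbits μ).filter fun ω => (Phi.rep ω).star = Phi.rep ω ∧
      (Phi.rep ω).deg ≠ 1).filter fun ω => (μ (Phi.rep ω), (Phi.rep ω).deg / 2) = b).card := by
  classical
  rw [SymType.selfDualMult]
  split_ifs with hb
  · change Set.ncard _ = _
    rw [← Set.ncard_coe_finset]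
    refine Set.ncard_congr (fun f _ => f.orbit) ?_ ?_ ?_
    · rintro f ⟨hs, hd, hlam⟩
      rw [Finset.mem_coe, Finset.mem_filter, Finset.mem_filter, Phi.rep_orbit_of_selfDual hs]
      have hd' : f.deg = 2 * b.2 := hd
      have hlam' : μ f = b.1 := hlam
      refine ⟨⟨mem_orbits.2 ⟨f, ?_, rfl⟩, hs, by omega⟩, ?_⟩
      · rw [Finsupp.mem_support_iff, hlam']
        exact hb.1
      · rw [hlam', hd', Nat.mul_div_cancel_left _ two_pos]
    · rintro f g ⟨hs, -⟩ ⟨hs', -⟩ h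
      rw [← Phi.rep_orbit_of_selfDual hs, h, Phi.rep_orbit_of_selfDual hs']
    · intro ω hω
      rw [Finset.mem_coe, Finset.mem_filter, Finset.mem_filter] at hω
      obtain ⟨⟨h1, hs, hd⟩, h3⟩ := hω
      refine ⟨Phi.rep ω, ⟨hs, ?_, congrArg Prod.fst h3⟩, (hμ.rep_spec h1).2⟩
      obtain ⟨d, hd'⟩ := (Phi.rep ω).even_deg_of_selfDual h2 hs hd
      have h4 : (Phi.rep ω).deg / 2 = b.2 := congrArg Prod.snd h3
      change (Phi.rep ω).deg = 2 * b.2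
      omega
  · refine (Finset.card_eq_zero.2 (Finset.filter_eq_empty_iff.2 fun ω hω h => hb ?_)).symm
    rw [Finset.mem_filter] at hω
    obtain ⟨h1, hs, hd⟩ := hω
    rw [← h]
    refine ⟨Finsupp.mem_support_iff.1 (hμ.rep_spec h1).1, ?_⟩
    have := (Phi.rep ω).deg_pos
    change 0 < (Phi.rep ω).deg / 2
    omega

theorem pairMult_symType (hμ : IsSymmetricMap μ)
    [DecidableEq (Phi K)] [DecidableEq (IntPartition × ℕ)] (b : IntPartition × ℕ) :
    (symType μ).pairMult b = (((orbits μ).filter fun ω => (Phi.rep ω).star ≠ Phi.rep ω).filter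
      fun ω => (μ (Phi.rep ω), (Phi.rep ω).deg) = b).card := by
  classical
  rw [SymType.pairMult]
  split_ifs with hb
  · change Set.ncard _ = _
    rw [← Set.ncard_coe_finset]
    congr 1
    ext ω
    rw [Finset.mem_coe, Finset.mem_filter, Finset.mem_filter]
    constructor
    · rintro ⟨f, hω, hs, hd, hlam⟩
      obtain rfl : ω = f.orbit := hω
      have hd' : f.deg = b.2 := hd
      have hlam' : μ f = b.1 := hlam
      obtain ⟨h1, h3, h4⟩ := hμ.rep_orbit f
      refine ⟨⟨mem_orbits.2 ⟨f, ?_, rfl⟩, fun h => hs (h4.1 h)⟩, ?_⟩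
      · rw [Finsupp.mem_support_iff, hlam']
        exact hb.1
      · rw [h1, h3, hd', hlam']
    · rintro ⟨⟨h1, hs⟩, h3⟩
      exact ⟨Phi.rep ω, (hμ.rep_spec h1).2.symm, hs, congrArg Prod.snd h3, congrArg Prod.fst h3⟩
  · refine (Finset.card_eq_zero.2 (Finset.filter_eq_empty_iff.2 fun ω hω h => hb ?_)).symm
    rw [Finset.mem_filter] at hω
    rw [← h]
    exact ⟨Finsupp.mem_support_iff.1 (hμ.rep_spec hω.1).1, (Phi.rep ω).deg_pos⟩

/-- All four factors become products over the orbits, with 1 wherever they do not apply; at each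
orbit exactly one of them applies. -/
theorem formPoly_symType [Finite K] (h2 : (2 : K) ≠ 0) (hμ : IsSymmetricMap μ) :
    (symType μ).formPoly = ∏ ω ∈ orbits μ, orbitPoly μ (Phi.rep ω) := by
  classical
  rw [SymType.formPoly, finprod_pow_eq_prod _ _ _ _ (selfDualMult_symType h2 hμ),
    finprod_pow_eq_prod _ _ _ _ (pairMult_symType hμ), Finset.prod_filter, Finset.prod_filter]
  change (μ (Phi.linear 1)).linearPoly * (μ (Phi.linear (-1))).linearPoly * _ * _ = _
  rw [← prod_orbits_ite_linear hμ (a := 1) inv_one, ← prod_orbits_ite_linear hμ (a := -1) (by simp),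
    ← Finset.prod_mul_distrib, ← Finset.prod_mul_distrib, ← Finset.prod_mul_distrib]
  refine Finset.prod_congr rfl fun ω _ => ?_
  have hne := Phi.linear_one_ne h2
  generalize Phi.rep ω = r
  rw [orbitPoly]
  by_cases hs : r.star = r
  · by_cases hd : r.deg = 1
    · rcases Phi.eq_linear_of_selfDual hs hd with rfl | rfl
      · simp [hs, hd, hne]
      · simp [hs, hd, hne.symm]
    · have h3 : ∀ a : Kˣ, r ≠ Phi.linear a := fun a h => hd (h ▸ Phi.deg_linear a)
      simp [hs, hd, h3]
  · have h3 : ∀ a : Kˣ, a⁻¹ = a → r ≠ Phi.linear a := fun a ha h => hs (h ▸ Phi.star_linear ha)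
    simp [hs, h3 1 inv_one, h3 (-1) (by simp)]

/-- Twice the contribution of `f` to the degree. -/
noncomputable def degContribution [DecidableEq (Phi K)] (μ : Phi K →₀ IntPartition) (f : Phi K) :
    ℕ :=
  f.deg * (2 * (μ f).nStat + (μ f).weight) +
    if f.star = f ∧ f.deg = 1 then (μ f).lengthOdd else 0

/-- The fibre over ω is {f} or {f, f*}. In the second case twice the degree of the pair polynomial
is the sum of two equal contributions; in the first, the factor 2 cancels the half in deg f / 2 or
clears the halves in the linear case. -/
theorem exists_isMonicOfDegree_orbitPoly [DecidableEq (Phi K)] [DecidableEq (Sym2 (Phi K))]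
    [Finite K] (h2 : (2 : K) ≠ 0) (hμ : IsSymmetricMap μ)
    (hpair : EvenPartsPaired μ) {ω : Sym2 (Phi K)} (hω : ω ∈ orbits μ) :
    ∃ D, IsMonicOfDegree (orbitPoly μ (Phi.rep ω)) D ∧
      2 * D = ∑ f ∈ μ.support with f.orbit = ω, degContribution μ f := by
  obtain ⟨h1, h3⟩ := hμ.rep_spec hω
  generalize Phi.rep ω = r at h1 h3
  subst h3
  rw [orbitPoly]
  by_cases hs : r.star = r
  · have hfib : μ.support.filter (fun f => f.orbit = r.orbit) = {r} := by
      ext f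
      rw [Finset.mem_filter, Finset.mem_singleton, Phi.orbit_eq_iff, hs, or_self]
      exact ⟨fun h => h.2, fun h => ⟨h ▸ h1, h⟩⟩
    rw [hfib, Finset.sum_singleton, if_pos hs, degContribution]
    by_cases hd : r.deg = 1
    · rw [if_pos hd, if_pos ⟨hs, hd⟩, hd, one_mul]
      refine IntPartition.exists_isMonicOfDegree_linearPoly _ fun d hdd => ?_
      rcases Phi.eq_linear_of_selfDual hs hd with rfl | rfl
      · exact (hpair d hdd).1
      · exact (hpair d hdd).2
    · rw [if_neg hd, if_neg fun h => hd h.2, add_zero]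
      obtain ⟨d, hd'⟩ := r.even_deg_of_selfDual h2 hs hd
      have hpos := r.deg_pos
      refine ⟨_, (μ r).isMonicOfDegree_selfDualPoly.comp (n := r.deg / 2) (by omega)
        (isMonicOfDegree_X_pow ℤ _), ?_⟩
      rw [hd', Nat.mul_div_cancel_left _ two_pos]
      ring
  · have hfib : μ.support.filter (fun f => f.orbit = r.orbit) = {r, r.star} := by
      ext f
      rw [Finset.mem_filter, Finset.mem_insert, Finset.mem_singleton, Phi.orbit_eq_iff]
      refine ⟨fun h => h.2, fun h => ⟨?_, h⟩⟩
      rcases h with rfl | rfl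
      · exact h1
      · exact hμ.star_mem_support.2 h1
    rw [hfib, Finset.sum_pair (Ne.symm hs), if_neg hs, degContribution, degContribution,
      if_neg fun h => hs h.1, if_neg fun h => hs (h.1.symm.trans r.star_star),
      Phi.star_deg, ← hμ r]
    refine ⟨_, (μ r).isMonicOfDegree_pairPoly.comp r.deg_pos.ne' (isMonicOfDegree_X_pow ℤ _), ?_⟩
    ring

/-- The term with ℓ_odd survives only at t - 1 and t + 1, which are distinct because 2 ≠ 0; outside
the support it is zero. -/
theorem sum_degContribution [DecidableEq (Phi K)] (h2 : (2 : K) ≠ 0) :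
    ((∑ f ∈ μ.support, degContribution μ f : ℕ) : ℚ) = 2 * degFormula μ := by
  have hodd : ∑ f ∈ μ.support, (if f.star = f ∧ f.deg = 1 then (μ f).lengthOdd else 0) =
      (μ (Phi.linear 1)).lengthOdd + (μ (Phi.linear (-1))).lengthOdd := by
    have h1 : ∀ a : Kˣ, ∑ f ∈ μ.support, (if f = Phi.linear a then (μ f).lengthOdd else 0) =
        (μ (Phi.linear a)).lengthOdd := by
      intro a
      rw [Finset.sum_ite_eq']
      split_ifs with h
      · rfl
      · rw [Finsupp.notMem_support_iff.1 h]
        rfl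
    rw [← h1 1, ← h1 (-1), ← Finset.sum_add_distrib]
    refine Finset.sum_congr rfl fun f _ => ?_
    have hne := Phi.linear_one_ne h2
    by_cases hf : f.star = f ∧ f.deg = 1
    · rcases Phi.eq_linear_of_selfDual hf.1 hf.2 with rfl | rfl
      · rw [if_pos hf, if_pos rfl, if_neg hne, add_zero]
      · rw [if_pos hf, if_pos rfl, if_neg hne.symm, zero_add]
    · have h3 : ∀ a : Kˣ, a⁻¹ = a → f ≠ Phi.linear a := fun a ha h =>
        hf (h ▸ ⟨Phi.star_linear ha, Phi.deg_linear a⟩)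
      rw [if_neg hf, if_neg (h3 1 inv_one), if_neg (h3 (-1) (by simp))]
  simp only [degContribution]
  rw [Finset.sum_add_distrib, hodd, degFormula, mul_add, Finset.mul_sum]
  push_cast
  rw [add_comm]
  congr 1
  · ring
  · exact Finset.sum_congr rfl fun f _ => by ring

theorem monic_formPoly_symType [Finite K] (h2 : (2 : K) ≠ 0) (hμ : IsSymmetricMap μ)
    (hpair : EvenPartsPaired μ) :
    (symType μ).formPoly.Monic ∧ ((symType μ).formPoly.natDegree : ℚ) = degFormula μ := by
  classical
  choose! D hD hD' using fun ω (hω : ω ∈ orbits μ) =>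
    exists_isMonicOfDegree_orbitPoly h2 hμ hpair hω
  have h := IsMonicOfDegree.prod (orbits μ) hD
  rw [← formPoly_symType h2 hμ] at h
  refine ⟨h.monic, ?_⟩
  have h1 : 2 * ∑ ω ∈ orbits μ, D ω = ∑ f ∈ μ.support, degContribution μ f := by
    rw [Finset.mul_sum, Finset.sum_congr rfl hD']
    exact Finset.sum_fiberwise_of_maps_to (fun f hf => mem_orbits.2 ⟨f, hf, rfl⟩) _
  have h3 := sum_degContribution (μ := μ) h2
  rw [← h1, ← h.natDegree_eq] at h3
  push_cast at h3
  linarith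

theorem formPoly_symType_eq_zero (hpair : ¬ EvenPartsPaired μ) : (symType μ).formPoly = 0 := by
  have h : (symType μ).plus.linearPoly = 0 ∨ (symType μ).minus.linearPoly = 0 := by
    by_contra hne
    push Not at hne
    refine hpair fun d hd => ⟨?_, ?_⟩
    · by_contra hc
      exact hne.1 (IntPartition.linearPoly_eq_zero _ fun h => hc (h d hd))
    · by_contra hc
      exact hne.2 (IntPartition.linearPoly_eq_zero _ fun h => hc (h d hd))
  rw [SymType.formPoly]
  rcases h with h | h <;> simp [h]

theorem two_ne_zero_of_odd_card [Fintype K] (h : Odd (Fintype.card K)) : (2 : K) ≠ 0 := by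
  refine Ring.two_ne_zero fun hc => ?_
  have := FiniteField.even_card_of_char_two hc
  rw [Nat.odd_iff] at h
  omega

end Assembly

theorem propositiont :
    ∃ P : SymType → ℤ[X],
      ∀ (K : Type*) [Field K] [Fintype K], Odd (Fintype.card K) →
      ∀ (n : ℕ) (μ : Phi K →₀ IntPartition) (A : GL (Fin n) K), A ∈ conjClass n μ →
        (¬ IsSymmetricMap μ → formCount A = 0) ∧
        (IsSymmetricMap μ →
          (formCount A : ℤ) = (P (symType μ)).eval (Fintype.card K : ℤ) ∧
          (EvenPartsPaired μ →
            (P (symType μ)).Monic ∧ ((P (symType μ)).natDegree : ℚ) = degFormula μ) ∧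
          (¬ EvenPartsPaired μ → P (symType μ) = 0)) := by
  refine ⟨SymType.formPoly, fun K _ _ hK n μ A hA => ?_⟩
  have h2 := two_ne_zero_of_odd_card hK
  rw [formCount_eq_supportEnd μ hA]
  refine ⟨invFormCount_eq_zero_of_not_symmetric μ, fun hμ => ⟨?_, monic_formPoly_symType h2 hμ,
    formPoly_symType_eq_zero⟩⟩
  rw [formPoly_symType h2 hμ, ← Nat.card_eq_fintype_card, invFormCount_supportEnd_eq_eval h2 hμ]
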